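/- Let $n\ge 2$ and let $(M,N,\alpha,\pi)$ be a contact quadruple: $M$ is a smooth $2n$-manifold with a symplectic form $\omega$, $N$ is a smooth $(2n+1)$-manifold, $\alpha$ is a 1-form on $N$ with $\alpha\wedge(d\alpha)^n$ nowhere zero, and $\pi:N\to M$ is a smooth submersion with $d\alpha=\pi^*\omega$. Put $P=N\times\mathbb R$ with coordinate $s$ on $\mathbb R$, let $p_1:P\to N$ be the projection, $p=\pi\circ p_1$, and $\mu=d(e^{2s}p_1^*\alpha)$, a symplectic form on $P$. Let $Z$ be the Reeb field of $\alpha$ ($i(Z)d\alpha=0$, $\alpha(Z)=1$), let $E$ be the vector field on $P$ with $p_{1*}E=Z$, $ds(E)=0$, and for a vector field $X$ on $M$ let $\bar X$ be the vector field on $P$ with $p_*\bar X=X$, $(p_1^*\alpha)(\bar X)=0$, $ds(\bar X)=0$. Let $\nabla$ be a symplectic connection on $(M,\omega)$ (smooth, torsion-free, $\nabla\omega=0$). Curvature conventions: $R(X,Y)Z=\nabla_X\nabla_YZ-\nabla_Y\nabla_XZ-\nabla_{[X,Y]}Z$, $r(X,Y)=\mathrm{Tr}[Z\mapsto R(X,Z)Y]$,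 and $\rho$ is the endomorphism with $r(X,Y)=\omega(X,\rho Y)$. The connection $\nabla$ is of Ricci type if $R$ equals its Ricci part, i.e. $$R(X,Y)Z=\tfrac{1}{2(n+1)}\big(2\omega(X,Y)\rho Z-\omega(Y,Z)\rho X+\omega(X,Z)\rho Y-r(Y,Z)X+r(X,Z)Y\big).$$ **Theorem 4.1.** (a) Let $\hat s$ be a smooth symmetric 2-tensor, $U$ a smooth vector field and $f$ a smooth function on $M$, and let $\sigma$ be the endomorphism with $\hat s(X,Y)=\omega(X,\sigma Y)$. There is exactly one linear connection $\nabla^P$ on $P$ such that, for all smooth vector fields $X,Y$ on $M$, $$\begin{aligned} \nabla^P_{\bar X}\bar Y&=\overline{\nabla_XY}-\tfrac12 p^*(\omega(X,Y))E-p^*(\hat s(X,Y))\partial_s,\\ \nabla^P_E\bar X&=\nabla^P_{\bar X}E=2\,\overline{\sigma X}+p^*(\omega(X,U))\partial_s,\\ \nabla^P_{\partial_s}\bar X&=\nabla^P_{\bar X}\partial_s=\bar X,\qquad \nabla^P_EE=(p^*f)\partial_s-2\bar U,\\ \nabla^P_E\partial_s&=\nabla^P_{\partial_s}E=E,\qquad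 \nabla^P_{\partial_s}\partial_s=\partial_s . \end{aligned}$$ It is a symplectic connection on $(P,\mu)$. The vector field $E$ is affine ($L_E\nabla^P=0$) and symplectic ($L_E\mu=0$); the vector field $\partial_s$ is affine ($L_{\partial_s}\nabla^P=0$) and conformal ($L_{\partial_s}\mu=2\mu$). (b) The choices $$\hat s=-\tfrac{1}{2(n+1)}r,\qquad \omega(U,\cdot)=\tfrac{2}{2n+1}\mathrm{Tr}[Y\mapsto\nabla_Y\sigma],\qquad f=\tfrac{1}{2n(n+1)^2}\mathrm{Tr}(\rho^2)+\tfrac1n\mathrm{Tr}[X\mapsto\nabla_XU]$$ are admissible in (a) (smooth, and $\hat s$ is symmetric). For the resulting connection $\nabla^P$: - $\nabla^P$ is Ricci-flat; - if $\nabla$ is of Ricci type, then $\nabla^P$ is flat; - if $\nabla^P$ is locally symmetric ($\nabla^PR^{\nabla^P}=0$), then $\nabla$ is of Ricci type at every point of $\pi(N)$ (hence on $M$ if $\pi$ is surjective), and $\nabla^P$ is flat. -/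

import Mathlib

open scoped Manifold ContDiff

noncomputable section

namespace SymplecticInduction

section General

variable {E : Type*} [NormedAddCommGroup E] [NormedSpace ℝ E]
  {H : Type*} [TopologicalSpace H] (I : ModelWithCorners ℝ E H)
  {M : Type*} [TopologicalSpace M] [ChartedSpace H M]

/-- Vector fields (no regularity). -/
abbrev VectorField (M : Type*) [TopologicalSpace M] [ChartedSpace H M] : Type _ :=
  Π x : M, TangentSpace I x

/-- 1-forms (no regularity). -/
abbrev OneForm (M : Type*) [TopologicalSpace M] [ChartedSpace H M] : Type _ :=
  Π x : M, TangentSpace I x →L[ℝ] ℝ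

/-- Covariant 2-tensors (no regularity). -/
abbrev TwoTensor (M : Type*) [TopologicalSpace M] [ChartedSpace H M] : Type _ :=
  Π x : M, TangentSpace I x →L[ℝ] TangentSpace I x →L[ℝ] ℝ

/-- Endomorphism fields of the tangent bundle (no regularity). -/
abbrev EndField (M : Type*) [TopologicalSpace M] [ChartedSpace H M] : Type _ :=
  Π x : M, TangentSpace I x →L[ℝ] TangentSpace I x

/-- Linear connections (covariant derivatives on the tangent bundle). Mathlib's argument order:
`D Y x v` is `(∇_v Y)(x)`. -/
abbrev LinearConnection (M : Type*) [TopologicalSpace M] [ChartedSpace H M] [IsManifold I ∞ M] :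
    Type _ :=
  CovariantDerivative I E (TangentSpace I : M → Type _)

variable [IsManifold I ∞ M]

/-- `X` is a smooth vector field. -/
abbrev IsSmoothVF (X : VectorField I M) : Prop :=
  ContMDiff I I.tangent ∞ (fun x => (⟨x, X x⟩ : TangentBundle I M))

/-- The vector field `X` is differentiable at the point `x`. -/
abbrev DiffVFAt (X : VectorField I M) (x : M) : Prop :=
  MDifferentiableAt I I.tangent (fun y => (⟨y, X y⟩ : TangentBundle I M)) x

/-- `α` is a smooth 1-form. -/
abbrev IsSmoothOneForm (α : OneForm I M) : Prop :=
  ContMDiff I (I.prod 𝓘(ℝ, E →L[ℝ] ℝ)) ∞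
    (fun x => Bundle.TotalSpace.mk' (E →L[ℝ] ℝ) (E := fun x : M => TangentSpace I x →L[ℝ] ℝ)
      x (α x))

/-- `s` is a smooth covariant 2-tensor. -/
abbrev IsSmoothTwoTensor (s : TwoTensor I M) : Prop :=
  ContMDiff I (I.prod 𝓘(ℝ, E →L[ℝ] E →L[ℝ] ℝ)) ∞
    (fun x => Bundle.TotalSpace.mk' (E →L[ℝ] E →L[ℝ] ℝ)
      (E := fun x : M => TangentSpace I x →L[ℝ] TangentSpace I x →L[ℝ] ℝ) x (s x))

/-- A symplectic form: a smooth, alternating, nondegenerate, closed 2-form. Closedness is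
`dΩ(X, Y, Z) = 0`, by the invariant formula for the exterior derivative. -/
structure IsSymplecticForm (Ω : TwoTensor I M) : Prop where
  smooth : IsSmoothTwoTensor I Ω
  alternating : ∀ x (v : TangentSpace I x), Ω x v v = 0
  nondegenerate : ∀ x (v : TangentSpace I x), (∀ w, Ω x v w = 0) → v = 0
  closed : ∀ (X Y Z : VectorField I M) (x : M),
    DiffVFAt I X x → DiffVFAt I Y x → DiffVFAt I Z x →
    mvfderiv I (fun y => Ω y (Y y) (Z y)) x (X x)
      + mvfderiv I (fun y => Ω y (Z y) (X y)) x (Y x)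
      + mvfderiv I (fun y => Ω y (X y) (Y y)) x (Z x)
      - Ω x (VectorField.mlieBracket I X Y x) (Z x)
      - Ω x (VectorField.mlieBracket I Y Z x) (X x)
      - Ω x (VectorField.mlieBracket I Z X x) (Y x) = 0

/-- The function `(L_V μ)(X, Y) = V(μ(X, Y)) - μ([V, X], Y) - μ(X, [V, Y])`, where `L_V μ` is the
Lie derivative. -/
def lieDerivTwo (μ : TwoTensor I M) (V X Y : VectorField I M) (x : M) : ℝ :=
  mvfderiv I (fun y => μ y (X y) (Y y)) x (V x)
    - μ x (VectorField.mlieBracket I V X x) (Y x)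
    - μ x (X x) (VectorField.mlieBracket I V Y x)

/-- The curvature operator on vector fields,
`R(X, Y)Z = ∇_X ∇_Y Z - ∇_Y ∇_X Z - ∇_[X,Y] Z`. -/
def curvOp (D : LinearConnection I M) (X Y Z : VectorField I M) : VectorField I M := fun x =>
  D (fun y => D Z y (Y y)) x (X x) - D (fun y => D Z y (X y)) x (Y x)
    - D Z x (VectorField.mlieBracket I X Y x)

/-- `V` is an affine vector field for `∇`: it is smooth and `L_V ∇ = 0`, where
`(L_V ∇)_X Y = [V, ∇_X Y] - ∇_[V,X] Y - ∇_X [V, Y]`. -/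
def IsAffineVF (D : LinearConnection I M) (V : VectorField I M) : Prop :=
  IsSmoothVF I V ∧
  ∀ X Y : VectorField I M, IsSmoothVF I X → IsSmoothVF I Y → ∀ x,
    VectorField.mlieBracket I V (fun y => D Y y (X y)) x
      - D Y x (VectorField.mlieBracket I V X x)
      - D (fun y => VectorField.mlieBracket I V Y y) x (X x) = 0

variable [FiniteDimensional ℝ E]

instance (x : M) : FiniteDimensional ℝ (TangentSpace I x) :=
  inferInstanceAs (FiniteDimensional ℝ E)

instance (x : M) : T2Space (TangentSpace I x) :=
  inferInstanceAs (T2Space E)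

/-- A basis of the tangent space at `x`. -/
def tangentBasis (x : M) :
    Module.Basis (Fin (Module.finrank ℝ (TangentSpace I x))) ℝ (TangentSpace I x) :=
  Module.finBasis ℝ (TangentSpace I x)

/-- Extension of the `i`-th basis vector at `x` to a vector field which is smooth near `x`: it has
constant coefficients in the preferred chart at `x`. These fields form a coordinate frame on the
chart domain. -/
def frame (x : M) (i : Fin (Module.finrank ℝ (TangentSpace I x))) : VectorField I M :=
  FiberBundle.extend E (tangentBasis I x i)

/-- The linear map on the tangent space at `x` with given values on the basis. -/
def ofComponents {F : Type*} [AddCommGroup F] [Module ℝ F] [TopologicalSpace F]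
    [IsTopologicalAddGroup F] [ContinuousSMul ℝ F] (x : M)
    (c : Fin (Module.finrank ℝ (TangentSpace I x)) → F) : TangentSpace I x →L[ℝ] F :=
  LinearMap.toContinuousLinearMap ((tangentBasis I x).constr ℝ c)

/-- The exterior derivative of a 1-form, `dα(X, Y) = X(α(Y)) - Y(α(X)) - α([X, Y])`: the bilinear
form with these components in the coordinate frame. -/
def extDerivOne (α : OneForm I M) : TwoTensor I M := fun x =>
  ofComponents I x fun i => ofComponents I x fun j =>
    mvfderiv I (fun y => α y (frame I x j y)) x (frame I x i x)
      - mvfderiv I (fun y => α y (frame I x i y)) x (frame I x j x)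
      - α x (VectorField.mlieBracket I (frame I x i) (frame I x j) x)

/-- `α` is a contact form on a manifold of dimension `2n + 1`: a smooth 1-form such that
`α ∧ (dα)^n` vanishes nowhere. Up to a nonzero constant factor depending on `n` only,
`(α ∧ (dα)^n)(v₀, …, v_{2n})` is the alternating sum below. -/
def IsContactForm (n : ℕ) (α : OneForm I M) : Prop :=
  IsSmoothOneForm I α ∧
  ∀ x : M, ∃ v : Fin (2 * n + 1) → TangentSpace I x,
    ∑ τ : Equiv.Perm (Fin (2 * n + 1)), ((Equiv.Perm.sign τ : ℤ) : ℝ) *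
      (α x (v (τ 0)) * ∏ i : Fin n,
        extDerivOne I α x (v (τ ⟨2 * i.1 + 1, by omega⟩)) (v (τ ⟨2 * i.1 + 2, by omega⟩))) ≠ 0

/-- The curvature tensor: `curvature I D x u v w = R(u, v)w`. It is the trilinear map whose
components in the coordinate frame are given by the curvature operator. -/
def curvature (D : LinearConnection I M) (x : M) :
    TangentSpace I x →L[ℝ] TangentSpace I x →L[ℝ] TangentSpace I x →L[ℝ] TangentSpace I x :=
  ofComponents I x fun i => ofComponents I x fun j => ofComponents I x fun k =>
    curvOp I D (frame I x i) (frame I x j) (frame I x k) x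

/-- The Ricci tensor, with the sign convention `r(u, v) = Tr[w ↦ R(u, w)v]`. -/
def ricci (D : LinearConnection I M) : TwoTensor I M := fun x =>
  ofComponents I x fun i => ofComponents I x fun j =>
    LinearMap.trace ℝ (TangentSpace I x)
      (((ContinuousLinearMap.coeLM ℝ).comp
        (curvature I D x (tangentBasis I x i)).toLinearMap).flip (tangentBasis I x j))

/-- `∇` is Ricci-flat. -/
def IsRicciFlat (D : LinearConnection I M) : Prop := ∀ x, ricci I D x = 0

/-- `∇` is flat. -/
def IsFlat (D : LinearConnection I M) : Prop := ∀ x, curvature I D x = 0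

/-- `∇` is locally symmetric: `∇R = 0`. -/
def IsLocallySymmetric (D : LinearConnection I M) : Prop :=
  ∀ V X Y Z : VectorField I M,
    IsSmoothVF I V → IsSmoothVF I X → IsSmoothVF I Y → IsSmoothVF I Z → ∀ x,
    D (fun y => curvature I D y (X y) (Y y) (Z y)) x (V x)
      - curvature I D x (D X x (V x)) (Y x) (Z x)
      - curvature I D x (X x) (D Y x (V x)) (Z x)
      - curvature I D x (X x) (Y x) (D Z x (V x)) = 0

/-- A symplectic connection: a smooth torsion-free linear connection with `∇Ω = 0`. -/
structure IsSymplecticConnection (Ω : TwoTensor I M) (D : LinearConnection I M) : Prop where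
  smooth : CovariantDerivative.ContMDiffCovariantDerivative D ∞
  torsion_free : D.torsion = 0
  parallel : ∀ (Y Z : VectorField I M) (x : M), DiffVFAt I Y x → DiffVFAt I Z x →
    ∀ v : TangentSpace I x,
      mvfderiv I (fun y => Ω y (Y y) (Z y)) x v = Ω x (D Y x v) (Z x) + Ω x (Y x) (D Z x v)

/-- The vector field `U` with `Ω(U, ·) = β` (for nondegenerate `Ω`). -/
def symplSharp (Ω : TwoTensor I M) (β : OneForm I M) : VectorField I M := fun x =>
  (Ω x).inverse (β x)

/-- The 2-tensor `(X, Y) ↦ s(Y, X)`. -/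
def flipTwo (s : TwoTensor I M) : TwoTensor I M := fun x =>
  ofComponents I x fun i => ofComponents I x fun j => s x (tangentBasis I x j) (tangentBasis I x i)

/-- The endomorphism field `σ` with `ŝ(X, Y) = Ω(X, σY)` (for `Ω` symplectic). -/
def symplEnd (Ω s : TwoTensor I M) : EndField I M := fun x =>
  -((Ω x).inverse.comp (flipTwo I s x))

/-- The 1-form `Tr[Y ↦ ∇_Y σ]`, that is `X ↦ Tr[Y ↦ (∇_Y σ)X]`, where
`(∇_Y σ)X = ∇_Y(σX) - σ(∇_Y X)`. -/
def traceCovDeriv (D : LinearConnection I M) (σ : EndField I M) : OneForm I M := fun x =>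
  ofComponents I x fun j =>
    LinearMap.trace ℝ (TangentSpace I x)
      (D (fun y => σ y (frame I x j y)) x - (σ x).comp (D (frame I x j) x)).toLinearMap

/-- The endomorphism field `ρ` with `r(X, Y) = Ω(X, ρY)`, where `r` is the Ricci tensor. -/
def ricciEnd (Ω : TwoTensor I M) (D : LinearConnection I M) : EndField I M :=
  symplEnd I Ω (ricci I D)

/-- The component of the curvature of a symplectic connection built from its Ricci tensor alone
(`2n` is the dimension):
`E(X,Y)Z = 1/(2(n+1)) (2Ω(X,Y)ρZ - Ω(Y,Z)ρX + Ω(X,Z)ρY - r(Y,Z)X + r(X,Z)Y)`. -/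
def ricciPart (n : ℕ) (Ω : TwoTensor I M) (D : LinearConnection I M) (x : M)
    (u v w : TangentSpace I x) : TangentSpace I x :=
  (1 / (2 * ((n : ℝ) + 1))) •
    ((2 * Ω x u v) • ricciEnd I Ω D x w - Ω x v w • ricciEnd I Ω D x u
      + Ω x u w • ricciEnd I Ω D x v - ricci I D x v w • u + ricci I D x u w • v)

/-- The component `W = R - E` of the curvature, all of whose traces vanish. -/
def weylPart (n : ℕ) (Ω : TwoTensor I M) (D : LinearConnection I M) (x : M)
    (u v w : TangentSpace I x) : TangentSpace I x :=
  curvature I D x u v w - ricciPart I n Ω D x u v w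

/-- A symplectic connection is of Ricci type on the set `A` if `W = 0` at the points of `A`. -/
def IsRicciTypeOn (n : ℕ) (Ω : TwoTensor I M) (D : LinearConnection I M) (A : Set M) : Prop :=
  ∀ x ∈ A, ∀ u v w : TangentSpace I x, weylPart I n Ω D x u v w = 0

/-- A symplectic connection is of Ricci type if `W = 0`. -/
def IsRicciType (n : ℕ) (Ω : TwoTensor I M) (D : LinearConnection I M) : Prop :=
  IsRicciTypeOn I n Ω D Set.univ

end General

section Quadruple

variable (n : ℕ)
  (M : Type*) [TopologicalSpace M] [ChartedSpace (EuclideanSpace ℝ (Fin (2 * n))) M]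
  [IsManifold (𝓡 (2 * n)) ∞ M]
  (N : Type*) [TopologicalSpace N] [ChartedSpace (EuclideanSpace ℝ (Fin (2 * n + 1))) N]
  [IsManifold (𝓡 (2 * n + 1)) ∞ N]

/-- The contact quadruples `(M, N, α, π)`, with the symplectic form `Ω` on `M` such that
`dα = π^*Ω`. A submersion is a smooth map with surjective differentials; it need not be surjective. -/
structure ContactQuadruple where
  Ω : TwoTensor (𝓡 (2 * n)) M
  symplectic : IsSymplecticForm (𝓡 (2 * n)) Ω
  α : OneForm (𝓡 (2 * n + 1)) N
  contact : IsContactForm (𝓡 (2 * n + 1)) n α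
  π : N → M
  smooth_π : ContMDiff (𝓡 (2 * n + 1)) (𝓡 (2 * n)) ∞ π
  submersion_π : ∀ y, Function.Surjective (mfderiv (𝓡 (2 * n + 1)) (𝓡 (2 * n)) π y)
  dα_eq : ∀ y (v w : TangentSpace (𝓡 (2 * n + 1)) y),
    extDerivOne (𝓡 (2 * n + 1)) α y v w =
      Ω (π y) (mfderiv (𝓡 (2 * n + 1)) (𝓡 (2 * n)) π y v)
        (mfderiv (𝓡 (2 * n + 1)) (𝓡 (2 * n)) π y w)

/-- The model with corners (without boundary) of the product manifold `P = N × ℝ`. -/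
abbrev modelP : ModelWithCorners ℝ (EuclideanSpace ℝ (Fin (2 * n + 1)) × ℝ)
    (ModelProd (EuclideanSpace ℝ (Fin (2 * n + 1))) ℝ) :=
  (𝓡 (2 * n + 1)).prod 𝓘(ℝ, ℝ)

namespace ContactQuadruple

variable {n M N}
variable (Q : ContactQuadruple n M N)

/-- The 1-form `p₁^*α` on `P`. -/
def αP : OneForm (modelP n) (N × ℝ) := fun p =>
  (Q.α p.1).comp (mfderiv (modelP n) (𝓡 (2 * n + 1)) Prod.fst p)

/-- The symplectic form `μ = d(e^{2s} p₁^*α)` on `P`. -/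
def μ : TwoTensor (modelP n) (N × ℝ) :=
  extDerivOne (modelP n) (fun p => Real.exp (2 * p.2) • Q.αP p)

/-- The projection `p = π ∘ p₁ : P → M`. -/
def proj (p : N × ℝ) : M := Q.π p.1

/-- The Reeb vector field `Z` on `N`: `i(Z)dα = 0`, `α(Z) = 1`. -/
def reeb : VectorField (𝓡 (2 * n + 1)) N := fun y =>
  Classical.epsilon fun z : TangentSpace (𝓡 (2 * n + 1)) y =>
    (∀ w, extDerivOne (𝓡 (2 * n + 1)) Q.α y z w = 0) ∧ Q.α y z = 1

/-- The tangent vector to `P = N × ℝ` with components `v` along `N` and `c` along `ℝ`. -/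
def mkTangent (p : N × ℝ) (v : TangentSpace (𝓡 (2 * n + 1)) p.1) (c : ℝ) :
    TangentSpace (modelP n) p :=
  show EuclideanSpace ℝ (Fin (2 * n + 1)) × ℝ from (v, c)

/-- The vector field `E` on `P`: `p₁_* E = Z`, `ds(E) = 0`. -/
def E : VectorField (modelP n) (N × ℝ) := fun p => mkTangent p (Q.reeb p.1) 0

/-- The vector field `S = ∂_s` on `P`. -/
def S (_Q : ContactQuadruple n M N) : VectorField (modelP n) (N × ℝ) := fun p => mkTangent p 0 1

/-- The horizontal lift to `P`, at `p`, of a tangent vector `v` to `M`: the vector `w` with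
`p_* w = v`, `(p₁^*α)(w) = 0`, `ds(w) = 0`. -/
def hlift (p : N × ℝ) (v : TangentSpace (𝓡 (2 * n)) (Q.proj p)) : TangentSpace (modelP n) p :=
  Classical.epsilon fun w : TangentSpace (modelP n) p =>
    mfderiv (modelP n) (𝓡 (2 * n)) Q.proj p w = v ∧ Q.αP p w = 0 ∧
      mvfderiv (modelP n) (Prod.snd : N × ℝ → ℝ) p w = 0

/-- The horizontal lift `X̄` of a vector field `X` on `M`. -/
def lift (X : VectorField (𝓡 (2 * n)) M) : VectorField (modelP n) (N × ℝ) := fun p =>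
  Q.hlift p (X (Q.proj p))

/-- `∇^P` is a linear connection on `P` given by the formulas defining the connection induced
from `∇`, the symmetric 2-tensor `ŝ`, the vector field `U` and the function `f` on `M`. Here
`σ` is the endomorphism with `ŝ(X, Y) = Ω(X, σY)`. -/
structure IsInduced (D : LinearConnection (𝓡 (2 * n)) M) (s : TwoTensor (𝓡 (2 * n)) M)
    (U : VectorField (𝓡 (2 * n)) M) (f : M → ℝ)
    (DP : LinearConnection (modelP n) (N × ℝ)) : Prop where
  lift_lift : ∀ X Y : VectorField (𝓡 (2 * n)) M,
    IsSmoothVF (𝓡 (2 * n)) X → IsSmoothVF (𝓡 (2 * n)) Y → ∀ p : N × ℝ,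
    DP (Q.lift Y) p (Q.lift X p) =
      Q.lift (fun x => D Y x (X x)) p
        - ((1 / 2 : ℝ) * Q.Ω (Q.proj p) (X (Q.proj p)) (Y (Q.proj p))) • Q.E p
        - s (Q.proj p) (X (Q.proj p)) (Y (Q.proj p)) • Q.S p
  E_lift : ∀ X : VectorField (𝓡 (2 * n)) M, IsSmoothVF (𝓡 (2 * n)) X → ∀ p : N × ℝ,
    DP (Q.lift X) p (Q.E p) =
      (2 : ℝ) • Q.lift (fun x => symplEnd (𝓡 (2 * n)) Q.Ω s x (X x)) p
        + Q.Ω (Q.proj p) (X (Q.proj p)) (U (Q.proj p)) • Q.S p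
  lift_E : ∀ X : VectorField (𝓡 (2 * n)) M, IsSmoothVF (𝓡 (2 * n)) X → ∀ p : N × ℝ,
    DP Q.E p (Q.lift X p) =
      (2 : ℝ) • Q.lift (fun x => symplEnd (𝓡 (2 * n)) Q.Ω s x (X x)) p
        + Q.Ω (Q.proj p) (X (Q.proj p)) (U (Q.proj p)) • Q.S p
  S_lift : ∀ X : VectorField (𝓡 (2 * n)) M, IsSmoothVF (𝓡 (2 * n)) X → ∀ p : N × ℝ,
    DP (Q.lift X) p (Q.S p) = Q.lift X p
  lift_S : ∀ X : VectorField (𝓡 (2 * n)) M, IsSmoothVF (𝓡 (2 * n)) X → ∀ p : N × ℝ,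
    DP Q.S p (Q.lift X p) = Q.lift X p
  E_E : ∀ p : N × ℝ, DP Q.E p (Q.E p) = f (Q.proj p) • Q.S p - (2 : ℝ) • Q.lift U p
  E_S : ∀ p : N × ℝ, DP Q.S p (Q.E p) = Q.E p
  S_E : ∀ p : N × ℝ, DP Q.E p (Q.S p) = Q.E p
  S_S : ∀ p : N × ℝ, DP Q.S p (Q.S p) = Q.S p

/-- The choice `ŝ = -r/(2(n+1))`. -/
def specialS (_Q : ContactQuadruple n M N) (D : LinearConnection (𝓡 (2 * n)) M) :
    TwoTensor (𝓡 (2 * n)) M := fun x =>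
  (-1 / (2 * ((n : ℝ) + 1))) • ricci (𝓡 (2 * n)) D x

/-- The choice of `U` with `Ω(U, ·) = 2/(2n+1) Tr[Y ↦ ∇_Y σ]`. -/
def specialU (D : LinearConnection (𝓡 (2 * n)) M) : VectorField (𝓡 (2 * n)) M :=
  symplSharp (𝓡 (2 * n)) Q.Ω fun x =>
    (2 / (2 * (n : ℝ) + 1)) •
      traceCovDeriv (𝓡 (2 * n)) D (symplEnd (𝓡 (2 * n)) Q.Ω (Q.specialS D)) x

/-- The choice `f = 1/(2n(n+1)²) Tr(ρ²) + 1/n Tr[X ↦ ∇_X U]`. -/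
def specialF (D : LinearConnection (𝓡 (2 * n)) M) (x : M) : ℝ :=
  1 / (2 * (n : ℝ) * ((n : ℝ) + 1) ^ 2) *
      LinearMap.trace ℝ (TangentSpace (𝓡 (2 * n)) x)
        ((ricciEnd (𝓡 (2 * n)) Q.Ω D x).comp (ricciEnd (𝓡 (2 * n)) Q.Ω D x)).toLinearMap
    + 1 / (n : ℝ) *
      LinearMap.trace ℝ (TangentSpace (𝓡 (2 * n)) x) (D (Q.specialU D) x).toLinearMap

end ContactQuadruple

end Quadruple

end SymplecticInduction

end

open scoped Manifold ContDiff

noncomputable section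

namespace SymplecticInduction

open Bundle Filter Topology VectorField

set_option linter.unusedSectionVars false

/-! ### Smooth fields, cutoffs and tensoriality. -/

section Calculus

variable {E : Type*} [NormedAddCommGroup E] [NormedSpace ℝ E]
  {H : Type*} [TopologicalSpace H] {I : ModelWithCorners ℝ E H}
  {M : Type*} [TopologicalSpace M] [ChartedSpace H M] [IsManifold I ∞ M]

/-! ### Smooth vector fields -/

/-! Everything on `P` is governed by the fields `comb X f g = X̄ + (f ∘ p) E + (g ∘ p) ∂_s` with
data on `M`. Since `dα = π^*Ω` and `α` is contact, the triple `(p_*, p₁^*α, ds)` identifies each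
tangent space of `P` with `TM ⊕ ℝ ⊕ ℝ` (`tangent_ext`, `exists_components`). Hence every tangent
vector is the value of a comb, and a tensorial statement on `P` has to be checked on combs only.
Combs are closed under brackets (`mlieBracket_comb`) and under the induced connection
(`IsInduced.exists_nabla_comb_eq`), so each check becomes an identity on `M`.

Part (a). Two connections given by the formulas agree on combs, and their difference is a tensor, so
they are equal. For existence, the formula on combs is extended to all fields by means of the
pullback of `∇` along `p` (`inducedConnection`). Zero torsion and `∇^P μ = 0` are read off on combs.
The fields `E` and `∂_s` commute with all combs, and `∇^P` sends combs to combs; hence both are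
affine. The Lie derivatives of `μ` follow in the same way, the factor 2 coming from `e^{2s}`.

Curvature. Any `∂_s` among the arguments of the curvature gives zero. The rest
(`IsInduced.curvature_vec`) is expressed by four objects on `M`: `H` (`tensorH`), `B` (`tensorB`,
involving `∇σ` and `U`), `A` (`tensorA`, involving `∇U`, `σ²` and `f`) and the 1-form `df + 4ŝ(·,
U)` (`formB`). The special `ŝ` turns `H` into the traceless part `W` of the curvature of `∇`; the
special `U` kills the trace of `B` in its first argument; the special `f` kills the trace of `A`.
The trace of `B` in its second argument vanishes because `B(u, ·)` is skew for `Ω`. The Ricci tensor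
of `∇^P` is a combination of these traces, hence zero.

Ricci type implies flat. If `H = 0`, the horizontal part of the second Bianchi identity on `P`
contains no derivative of the unknown tensors: in this situation the curvature fields involved are
multiples of `∂_s`, and `∇^P_W ∂_s = W`. It is therefore an algebraic identity, and taking traces
gives in succession: `Ω(u, B(w, v))` is totally symmetric, `B = 0` (with the factor `2 - 2n`, whence
`n ≥ 2`), `A = 0`, and `df + 4ŝ(·, U) = 0`.

Local symmetry implies flat. The operator `∇^P_{∂_s}` is the identity on combs, and the curvature of
combs is a comb, so `(∇^P_{∂_s} R)(X, Y)Z = (1 - 3) R(X, Y)Z`. If this vanishes then `R = 0`; in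
particular `H = W = 0` over the image of `π`. -/

theorem IsSmoothVF.diffAt {X : VectorField I M} (hX : IsSmoothVF I X) (x : M) : DiffVFAt I X x :=
  (hX x).mdifferentiableAt (by simp)

theorem IsSmoothVF.add {X Y : VectorField I M} (hX : IsSmoothVF I X) (hY : IsSmoothVF I Y) :
    IsSmoothVF I (X + Y) :=
  ContMDiff.add_section hX hY

theorem IsSmoothVF.sub {X Y : VectorField I M} (hX : IsSmoothVF I X) (hY : IsSmoothVF I Y) :
    IsSmoothVF I (X - Y) :=
  ContMDiff.sub_section hX hY

theorem IsSmoothVF.neg {X : VectorField I M} (hX : IsSmoothVF I X) : IsSmoothVF I (-X) :=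
  ContMDiff.neg_section hX

theorem IsSmoothVF.smul {f : M → ℝ} {X : VectorField I M} (hf : ContMDiff I 𝓘(ℝ, ℝ) ∞ f)
    (hX : IsSmoothVF I X) : IsSmoothVF I (f • X) :=
  ContMDiff.smul_section hf hX

theorem IsSmoothVF.const_smul (a : ℝ) {X : VectorField I M} (hX : IsSmoothVF I X) :
    IsSmoothVF I (a • X) :=
  ContMDiff.const_smul_section hX

theorem isSmoothVF_zero : IsSmoothVF I (0 : VectorField I M) :=
  contMDiff_zeroSection _ _

theorem IsSmoothVF.mlieBracket [CompleteSpace E] {X Y : VectorField I M}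
    (hX : IsSmoothVF I X) (hY : IsSmoothVF I Y) :
    IsSmoothVF I (mlieBracket I X Y) :=
  have : IsManifold I (((⊤ : ℕ∞) : WithTop ℕ∞) + 1) M := inferInstanceAs (IsManifold I ∞ M)
  have : IsManifold I (minSmoothness ℝ 2) M := by
    rw [minSmoothness_of_isRCLikeNormedField]; infer_instance
  ContDiff.mlieBracket_vectorField (n := ⊤) (m := ⊤) hX hY
    (by rw [minSmoothness_of_isRCLikeNormedField]; rfl)

theorem mlieBracket_jacobi [CompleteSpace E] {X Y Z : VectorField I M}
    (hX : IsSmoothVF I X) (hY : IsSmoothVF I Y) (hZ : IsSmoothVF I Z) (x : M) :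
    mlieBracket I X (mlieBracket I Y Z) x =
      mlieBracket I (mlieBracket I X Y) Z x + mlieBracket I Y (mlieBracket I X Z) x := by
  have h3 : minSmoothness ℝ 3 = 3 := minSmoothness_of_isRCLikeNormedField
  have h2 : minSmoothness ℝ 2 = 2 := minSmoothness_of_isRCLikeNormedField
  have : IsManifold I (minSmoothness ℝ 3) M := by
    rw [h3]; exact IsManifold.of_le (n := ∞) ENat.LEInfty.out
  apply leibniz_identity_mlieBracket_apply
  all_goals rw [h2]
  · exact (hX x).of_le ENat.LEInfty.out
  · exact (hY x).of_le ENat.LEInfty.out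
  · exact (hZ x).of_le ENat.LEInfty.out

theorem contMDiff_mvfderiv_apply {F : Type*} [NormedAddCommGroup F] [NormedSpace ℝ F]
    {f : M → F} (hf : ContMDiff I 𝓘(ℝ, F) ∞ f) {X : VectorField I M} (hX : IsSmoothVF I X) :
    ContMDiff I 𝓘(ℝ, F) ∞ (fun x => mvfderiv I f x (X x)) := by
  have h1 : ContMDiff I.tangent 𝓘(ℝ, F).tangent ∞ (tangentMap I 𝓘(ℝ, F) f) :=
    hf.contMDiff_tangentMap (by simp)
  exact (contMDiff_snd_tangentBundle_modelSpace F 𝓘(ℝ, F)).comp (h1.comp hX)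

theorem mdifferentiableAt_mvfderiv_apply {F : Type*} [NormedAddCommGroup F] [NormedSpace ℝ F]
    {f : M → F} (hf : ContMDiff I 𝓘(ℝ, F) ∞ f) {X : VectorField I M} {x : M}
    (hX : DiffVFAt I X x) :
    MDifferentiableAt I 𝓘(ℝ, F) (fun x => mvfderiv I f x (X x)) x := by
  have h1 : ContMDiff I.tangent 𝓘(ℝ, F).tangent ∞ (tangentMap I 𝓘(ℝ, F) f) :=
    hf.contMDiff_tangentMap (by simp)
  have h2 := (contMDiff_snd_tangentBundle_modelSpace (n := ∞) F 𝓘(ℝ, F)).comp h1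
  exact (h2.mdifferentiable (by simp) _).comp x hX

/-! ### Extending local fields, local expansions in a frame -/

section Cutoff

variable [FiniteDimensional ℝ E] [T2Space M]

/-- A bump function supported in `s` and equal to 1 near `x` makes the field global without changing
its germ. Local frames can thus be used wherever globally smooth fields are required. -/
theorem exists_isSmoothVF_eventuallyEq {W : VectorField I M} {x : M} {s : Set M} (hs : s ∈ 𝓝 x)
    (hW : ContMDiffOn I I.tangent ∞ (fun y => (⟨y, W y⟩ : TangentBundle I M)) s) :
    ∃ X, IsSmoothVF I X ∧ X =ᶠ[𝓝 x] W := by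
  obtain ⟨ψ, -, hψ⟩ := (SmoothBumpFunction.nhds_basis_tsupport (I := I) x).mem_iff.1
    (interior_mem_nhds.2 hs)
  refine ⟨(ψ : M → ℝ) • W, ContMDiffOn.smul_section_of_tsupport (u := interior s)
    ψ.contMDiff.contMDiffOn isOpen_interior hψ (hW.mono interior_subset), ?_⟩
  filter_upwards [ψ.eventuallyEq_one] with y hy
  change ψ y • W y = W y
  rw [hy]
  exact one_smul ℝ (W y)

theorem exists_isSmoothVF_apply_eq (x : M) (v : TangentSpace I x) :
    ∃ X : VectorField I M, IsSmoothVF I X ∧ X x = v := by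
  obtain ⟨s, hs, h⟩ := FiberBundle.exists_contMDiffOn_extend (k := ∞) I E v
  obtain ⟨X, hX, h'⟩ := exists_isSmoothVF_eventuallyEq hs h
  exact ⟨X, hX, by simp [h'.self_of_nhds]⟩

/-- The fields `frame`, in which `curvature` and the other tensors are defined, are smooth only near
`x`; statements about global smooth fields apply to these substitutes with the same germs. -/
theorem exists_frame (x : M) : ∃ F : Fin (Module.finrank ℝ (TangentSpace I x)) → VectorField I M,
    ∀ i, IsSmoothVF I (F i) ∧ F i =ᶠ[𝓝 x] frame I x i := by
  have (i : Fin (Module.finrank ℝ (TangentSpace I x))) :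
      ∃ X, IsSmoothVF I X ∧ X =ᶠ[𝓝 x] frame I x i := by
    obtain ⟨s, hs, h⟩ := FiberBundle.exists_contMDiffOn_extend (k := ∞) I E (tangentBasis I x i)
    exact exists_isSmoothVF_eventuallyEq hs h
  choose F hF using this
  exact ⟨F, hF⟩

theorem diffVFAt_frame (x : M) (i : Fin (Module.finrank ℝ (TangentSpace I x))) :
    DiffVFAt I (frame I x i) x :=
  FiberBundle.mdifferentiableAt_extend ..

@[simp] theorem frame_self (x : M) (i : Fin (Module.finrank ℝ (TangentSpace I x))) :
    frame I x i x = tangentBasis I x i :=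
  FiberBundle.extend_apply_self ..

/-- Smooth fields expand, after multiplication by a cutoff function, in smooth fields with smooth
coefficients. -/
theorem exists_cutoff_expansion (x : M) :
    ∃ (χ : M → ℝ) (F : Fin (Module.finrank ℝ E) → VectorField I M)
      (c : Fin (Module.finrank ℝ E) → VectorField I M → M → ℝ),
      ContMDiff I 𝓘(ℝ, ℝ) ∞ χ ∧ χ =ᶠ[𝓝 x] 1 ∧ (∀ i, IsSmoothVF I (F i)) ∧
      (∀ i X, IsSmoothVF I X → ContMDiff I 𝓘(ℝ, ℝ) ∞ (c i X)) ∧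
      (∀ X, χ • X = ∑ i, c i X • F i) ∧
      (∀ i X X', X x = X' x → c i X x = c i X' x) := by
  let t := trivializationAt E (TangentSpace I : M → Type _) x
  let b := Module.finBasis ℝ E
  obtain ⟨ψ, -, hψ⟩ := (SmoothBumpFunction.nhds_basis_tsupport (I := I) x).mem_iff.1
    (t.open_baseSet.mem_nhds (FiberBundle.mem_baseSet_trivializationAt' x))
  have hψ0 (y) (hy : y ∉ t.baseSet) : ψ y = 0 :=
    image_eq_zero_of_notMem_tsupport fun h => hy (hψ h)
  -- The cutoff is `ψ²`: one factor globalizes the frame fields, the other the coefficients.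
  refine ⟨fun y => ψ y * ψ y, fun i => (ψ : M → ℝ) • t.localFrame b i,
    fun i X y => ψ y * t.localFrameCoeff I b i y (X y), ψ.contMDiff.mul ψ.contMDiff, ?_, ?_, ?_,
    ?_, ?_⟩
  · filter_upwards [ψ.eventuallyEq_one] with y hy
    simp [hy]
  · intro i
    exact ContMDiffOn.smul_section_of_tsupport ψ.contMDiff.contMDiffOn t.open_baseSet hψ
      (t.contMDiffOn_localFrame_baseSet ∞ b i)
  · intro i X hX
    refine contMDiff_of_tsupport fun y hy => ?_
    have hy' : y ∈ t.baseSet := hψ (tsupport_mul_subset_left hy)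
    exact ψ.contMDiffAt.mul (contMDiffAt_localFrameCoeff b hy' (hX y) i)
  · intro X
    ext1 y
    by_cases hy : y ∈ t.baseSet
    · simp only [Pi.smul_apply', Finset.sum_apply]
      conv_lhs => rw [t.eq_sum_localFrameCoeff_smul (I := I) (b := b) hy (s := X)]
      rw [Finset.smul_sum]
      exact Finset.sum_congr rfl fun i _ => by rw [smul_smul, smul_smul]; ring_nf
    · have h0 := hψ0 y hy
      simp only [Pi.smul_apply', Finset.sum_apply, h0, zero_mul, zero_smul,
        Finset.sum_const_zero]
  · intro i X X' h
    simp only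
    rw [h]

/-- An operation on vector fields is tensorial at `x` on smooth fields. -/
structure SmoothTensorialAt (I : ModelWithCorners ℝ E H) [IsManifold I ∞ M]
    {A : Type*} [AddCommGroup A] [Module ℝ A]
    (Φ : VectorField I M → A) (x : M) : Prop where
  smul : ∀ {f : M → ℝ} {X}, ContMDiff I 𝓘(ℝ, ℝ) ∞ f → IsSmoothVF I X → Φ (f • X) = f x • Φ X
  add : ∀ {X Y}, IsSmoothVF I X → IsSmoothVF I Y → Φ (X + Y) = Φ X + Φ Y

namespace SmoothTensorialAt

variable {A : Type*} [AddCommGroup A] [Module ℝ A] {Φ : VectorField I M → A} {x : M}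

theorem zero (h : SmoothTensorialAt I Φ x) : Φ 0 = 0 := by
  have := h.add (isSmoothVF_zero (I := I) (M := M)) isSmoothVF_zero
  simpa using this

/-- Applying `Φ` to `χ • X = ∑ cᵢ • Fᵢ` gives `Φ X = ∑ cᵢ(x) Φ(Fᵢ)`, and `cᵢ(x)` depends on `X x`
only. -/
theorem pointwise (h : SmoothTensorialAt I Φ x) {X X' : VectorField I M} (hX : IsSmoothVF I X)
    (hX' : IsSmoothVF I X') (hx : X x = X' x) : Φ X = Φ X' := by
  obtain ⟨χ, F, c, hχ, hχ1, hF, hc, hexp, hcx⟩ := exists_cutoff_expansion (I := I) x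
  have key (X : VectorField I M) (hX : IsSmoothVF I X) : Φ X = ∑ i, c i X x • Φ (F i) := by
    have h1 : Φ (χ • X) = Φ X := by rw [h.smul hχ hX, hχ1.self_of_nhds]; simp
    have h2 (s : Finset (Fin (Module.finrank ℝ E))) :
        IsSmoothVF I (∑ i ∈ s, c i X • F i) ∧
        Φ (∑ i ∈ s, c i X • F i) = ∑ i ∈ s, c i X x • Φ (F i) := by
      classical
      induction s using Finset.induction_on with
      | empty => simpa using! ⟨isSmoothVF_zero, h.zero⟩
      | insert a s ha ih =>
        rw [Finset.sum_insert ha, Finset.sum_insert ha]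
        have := IsSmoothVF.smul (hc a X hX) (hF a)
        exact ⟨this.add ih.1, by rw [h.add this ih.1, ih.2, h.smul (hc a X hX) (hF a)]⟩
    rw [← h1, hexp, (h2 _).2]
  rw [key X hX, key X' hX']
  exact Finset.sum_congr rfl fun i _ => by rw [hcx i X X' hx]

end SmoothTensorialAt

end Cutoff
end Calculus

/-! ### Brackets as commutators, and brackets of related fields. -/

section Brackets

variable {E : Type*} [NormedAddCommGroup E] [NormedSpace ℝ E]
  {H : Type*} [TopologicalSpace H] {I : ModelWithCorners ℝ E H}
  {M : Type*} [TopologicalSpace M] [ChartedSpace H M] [IsManifold I ∞ M]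
  [FiniteDimensional ℝ E] [I.Boundaryless]
  {F : Type*} [NormedAddCommGroup F] [NormedSpace ℝ F]

/-- The chain rule in a chart; it carries the commutator formula for brackets over to a vector
space. -/
theorem mvfderiv_eq_fderiv_mpullbackWithin {h : M → F} {x : M} {z : E}
    (hz : z ∈ (extChartAt I x).target)
    (hh : MDifferentiableAt I 𝓘(ℝ, F) h ((extChartAt I x).symm z)) (W : VectorField I M) :
    mvfderiv I h ((extChartAt I x).symm z) (W ((extChartAt I x).symm z)) =
      fderivWithin ℝ (h ∘ (extChartAt I x).symm) (Set.range I) z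
        (mpullbackWithin 𝓘(ℝ, E) I (extChartAt I x).symm W (Set.range I) z) := by
  have hu : UniqueMDiffWithinAt 𝓘(ℝ, E) (Set.range I) z := by
    rw [I.range_eq_univ]; exact uniqueMDiffWithinAt_univ _
  have h2 : mfderivWithin 𝓘(ℝ, E) 𝓘(ℝ, F) (h ∘ (extChartAt I x).symm) (Set.range I) z =
      (mfderiv I 𝓘(ℝ, F) h ((extChartAt I x).symm z)).comp
        (mfderivWithin 𝓘(ℝ, E) I (extChartAt I x).symm (Set.range I) z) :=
    mfderiv_comp_mfderivWithin z hh (mdifferentiableWithinAt_extChartAt_symm hz) hu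
  rw [mfderivWithin_eq_fderivWithin] at h2
  rw [h2, mpullbackWithin_apply]
  change _ = mfderiv I 𝓘(ℝ, F) h ((extChartAt I x).symm z)
    (mfderivWithin 𝓘(ℝ, E) I (extChartAt I x).symm (Set.range I) z
      ((mfderivWithin 𝓘(ℝ, E) I (extChartAt I x).symm (Set.range I) z).inverse _))
  rw [(isInvertible_mfderivWithin_extChartAt_symm hz).self_apply_inverse]
  rfl

/-- The differentiation operator along `[X, Y]` is the commutator of the differentiation operators
along `X` and `Y`. -/
theorem mvfderiv_mlieBracket {f : M → F} (hf : ContMDiff I 𝓘(ℝ, F) ∞ f) {X Y : VectorField I M}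
    {x : M} (hX : DiffVFAt I X x) (hY : DiffVFAt I Y x) :
    mvfderiv I f x (mlieBracket I X Y x) =
      mvfderiv I (fun y => mvfderiv I f y (Y y)) x (X x) -
        mvfderiv I (fun y => mvfderiv I f y (X y)) x (Y x) := by
  have h2 : minSmoothness ℝ 2 = 2 := minSmoothness_of_isRCLikeNormedField
  set φ := extChartAt I x with hφ
  have hz0 : φ x ∈ φ.target := mem_extChartAt_target x
  have hx0 : φ.symm (φ x) = x := extChartAt_to_inv x
  have htar : φ.target ∈ 𝓝 (φ x) := extChartAt_target_mem_nhds x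
  set V := mpullbackWithin 𝓘(ℝ, E) I φ.symm X (Set.range I) with hV
  set W := mpullbackWithin 𝓘(ℝ, E) I φ.symm Y (Set.range I) with hW
  have hdV : DifferentiableWithinAt ℝ V (Set.range I) (φ x) := by
    have := MDifferentiableWithinAt.differentiableWithinAt_mpullbackWithin_vectorField
      (mdifferentiableWithinAt_univ.2 hX)
    rw [Set.preimage_univ, Set.univ_inter] at this
    exact this
  have hdW : DifferentiableWithinAt ℝ W (Set.range I) (φ x) := by
    have := MDifferentiableWithinAt.differentiableWithinAt_mpullbackWithin_vectorField
      (mdifferentiableWithinAt_univ.2 hY)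
    rw [Set.preimage_univ, Set.univ_inter] at this
    exact this
  have hr : Set.range I = Set.univ := I.range_eq_univ
  have hfd (z) (hz : z ∈ φ.target) : MDifferentiableAt I 𝓘(ℝ, F) f (φ.symm z) :=
    hf.mdifferentiable (by simp) _
  have hfs : ContDiffWithinAt ℝ 2 (f ∘ φ.symm) (Set.range I) (φ x) := by
    have h1 : ContMDiffWithinAt 𝓘(ℝ, E) 𝓘(ℝ, F) ∞ (f ∘ φ.symm) (Set.range I) (φ x) :=
      ContMDiffAt.comp_contMDiffWithinAt _ (hf _)
        (contMDiffWithinAt_extChartAt_symm_range x hz0)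
    exact (contMDiffWithinAt_iff_contDiffWithinAt.1 h1).of_le ENat.LEInfty.out
  have e1 : mvfderiv I f x (mlieBracket I X Y x) =
      fderivWithin ℝ (f ∘ φ.symm) (Set.range I) (φ x)
        (lieBracketWithin ℝ V W (Set.range I) (φ x)) := by
    have h1 := mvfderiv_eq_fderiv_mpullbackWithin hz0 (hfd _ hz0) (mlieBracket I X Y)
    rw [hx0] at h1
    rw [h1, mpullbackWithin_apply, ← hφ, hx0, ← mlieBracketWithin_univ, mlieBracketWithin_apply]
    simp only [Set.preimage_univ, Set.univ_inter]
    have h3 := (isInvertible_mfderivWithin_extChartAt_symm (I := I) hz0)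
    congr 1
    let w : E := lieBracketWithin ℝ (E := E) V W (Set.range I) (φ x)
    have h5 := isInvertible_mfderiv_extChartAt (mem_extChartAt_source (I := I) x)
    have h4 := mfderiv_extChartAt_comp_mfderivWithin_extChartAt_symm (I := I) hz0
    rw [← hφ] at h3 h4 h5
    rw [hx0] at h4
    -- The bracket is defined with the inverse of the differential of the chart, which is the
    -- differential of `φ.symm`; it cancels against the inverse coming from the pullback.
    have h6 := h5.inverse_apply_eq.2 congr($h4 w).symm
    exact (congrArg _ h6).trans (h3.inverse_apply_self _)
  have hfun (Z : VectorField I M) :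
      (fun y => mvfderiv I f y (Z y)) ∘ φ.symm =ᶠ[𝓝 (φ x)]
        fun z => fderivWithin ℝ (f ∘ φ.symm) (Set.range I) z
          (mpullbackWithin 𝓘(ℝ, E) I φ.symm Z (Set.range I) z) := by
    filter_upwards [htar] with z hz
    exact mvfderiv_eq_fderiv_mpullbackWithin hz (hfd z hz) Z
  have e2 {Z Z' : VectorField I M} (hZ : DiffVFAt I Z x) :
      mvfderiv I (fun y => mvfderiv I f y (Z y)) x (Z' x) =
        fderivWithin ℝ (fun z => fderivWithin ℝ (f ∘ φ.symm) (Set.range I) z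
          (mpullbackWithin 𝓘(ℝ, E) I φ.symm Z (Set.range I) z)) (Set.range I) (φ x)
          (mpullbackWithin 𝓘(ℝ, E) I φ.symm Z' (Set.range I) (φ x)) := by
    have h1 := mvfderiv_eq_fderiv_mpullbackWithin hz0
      (h := fun y => mvfderiv I f y (Z y)) (by
        rw [← hφ, hx0]; exact mdifferentiableAt_mvfderiv_apply hf hZ) Z'
    rw [← hφ, hx0] at h1
    rw [h1, Filter.EventuallyEq.fderivWithin_eq ((hfun Z).filter_mono nhdsWithin_le_nhds)
      (hfun Z).self_of_nhds]
  rw [e1, e2 hY, e2 hX]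
  -- In the model space this is the symmetry of the second derivative of `f`, for which `C²` is
  -- enough.
  refine fderivWithin_apply_lieBracket hfs (by rw [h2]) ?_ ?_ ?_ hdW hdV
  · rw [hr]; exact uniqueDiffOn_univ
  · rw [hr]; simp
  · rw [hr]; trivial

variable [T2Space M]

/-- Global smooth functions separate tangent vectors. -/
theorem exists_separating_function (x : M) :
    ∃ g : M → E, ContMDiff I 𝓘(ℝ, E) ∞ g ∧ Function.Injective (mvfderiv I g x) := by
  let ψ : SmoothBumpFunction I x := Classical.arbitrary _
  refine ⟨fun y => ψ y • extChartAt I x y, ψ.contMDiff_smul contMDiffOn_extChartAt, ?_⟩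
  have h : (fun y => ψ y • extChartAt I x y) =ᶠ[𝓝 x] extChartAt I x := by
    filter_upwards [ψ.eventuallyEq_one] with y hy
    rw [hy]; exact one_smul ℝ _
  have h1 : mvfderiv I (fun y => ψ y • extChartAt I x y) x =
      mfderiv I 𝓘(ℝ, E) (extChartAt I x) x := by
    rw [← h.mfderiv_eq]; rfl
  rw [h1]
  obtain ⟨e, he⟩ := isInvertible_mfderiv_extChartAt (mem_extChartAt_source (I := I) x)
  rw [← he]
  exact e.injective

variable {E' : Type*} [NormedAddCommGroup E'] [NormedSpace ℝ E'] [FiniteDimensional ℝ E']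
  {H' : Type*} [TopologicalSpace H'] {I' : ModelWithCorners ℝ E' H'} [I'.Boundaryless]
  {M' : Type*} [TopologicalSpace M'] [ChartedSpace H' M'] [IsManifold I' ∞ M'] [T2Space M']

/-- Brackets of related fields are related. -/
theorem mfderiv_mlieBracket_of_related {f : M → M'} (hf : ContMDiff I I' ∞ f)
    {X Y : VectorField I M} {X' Y' : VectorField I' M'} {x : M}
    (hX : DiffVFAt I X x) (hY : DiffVFAt I Y x)
    (hX' : DiffVFAt I' X' (f x)) (hY' : DiffVFAt I' Y' (f x))
    (hXX' : ∀ y, mfderiv I I' f y (X y) = X' (f y))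
    (hYY' : ∀ y, mfderiv I I' f y (Y y) = Y' (f y)) :
    mfderiv I I' f x (mlieBracket I X Y x) = mlieBracket I' X' Y' (f x) := by
  -- Vectors at `f x` are tested by `g`. The derivative of `g ∘ f` along `X` is `(X'g) ∘ f`, so the
  -- commutator formulas on `M` and on `M'` match term by term.
  obtain ⟨g, hg, hinj⟩ := exists_separating_function (I := I') (f x)
  apply hinj
  have hfd (y) : MDifferentiableAt I I' f y := hf.mdifferentiable (by simp) y
  have hgd (y) : MDifferentiableAt I' 𝓘(ℝ, E') g y := hg.mdifferentiable (by simp) y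
  have hcomp (y) (v : TangentSpace I y) :
      mvfderiv I (g ∘ f) y v = mvfderiv I' g (f y) (mfderiv I I' f y v) :=
    mfderiv_comp_apply y (hgd _) (hfd y) v
  rw [← hcomp, mvfderiv_mlieBracket (hg.comp hf) hX hY, mvfderiv_mlieBracket hg hX' hY']
  have e (Z : VectorField I M) (Z' : VectorField I' M')
      (h : ∀ y, mfderiv I I' f y (Z y) = Z' (f y)) :
      (fun y => mvfderiv I (g ∘ f) y (Z y)) = (fun y => mvfderiv I' g y (Z' y)) ∘ f := by
    funext y; simp [hcomp, h]
  rw [e Y Y' hYY', e X X' hXX', ← hXX', ← hYY']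
  congr 1
  · exact mfderiv_comp_apply x (mdifferentiableAt_mvfderiv_apply hg hY') (hfd x) _
  · exact mfderiv_comp_apply x (mdifferentiableAt_mvfderiv_apply hg hX') (hfd x) _

end Brackets

/-! ### Smoothness of tensors tested on smooth fields. -/

section Tensors

variable {E : Type*} [NormedAddCommGroup E] [NormedSpace ℝ E]
  {H : Type*} [TopologicalSpace H] {I : ModelWithCorners ℝ E H}
  {M : Type*} [TopologicalSpace M] [ChartedSpace H M] [IsManifold I ∞ M]

/-! ### Tensors applied to fields -/

theorem IsSmoothOneForm.apply {α : OneForm I M} (hα : IsSmoothOneForm I α) {X : VectorField I M}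
    (hX : IsSmoothVF I X) : ContMDiff I 𝓘(ℝ, ℝ) ∞ (fun x => α x (X x)) := by
  have := ContMDiff.clm_bundle_apply (F₁ := E) (F₂ := ℝ) (E₁ := (TangentSpace I : M → Type _))
    (E₂ := Bundle.Trivial M ℝ) (b := id) hα hX
  exact fun x => (contMDiffAt_totalSpace.1 (this x)).2

theorem IsSmoothOneForm.mdifferentiableAt_apply {α : OneForm I M} (hα : IsSmoothOneForm I α)
    {X : VectorField I M} {x : M} (hX : DiffVFAt I X x) :
    MDifferentiableAt I 𝓘(ℝ, ℝ) (fun x => α x (X x)) x := by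
  have := MDifferentiableAt.clm_bundle_apply (F₁ := E) (F₂ := ℝ)
    (E₁ := (TangentSpace I : M → Type _))
    (E₂ := Bundle.Trivial M ℝ) (b := id) ((hα x).mdifferentiableAt (by simp)) hX
  exact ((mdifferentiableAt_totalSpace _ _).1 this).2

theorem IsSmoothTwoTensor.apply {s : TwoTensor I M} (hs : IsSmoothTwoTensor I s)
    {X Y : VectorField I M} (hX : IsSmoothVF I X) (hY : IsSmoothVF I Y) :
    ContMDiff I 𝓘(ℝ, ℝ) ∞ (fun x => s x (X x) (Y x)) := by
  have := ContMDiff.clm_bundle_apply₂ (F₁ := E) (F₂ := E) (F₃ := ℝ)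
    (E₁ := (TangentSpace I : M → Type _)) (E₂ := (TangentSpace I : M → Type _))
    (E₃ := Bundle.Trivial M ℝ) (b := id) hs hX hY
  exact fun x => (contMDiffAt_totalSpace.1 (this x)).2

theorem IsSmoothTwoTensor.mdifferentiableAt_apply {s : TwoTensor I M} (hs : IsSmoothTwoTensor I s)
    {X Y : VectorField I M} {x : M} (hX : DiffVFAt I X x) (hY : DiffVFAt I Y x) :
    MDifferentiableAt I 𝓘(ℝ, ℝ) (fun x => s x (X x) (Y x)) x := by
  have := MDifferentiableAt.clm_bundle_apply₂ (F₁ := E) (F₂ := E) (F₃ := ℝ)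
    (E₁ := (TangentSpace I : M → Type _)) (E₂ := (TangentSpace I : M → Type _))
    (E₃ := Bundle.Trivial M ℝ) (b := id) ((hs x).mdifferentiableAt (by simp)) hX hY
  exact ((mdifferentiableAt_totalSpace _ _).1 this).2

/-- The endomorphism field `σ` is smooth. -/
def IsSmoothEnd (σ : EndField I M) : Prop :=
  ContMDiff I (I.prod 𝓘(ℝ, E →L[ℝ] E)) ∞
    (fun x => Bundle.TotalSpace.mk' (E →L[ℝ] E)
      (E := fun x : M => TangentSpace I x →L[ℝ] TangentSpace I x) x (σ x))

theorem IsSmoothEnd.apply {σ : EndField I M} (hσ : IsSmoothEnd σ)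
    {X : VectorField I M} (hX : IsSmoothVF I X) :
    IsSmoothVF I (fun x => σ x (X x)) :=
  ContMDiff.clm_bundle_apply (F₁ := E) (F₂ := E)
    (E₁ := (TangentSpace I : M → Type _)) (E₂ := (TangentSpace I : M → Type _)) (b := id) hσ hX

theorem IsSmoothEnd.diffVFAt_apply {σ : EndField I M} (hσ : IsSmoothEnd σ)
    {X : VectorField I M} {x : M} (hX : DiffVFAt I X x) :
    DiffVFAt I (fun x => σ x (X x)) x :=
  MDifferentiableAt.clm_bundle_apply (F₁ := E) (F₂ := E)
    (E₁ := (TangentSpace I : M → Type _)) (E₂ := (TangentSpace I : M → Type _)) (b := id)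
    ((hσ x).mdifferentiableAt (by simp)) hX

/-! ### Smoothness tests -/

theorem contMDiffAt_clm_of_forall_basis {ι F F' : Type*} [Fintype ι] [NormedAddCommGroup F]
    [NormedSpace ℝ F] [NormedAddCommGroup F'] [NormedSpace ℝ F'] [FiniteDimensional ℝ F]
    (b : Module.Basis ι ℝ F) {A : M → F →L[ℝ] F'} {x : M}
    (h : ∀ i, ContMDiffAt I 𝓘(ℝ, F') ∞ (fun y => A y (b i)) x) :
    ContMDiffAt I 𝓘(ℝ, F →L[ℝ] F') ∞ A x := by
  have e : A = fun y => ∑ i, ContinuousLinearMap.smulRightL ℝ F F'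
      (LinearMap.toContinuousLinearMap (b.coord i)) (A y (b i)) := by
    funext y
    refine ContinuousLinearMap.coe_injective (b.ext fun j => ?_)
    classical
    simp [Finsupp.single_apply, ite_smul]
  rw [e]
  exact ContMDiffAt.sum fun i _ =>
    (ContinuousLinearMap.contMDiff _).contMDiffAt.comp x (h i)

variable [FiniteDimensional ℝ E] [T2Space M]

/-- In trivializations, the columns of `φ` are its values on the local frame, and each frame field
agrees near `x` with a global smooth field. -/
theorem contMDiff_hom_of_forall {F' : Type*} [NormedAddCommGroup F'] [NormedSpace ℝ F']
    {V : M → Type*} [TopologicalSpace (TotalSpace F' V)] [∀ x, AddCommGroup (V x)]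
    [∀ x, Module ℝ (V x)] [∀ x, TopologicalSpace (V x)] [∀ x, IsTopologicalAddGroup (V x)]
    [∀ x, ContinuousSMul ℝ (V x)] [FiberBundle F' V] [VectorBundle ℝ F' V]
    (φ : ∀ x : M, TangentSpace I x →L[ℝ] V x)
    (h : ∀ X, IsSmoothVF I X →
      ContMDiff I (I.prod 𝓘(ℝ, F')) ∞ fun x => TotalSpace.mk' F' x (φ x (X x))) :
    ContMDiff I (I.prod 𝓘(ℝ, E →L[ℝ] F')) ∞ (fun x => TotalSpace.mk' (E →L[ℝ] F')
      (E := fun x : M => TangentSpace I x →L[ℝ] V x) x (φ x)) := by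
  intro x
  rw [contMDiffAt_hom_bundle]
  refine ⟨contMDiffAt_id, contMDiffAt_clm_of_forall_basis (Module.finBasis ℝ E) fun i => ?_⟩
  let t := trivializationAt E (TangentSpace I : M → Type _) x
  let b := Module.finBasis ℝ E
  have ht : t.baseSet ∈ 𝓝 x := t.open_baseSet.mem_nhds (FiberBundle.mem_baseSet_trivializationAt' x)
  have ht' : (trivializationAt F' V x).baseSet ∈ 𝓝 x :=
    (trivializationAt F' V x).open_baseSet.mem_nhds (FiberBundle.mem_baseSet_trivializationAt' x)
  obtain ⟨X, hX, hXe⟩ := exists_isSmoothVF_eventuallyEq ht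
    (t.contMDiffOn_localFrame_baseSet (I := I) ∞ b i)
  have h1 := (contMDiffAt_totalSpace.1 (h X hX x)).2
  refine h1.congr_of_eventuallyEq ?_
  filter_upwards [ht, ht', hXe] with y hy hy' hXy
  rw [ContinuousLinearMap.inCoordinates_eq hy hy']
  simp only [ContinuousLinearMap.comp_apply, ContinuousLinearEquiv.coe_coe]
  rw [hXy, t.localFrame_apply_of_mem_baseSet b hy]
  rfl

theorem isSmoothOneForm_of_forall {α : OneForm I M}
    (h : ∀ X, IsSmoothVF I X → ContMDiff I 𝓘(ℝ, ℝ) ∞ (fun x => α x (X x))) :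
    IsSmoothOneForm I α :=
  contMDiff_hom_of_forall (V := Bundle.Trivial M ℝ) α fun X hX x =>
    contMDiffAt_totalSpace.2 ⟨contMDiffAt_id, h X hX x⟩

theorem isSmoothTwoTensor_of_forall {s : TwoTensor I M}
    (h : ∀ X Y, IsSmoothVF I X → IsSmoothVF I Y →
      ContMDiff I 𝓘(ℝ, ℝ) ∞ (fun x => s x (X x) (Y x))) :
    IsSmoothTwoTensor I s :=
  contMDiff_hom_of_forall (V := fun x => TangentSpace I x →L[ℝ] Bundle.Trivial M ℝ x) s
    fun X hX => isSmoothOneForm_of_forall fun Y hY => h X Y hX hY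

theorem isSmoothEnd_of_forall {σ : EndField I M}
    (h : ∀ X, IsSmoothVF I X → IsSmoothVF I (fun x => σ x (X x))) : IsSmoothEnd σ :=
  contMDiff_hom_of_forall (V := (TangentSpace I : M → Type _)) σ h

end Tensors

/-! ### Smoothness of fields tested by forms; the invariant formula for the exterior derivative. -/

section Tensors

variable {E : Type*} [NormedAddCommGroup E] [NormedSpace ℝ E]
  {H : Type*} [TopologicalSpace H] {I : ModelWithCorners ℝ E H}
  {M : Type*} [TopologicalSpace M] [ChartedSpace H M] [IsManifold I ∞ M]
  [FiniteDimensional ℝ E]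

/-- With a left inverse `Q` of `L x`, the endomorphisms `Q ∘ L` are the identity at `x`, hence
invertible nearby with smooth inverse, and `u` is recovered as `(Q ∘ L)⁻¹ (Q (L u))`. -/
theorem contMDiffAt_of_clm_injective {W : Type*} [NormedAddCommGroup W] [NormedSpace ℝ W]
    [FiniteDimensional ℝ W] {L : M → E →L[ℝ] W} {u : M → E} {x : M}
    (hL : ContMDiffAt I 𝓘(ℝ, E →L[ℝ] W) ∞ L x) (hinj : Function.Injective (L x))
    (h : ContMDiffAt I 𝓘(ℝ, W) ∞ (fun y => L y (u y)) x) :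
    ContMDiffAt I 𝓘(ℝ, E) ∞ u x := by
  obtain ⟨Q₀, hQ₀⟩ := LinearMap.exists_leftInverse_of_injective (L x).toLinearMap
    (LinearMap.ker_eq_bot.2 hinj)
  let Q : W →L[ℝ] E := LinearMap.toContinuousLinearMap Q₀
  let A : M → E →L[ℝ] E := fun y => Q.comp (L y)
  have hA : ContMDiffAt I 𝓘(ℝ, E →L[ℝ] E) ∞ A x := contMDiffAt_const.clm_comp hL
  have hAx : A x = (ContinuousLinearEquiv.refl ℝ E : E →L[ℝ] E) := by
    ext v; exact congr($hQ₀ v)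
  have hB : ContMDiffAt I 𝓘(ℝ, E →L[ℝ] E) ∞ (fun y => (A y).inverse) x := by
    have := (contDiffAt_map_inverse (𝕜 := ℝ) (n := ∞) (ContinuousLinearEquiv.refl ℝ E)).contMDiffAt
    rw [← hAx] at this
    exact this.comp x hA
  have hev : ∀ᶠ y in 𝓝 x, (A y).IsInvertible := by
    have h1 := (ContinuousLinearEquiv.nhds (ContinuousLinearEquiv.refl ℝ E))
    rw [← hAx] at h1
    exact hA.continuousAt h1
  refine (hB.clm_apply ((Q.contMDiff.contMDiffAt).comp x h)).congr_of_eventuallyEq ?_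
  filter_upwards [hev] with y hy
  exact (hy.inverse_apply_self (u y)).symm

theorem clm_ext_tangentBasis {F : Type*} [AddCommGroup F] [Module ℝ F] [TopologicalSpace F] {x : M}
    {f g : TangentSpace I x →L[ℝ] F} (h : ∀ i, f (tangentBasis I x i) = g (tangentBasis I x i)) :
    f = g :=
  ContinuousLinearMap.coe_injective ((tangentBasis I x).ext h)

@[simp] theorem ofComponents_tangentBasis {F : Type*} [AddCommGroup F] [Module ℝ F]
    [TopologicalSpace F] [IsTopologicalAddGroup F] [ContinuousSMul ℝ F] (x : M)
    (c : Fin (Module.finrank ℝ (TangentSpace I x)) → F)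
    (i : Fin (Module.finrank ℝ (TangentSpace I x))) :
    ofComponents I x c (tangentBasis I x i) = c i :=
  (tangentBasis I x).constr_basis ℝ c i

variable [T2Space M]

/-- A field is smooth at `x` if a smooth vector-valued 1-form which is injective at `x` is smooth
on it. -/
theorem contMDiffAt_of_form_injective {W : Type*} [NormedAddCommGroup W] [NormedSpace ℝ W]
    [FiniteDimensional ℝ W] {Λ : ∀ y : M, TangentSpace I y →L[ℝ] W} {U : VectorField I M} {x : M}
    (hΛ : ∀ X, IsSmoothVF I X → ContMDiff I 𝓘(ℝ, W) ∞ (fun y => Λ y (X y)))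
    (hinj : Function.Injective (Λ x))
    (h : ContMDiffAt I 𝓘(ℝ, W) ∞ (fun y => Λ y (U y)) x) :
    ContMDiffAt I I.tangent ∞ (fun y => (⟨y, U y⟩ : TangentBundle I M)) x := by
  let t := trivializationAt E (TangentSpace I : M → Type _) x
  let b := Module.finBasis ℝ E
  have hxt : x ∈ t.baseSet := FiberBundle.mem_baseSet_trivializationAt' x
  have ht : t.baseSet ∈ 𝓝 x := t.open_baseSet.mem_nhds hxt
  rw [contMDiffAt_totalSpace]
  refine ⟨contMDiffAt_id, ?_⟩
  refine contMDiffAt_of_clm_injective (L := fun y => (Λ y).comp (t.symmL ℝ y)) (W := W) ?_ ?_ ?_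
  · refine contMDiffAt_clm_of_forall_basis b fun i => ?_
    obtain ⟨X, hX, hXe⟩ := exists_isSmoothVF_eventuallyEq ht
      (t.contMDiffOn_localFrame_baseSet (I := I) ∞ b i)
    refine (hΛ X hX x).congr_of_eventuallyEq ?_
    filter_upwards [ht, hXe] with y hy hXy
    rw [hXy, t.localFrame_apply_of_mem_baseSet b hy]
    exact congrArg (Λ y) (congr($(t.symm_continuousLinearEquivAt_eq (R := ℝ) hy) (b i)).symm)
  · intro v w hvw
    have h1 := hinj hvw
    have h2 := congrArg (t.continuousLinearMapAt ℝ x) h1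
    exact (t.continuousLinearMapAt_symmL hxt v).symm.trans
      (h2.trans (t.continuousLinearMapAt_symmL hxt w))
  · refine h.congr_of_eventuallyEq ?_
    filter_upwards [ht] with y hy
    change Λ y (t.symmL ℝ y (t ⟨y, U y⟩).2) = Λ y (U y)
    congr 1
    exact (congrArg (t.symmL ℝ y) (t.continuousLinearMapAt_apply_of_mem ℝ hy (U y)).symm).trans
      (t.symmL_continuousLinearMapAt hy (U y))

/-- Pairing with a local frame gives a vector-valued 1-form, injective at `x` by nondegeneracy, to
which the preceding test applies. -/
theorem isSmoothVF_of_nondegenerate {Ω : TwoTensor I M} (hΩ : IsSmoothTwoTensor I Ω)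
    (hnd : ∀ x (v : TangentSpace I x), (∀ w, Ω x v w = 0) → v = 0) {U : VectorField I M}
    (h : ∀ Y, IsSmoothVF I Y → ContMDiff I 𝓘(ℝ, ℝ) ∞ (fun x => Ω x (U x) (Y x))) :
    IsSmoothVF I U := by
  intro x
  obtain ⟨F, hF⟩ := exists_frame (I := I) x
  refine contMDiffAt_of_form_injective (Λ := fun y => LinearMap.toContinuousLinearMap
    { toFun := fun v i => Ω y v (F i y)
      map_add' := fun v w => by ext; simp
      map_smul' := fun c v => by ext; simp }) ?_ ?_ ?_
  · intro X hX
    exact contMDiff_pi_space.2 fun i => hΩ.apply hX (hF i).1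
  · refine (injective_iff_map_eq_zero _).2 fun v hv => hnd x v fun w => ?_
    have : Ω x v = 0 := clm_ext_tangentBasis fun i => by
      have h1 : Ω x v (F i x) = 0 := congrFun hv i
      rw [(hF i).2.self_of_nhds, frame_self] at h1
      simpa using h1
    rw [this]; rfl
  · exact (contMDiff_pi_space.2 fun i => h _ (hF i).1) x

/-- The trace of a smooth field of endomorphisms is smooth. -/
theorem contMDiff_trace {A : ∀ x : M, TangentSpace I x →ₗ[ℝ] TangentSpace I x}
    (h : ∀ X : VectorField I M, IsSmoothVF I X → IsSmoothVF I (fun x => A x (X x))) :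
    ContMDiff I 𝓘(ℝ, ℝ) ∞ (fun x => LinearMap.trace ℝ (TangentSpace I x) (A x)) := by
  intro x
  let t := trivializationAt E (TangentSpace I : M → Type _) x
  let b := Module.finBasis ℝ E
  have hxt : x ∈ t.baseSet := FiberBundle.mem_baseSet_trivializationAt' x
  have ht : t.baseSet ∈ 𝓝 x := t.open_baseSet.mem_nhds hxt
  have hX (i) := exists_isSmoothVF_eventuallyEq ht
      (t.contMDiffOn_localFrame_baseSet (I := I) ∞ b i)
  choose X hX hXe using hX
  have h1 : ContMDiffAt I 𝓘(ℝ, ℝ) ∞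
      (fun y => ∑ i, t.localFrameCoeff I b i y (A y (X i y))) x :=
    ContMDiffAt.sum fun i _ => contMDiffAt_localFrameCoeff b hxt (h _ (hX i) x) i
  refine h1.congr_of_eventuallyEq ?_
  filter_upwards [ht, eventually_all.2 hXe] with y hy hXy
  rw [LinearMap.trace_eq_matrix_trace ℝ (t.basisAt b hy), Matrix.trace]
  refine Finset.sum_congr rfl fun i _ => ?_
  have e : X i y = t.basisAt b hy i := by rw [hXy i, t.localFrame_apply_of_mem_baseSet b hy]
  rw [Matrix.diag_apply, LinearMap.toMatrix_apply, ← e]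
  exact (t.localFrameCoeff_apply_of_mem_baseSet (I := I) b hy (fun y => A y (X i y)) i).symm

/-- Used once per argument of the curvature, to pass from the frame in which `curvature` is defined
to arbitrary smooth fields. -/
theorem SmoothTensorialAt.apply_eq {A : Type*} [AddCommGroup A] [Module ℝ A]
    {Φ : VectorField I M → A} {x : M} (h : SmoothTensorialAt I Φ x) {ι : Type*} [Fintype ι]
    (b : Module.Basis ι ℝ (TangentSpace I x)) {F : ι → VectorField I M}
    (hF : ∀ i, IsSmoothVF I (F i)) (hFx : ∀ i, F i x = b i) (L : TangentSpace I x →ₗ[ℝ] A)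
    (hL : ∀ i, L (b i) = Φ (F i)) {X : VectorField I M} (hX : IsSmoothVF I X) :
    L (X x) = Φ X := by
  have h2 (s : Finset ι) :
        IsSmoothVF I (∑ i ∈ s, (fun _ : M => b.repr (X x) i) • F i) ∧
        Φ (∑ i ∈ s, (fun _ : M => b.repr (X x) i) • F i) =
          ∑ i ∈ s, b.repr (X x) i • Φ (F i) := by
    classical
    induction s using Finset.induction_on with
    | empty => simpa using! ⟨isSmoothVF_zero, h.zero⟩
    | insert a s ha ih =>
      rw [Finset.sum_insert ha, Finset.sum_insert ha]
      have := IsSmoothVF.smul (f := fun _ : M => b.repr (X x) a) contMDiff_const (hF a)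
      exact ⟨this.add ih.1, by rw [h.add this ih.1, ih.2, h.smul contMDiff_const (hF a)]⟩
  rw [h.pointwise hX (h2 Finset.univ).1, (h2 _).2]
  · calc L (X x) = L (∑ i, b.repr (X x) i • b i) := by rw [b.sum_repr]
      _ = _ := by simp only [map_sum, map_smul, hL]
  · calc X x = ∑ i, b.repr (X x) i • b i := (b.sum_repr _).symm
      _ = _ := by simp only [Finset.sum_apply, Pi.smul_apply', hFx]

variable [I.Boundaryless]

/-- The right side is tensorial in both fields, since the derivatives of a factor `f` cancel against
those produced by the bracket; so it is determined by its components in the coordinate frame, which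
define `extDerivOne`. -/
theorem extDerivOne_apply {α : OneForm I M} (hα : IsSmoothOneForm I α) {X Y : VectorField I M}
    {x : M} (hX : DiffVFAt I X x) (hY : DiffVFAt I Y x) :
    extDerivOne I α x (X x) (Y x) = mvfderiv I (fun y => α y (Y y)) x (X x)
      - mvfderiv I (fun y => α y (X y)) x (Y x) - α x (mlieBracket I X Y x) := by
  let Φ : VectorField I M → VectorField I M → ℝ := fun X Y =>
    mvfderiv I (fun y => α y (Y y)) x (X x)
      - mvfderiv I (fun y => α y (X y)) x (Y x) - α x (mlieBracket I X Y x)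
  have hsw (X Y) : Φ X Y = - Φ Y X := by
    simp only [Φ]; rw [mlieBracket_swap_apply, map_neg]; ring
  have h1 (Y : VectorField I M) (hY : DiffVFAt I Y x) : TensorialAt I E (Φ · Y) x := by
    refine ⟨fun {f} {X} hf hX => ?_, fun {X} {X'} hX hX' => ?_⟩
    · have e : (fun y => α y ((f • X) y)) = f * fun y => α y (X y) := by
        funext y; simp [Pi.smul_apply']
      simp only [Φ]
      rw [mlieBracket_smul_left hf hX, e, mvfderiv_mul hf (hα.mdifferentiableAt_apply hX)]
      simp only [Pi.smul_apply', map_smul, map_add, map_neg, add_apply,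
        smul_apply, smul_eq_mul, neg_smul]
      ring
    · have e : (fun y => α y ((X + X') y)) = (fun y => α y (X y)) + fun y => α y (X' y) := by
        funext y; simp
      simp only [Φ]
      rw [mlieBracket_add_left hX hX', e, mvfderiv_add (hα.mdifferentiableAt_apply hX)
        (hα.mdifferentiableAt_apply hX')]
      simp only [Pi.add_apply, map_add, add_apply]
      ring
  have h2 (X : VectorField I M) (hX : DiffVFAt I X x) : TensorialAt I E (Φ X ·) x := by
    refine ⟨fun {f} {Y} hf hY => ?_, fun {Y} {Y'} hY hY' => ?_⟩
    · rw [hsw, hsw X Y, (h1 X hX).smul hf hY, smul_neg]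
    · rw [hsw, hsw X Y, hsw X Y', (h1 X hX).add hY hY', neg_add]
  have key : extDerivOne I α x = TensorialAt.mkHom₂ Φ x h1 h2 := by
    refine clm_ext_tangentBasis fun i => clm_ext_tangentBasis fun j => ?_
    rw [TensorialAt.mkHom₂_apply_eq_extend]
    simp only [extDerivOne, ofComponents_tangentBasis, Φ]
    rfl
  rw [key, TensorialAt.mkHom₂_apply _ _ hX hY]

end Tensors

/-! ### Connections, the second Bianchi identity, and the curvature tensor on fields. -/

section Connections

variable {E : Type*} [NormedAddCommGroup E] [NormedSpace ℝ E]
  {H : Type*} [TopologicalSpace H] {I : ModelWithCorners ℝ E H}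
  {M : Type*} [TopologicalSpace M] [ChartedSpace H M] [IsManifold I ∞ M]

/-! ### Covariant derivatives of vector fields -/

/-- The vector field `∇_X Y`. -/
def nabla (D : LinearConnection I M) (X Y : VectorField I M) : VectorField I M :=
  fun x => D Y x (X x)

variable {D : LinearConnection I M}

theorem nabla_apply (X Y : VectorField I M) (x : M) : nabla D X Y x = D Y x (X x) := rfl

theorem nabla_add_left (X X' Y : VectorField I M) :
    nabla D (X + X') Y = nabla D X Y + nabla D X' Y := by
  funext x; simp [nabla]

theorem nabla_neg_left (X Y : VectorField I M) : nabla D (-X) Y = -nabla D X Y := by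
  funext x; simp [nabla]

theorem nabla_sub_left (X X' Y : VectorField I M) :
    nabla D (X - X') Y = nabla D X Y - nabla D X' Y := by
  funext x; simp [nabla]

theorem nabla_smul_left (f : M → ℝ) (X Y : VectorField I M) :
    nabla D (f • X) Y = f • nabla D X Y := by
  funext x; simp [nabla]

theorem nabla_add_right (X : VectorField I M) {Y Y' : VectorField I M} (hY : IsSmoothVF I Y)
    (hY' : IsSmoothVF I Y') : nabla D X (Y + Y') = nabla D X Y + nabla D X Y' := by
  funext x
  simp [nabla, D.isCovariantDerivativeOn.add (hY.diffAt x) (hY'.diffAt x)]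

theorem nabla_smul_right (X : VectorField I M) {f : M → ℝ} (hf : ContMDiff I 𝓘(ℝ, ℝ) ∞ f)
    {Y : VectorField I M} (hY : IsSmoothVF I Y) :
    nabla D X (f • Y) = f • nabla D X Y + (fun x => mvfderiv I f x (X x)) • Y := by
  funext x
  simp [nabla, D.isCovariantDerivativeOn.leibniz (hY.diffAt x) (hf.mdifferentiable (by simp) x)]

theorem nabla_neg_right (X : VectorField I M) {Y : VectorField I M} (hY : IsSmoothVF I Y) :
    nabla D X (-Y) = -nabla D X Y := by
  funext x
  have := D.isCovariantDerivativeOn.smul_const (x := x) (-1 : ℝ) (hY.diffAt x)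
  simp only [neg_smul, one_smul] at this
  simp [nabla, this]

theorem nabla_sub_right (X : VectorField I M) {Y Y' : VectorField I M} (hY : IsSmoothVF I Y)
    (hY' : IsSmoothVF I Y') : nabla D X (Y - Y') = nabla D X Y - nabla D X Y' := by
  rw [sub_eq_add_neg, nabla_add_right X hY hY'.neg, nabla_neg_right X hY', sub_eq_add_neg]

theorem IsSmoothVF.nabla (hD : D.ContMDiffCovariantDerivative ∞) {X Y : VectorField I M}
    (hX : IsSmoothVF I X) (hY : IsSmoothVF I Y) : IsSmoothVF I (nabla D X Y) := by
  have h1 := contMDiffOn_univ.1 (hD.contMDiff.contMDiff (contMDiffOn_univ.2 hY))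
  exact ContMDiff.clm_bundle_apply (F₁ := E) (F₂ := E)
    (E₁ := (TangentSpace I : M → Type _)) (E₂ := (TangentSpace I : M → Type _)) (b := id) h1 hX

theorem curvOp_eq (X Y Z : VectorField I M) : curvOp I D X Y Z =
    nabla D X (nabla D Y Z) - nabla D Y (nabla D X Z) - nabla D (mlieBracket I X Y) Z := rfl

theorem curvOp_swap (X Y Z : VectorField I M) : curvOp I D X Y Z = -curvOp I D Y X Z := by
  rw [curvOp_eq, curvOp_eq, mlieBracket_swap, nabla_neg_left]
  abel

variable [FiniteDimensional ℝ E]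

theorem IsSmoothVF.curvOp (hD : D.ContMDiffCovariantDerivative ∞) {X Y Z : VectorField I M}
    (hX : IsSmoothVF I X) (hY : IsSmoothVF I Y) (hZ : IsSmoothVF I Z) :
    IsSmoothVF I (curvOp I D X Y Z) := by
  have := FiniteDimensional.complete ℝ E
  rw [curvOp_eq]
  exact ((hX.nabla hD (hY.nabla hD hZ)).sub (hY.nabla hD (hX.nabla hD hZ))).sub
    ((hX.mlieBracket hY).nabla hD hZ)

/-- The second Bianchi identity for vector fields. -/
theorem second_bianchi (hD : D.ContMDiffCovariantDerivative ∞) {X Y Z V : VectorField I M}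
    (hX : IsSmoothVF I X) (hY : IsSmoothVF I Y) (hZ : IsSmoothVF I Z) (hV : IsSmoothVF I V) :
    (nabla D X (curvOp I D Y Z V) - curvOp I D Y Z (nabla D X V)
        - curvOp I D (mlieBracket I X Y) Z V)
      + (nabla D Y (curvOp I D Z X V) - curvOp I D Z X (nabla D Y V)
        - curvOp I D (mlieBracket I Y Z) X V)
      + (nabla D Z (curvOp I D X Y V) - curvOp I D X Y (nabla D Z V)
        - curvOp I D (mlieBracket I Z X) Y V) = 0 := by
  have := FiniteDimensional.complete ℝ E
  have h (A B C : VectorField I M) (hA : IsSmoothVF I A) (hB : IsSmoothVF I B)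
      (hC : IsSmoothVF I C) : nabla D A (SymplecticInduction.curvOp I D B C V) =
      nabla D A (nabla D B (nabla D C V)) - nabla D A (nabla D C (nabla D B V))
        - nabla D A (nabla D (mlieBracket I B C) V) := by
    rw [curvOp_eq, nabla_sub_right _ ((hB.nabla hD (hC.nabla hD hV)).sub
      (hC.nabla hD (hB.nabla hD hV))) ((hB.mlieBracket hC).nabla hD hV),
      nabla_sub_right _ (hB.nabla hD (hC.nabla hD hV)) (hC.nabla hD (hB.nabla hD hV))]
  -- In the cyclic sum all compositions of covariant derivatives cancel, whatever the torsion; what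
  -- remains is the covariant derivative of `V` along this Jacobi sum.
  have hJ : mlieBracket I (mlieBracket I X Y) Z + mlieBracket I (mlieBracket I Y Z) X
      + mlieBracket I (mlieBracket I Z X) Y = 0 := by
    funext x
    have h1 := mlieBracket_jacobi hX hY hZ x
    rw [mlieBracket_swap (V := X) (W := Z), mlieBracket_swap_apply,
      mlieBracket_swap_apply (V := Y)] at h1
    have h2 : mlieBracket I (-mlieBracket I Z X) Y x = -mlieBracket I (mlieBracket I Z X) Y x := by
      have := mlieBracket_const_smul_left (I := I) (c := (-1 : ℝ)) (W := Y)
        ((hZ.mlieBracket hX).diffAt x)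
      simpa using this
    rw [h2] at h1
    simp only [Pi.add_apply, Pi.zero_apply]
    rw [neg_neg] at h1
    rw [add_right_comm, ← h1, neg_add_cancel]
  rw [h X Y Z hX hY hZ, h Y Z X hY hZ hX, h Z X Y hZ hX hY]
  simp only [curvOp_eq]
  have hJ' := congrArg (fun W => nabla D W V) hJ
  simp only [nabla_add_left] at hJ'
  have h0 : nabla D (0 : VectorField I M) V = 0 := by funext x; simp [nabla]
  rw [h0] at hJ'
  rw [← hJ']
  abel

variable [T2Space M]

theorem smoothTensorialAt_curvOp_left (hD : D.ContMDiffCovariantDerivative ∞)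
    {Y Z : VectorField I M} (hZ : IsSmoothVF I Z) (x : M) :
    SmoothTensorialAt I (fun X => curvOp I D X Y Z x) x where
  smul {f X} hf hX := by
    have h := mlieBracket_smul_left (I := I) (W := Y) (hf.mdifferentiable (by simp) x)
      (hX.diffAt x)
    simp only [curvOp_eq, nabla_smul_left, nabla_smul_right Y hf (hX.nabla hD hZ)]
    simp only [Pi.sub_apply, Pi.add_apply, Pi.smul_apply', nabla_apply, h, map_add, map_smul,
      neg_smul, map_neg]
    module
  add {X X'} hX hX' := by
    have h := mlieBracket_add_left (I := I) (W := Y) (hX.diffAt x) (hX'.diffAt x)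
    simp only [curvOp_eq, nabla_add_left, nabla_add_right Y (hX.nabla hD hZ) (hX'.nabla hD hZ)]
    simp only [Pi.sub_apply, Pi.add_apply, nabla_apply, h, map_add]
    module

theorem smoothTensorialAt_curvOp_middle (hD : D.ContMDiffCovariantDerivative ∞)
    {X Z : VectorField I M} (hZ : IsSmoothVF I Z) (x : M) :
    SmoothTensorialAt I (fun Y => curvOp I D X Y Z x) x where
  smul {f Y} hf hY := by
    have := (smoothTensorialAt_curvOp_left (Y := X) hD hZ x).smul hf hY
    rw [curvOp_swap, curvOp_swap X Y, Pi.neg_apply, this, Pi.neg_apply, smul_neg]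
  add {Y Y'} hY hY' := by
    have := (smoothTensorialAt_curvOp_left (Y := X) hD hZ x).add hY hY'
    rw [curvOp_swap, curvOp_swap X Y, curvOp_swap X Y', Pi.neg_apply, this, Pi.neg_apply,
      Pi.neg_apply, neg_add]

variable [I.Boundaryless]

/-- The second derivatives `X(Yf) - Y(Xf)` are cancelled by the derivative of `f` along `[X, Y]`,
which is where `mvfderiv_mlieBracket` is needed. -/
theorem smoothTensorialAt_curvOp_right (hD : D.ContMDiffCovariantDerivative ∞)
    {X Y : VectorField I M} (hX : IsSmoothVF I X) (hY : IsSmoothVF I Y) (x : M) :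
    SmoothTensorialAt I (fun Z => curvOp I D X Y Z x) x where
  smul {f Z} hf hZ := by
    have hfX := contMDiff_mvfderiv_apply hf hX
    have hfY := contMDiff_mvfderiv_apply hf hY
    have h := mvfderiv_mlieBracket hf (hX.diffAt x) (hY.diffAt x)
    simp only [curvOp_eq, nabla_smul_right _ hf hZ]
    rw [nabla_add_right _ (.smul hf (hY.nabla hD hZ)) (.smul hfY hZ),
      nabla_add_right _ (.smul hf (hX.nabla hD hZ)) (.smul hfX hZ),
      nabla_smul_right _ hf (hY.nabla hD hZ), nabla_smul_right _ hf (hX.nabla hD hZ),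
      nabla_smul_right _ hfY hZ, nabla_smul_right _ hfX hZ]
    simp only [Pi.sub_apply, Pi.add_apply, Pi.smul_apply', h, nabla_apply]
    module
  add {Z Z'} hZ hZ' := by
    simp only [curvOp_eq, nabla_add_right _ hZ hZ',
      nabla_add_right _ (hX.nabla hD hZ) (hX.nabla hD hZ'),
      nabla_add_right _ (hY.nabla hD hZ) (hY.nabla hD hZ')]
    simp only [Pi.sub_apply, Pi.add_apply]
    abel

/-- The value at `x` sees germs only. This bridges the fields `frame`, smooth only near `x`, and
their global substitutes. -/
theorem curvOp_congr (hD : D.ContMDiffCovariantDerivative ∞) {X Y Z X' Y' Z' : VectorField I M}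
    (hX : IsSmoothVF I X) (hY : IsSmoothVF I Y) (hZ : IsSmoothVF I Z) {x : M}
    (hXX' : X =ᶠ[𝓝 x] X') (hYY' : Y =ᶠ[𝓝 x] Y') (hZZ' : Z =ᶠ[𝓝 x] Z') :
    curvOp I D X Y Z x = curvOp I D X' Y' Z' x := by
  have hcongr {A A' : VectorField I M} (hA : IsSmoothVF I A) {y : M} (h : A =ᶠ[𝓝 y] A') :
      D A y = D A' y := by
    refine D.isCovariantDerivativeOn.congr_of_eventuallyEq (s := Set.univ) (hA.diffAt y)
      ?_ univ_mem h
    refine (hA.diffAt y).congr_of_eventuallyEq ?_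
    filter_upwards [h] with z hz
    rw [hz]
  have h1 {A A' B B' : VectorField I M} (hA : IsSmoothVF I A) (h : A =ᶠ[𝓝 x] A')
      (h' : B =ᶠ[𝓝 x] B') : nabla D B A =ᶠ[𝓝 x] fun y => D A' y (B' y) := by
    filter_upwards [h.eventuallyEq_nhds, h'] with y hy hy'
    rw [nabla_apply, hcongr hA hy, hy']
  rw [curvOp_eq]
  simp only [Pi.sub_apply, nabla_apply, curvOp]
  rw [hcongr (hY.nabla hD hZ) (h1 hZ hZZ' hYY'), hcongr (hX.nabla hD hZ) (h1 hZ hZZ' hXX'),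
    hcongr hZ hZZ', hXX'.mlieBracket_vectorField_eq hYY', hXX'.self_of_nhds, hYY'.self_of_nhds]

/-- The curvature tensor evaluated on smooth vector fields. -/
theorem curvature_apply (hD : D.ContMDiffCovariantDerivative ∞) {X Y Z : VectorField I M}
    (hX : IsSmoothVF I X) (hY : IsSmoothVF I Y) (hZ : IsSmoothVF I Z) (x : M) :
    curvature I D x (X x) (Y x) (Z x) = curvOp I D X Y Z x := by
  obtain ⟨F, hF⟩ := exists_frame (I := I) x
  have hFx (i) : F i x = tangentBasis I x i := by rw [(hF i).2.self_of_nhds, frame_self]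
  have h0 (i j k) : curvature I D x (F i x) (F j x) (F k x) = curvOp I D (F i) (F j) (F k) x := by
    rw [hFx, hFx, hFx, curvOp_congr hD (hF i).1 (hF j).1 (hF k).1 (hF i).2 (hF j).2 (hF k).2]
    simp only [curvature, ofComponents_tangentBasis]
  have h1 (i j) : curvature I D x (F i x) (F j x) (Z x) = curvOp I D (F i) (F j) Z x :=
    (smoothTensorialAt_curvOp_right hD (hF i).1 (hF j).1 x).apply_eq (tangentBasis I x)
      (fun i => (hF i).1) hFx (curvature I D x (F i x) (F j x)).toLinearMap
      (fun k => by rw [← hFx]; exact h0 i j k) hZ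
  have h2 (i) : curvature I D x (F i x) (Y x) (Z x) = curvOp I D (F i) Y Z x :=
    (smoothTensorialAt_curvOp_middle hD hZ x).apply_eq (tangentBasis I x)
      (fun i => (hF i).1) hFx
      { toFun := fun v => curvature I D x (F i x) v (Z x)
        map_add' := fun v w =>
          congrArg (fun L => L (Z x)) (ContinuousLinearMap.map_add (curvature I D x (F i x)) v w)
        map_smul' := fun c v => congrArg (fun L => L (Z x))
          (ContinuousLinearMap.map_smul (curvature I D x (F i x)) c v) }
      (fun j => by rw [← hFx]; exact h1 i j) hY
  exact (smoothTensorialAt_curvOp_left hD hZ x).apply_eq (tangentBasis I x)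
      (fun i => (hF i).1) hFx
      { toFun := fun v => curvature I D x v (Y x) (Z x)
        map_add' := fun v w =>
          congrArg (fun L => L (Y x) (Z x)) (ContinuousLinearMap.map_add (curvature I D x) v w)
        map_smul' := fun c v =>
          congrArg (fun L => L (Y x) (Z x)) (ContinuousLinearMap.map_smul (curvature I D x) c v) }
      (fun j => by rw [← hFx]; exact h2 j) hX

end Connections

/-! ### Traces of skew endomorphisms. -/

section LinearAlgebra

open Module

variable {V : Type*} [AddCommGroup V] [Module ℝ V] [FiniteDimensional ℝ V]

/-- A skew endomorphism of a space with a nondegenerate form has trace zero. -/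
theorem trace_eq_zero_of_skew (B : V →ₗ[ℝ] V →ₗ[ℝ] ℝ)
    (hnd : ∀ v, (∀ w, B v w = 0) → v = 0) (A : V →ₗ[ℝ] V)
    (h : ∀ v w, B (A v) w = -B v (A w)) : LinearMap.trace ℝ V A = 0 := by
  have hinj : Function.Injective B := (injective_iff_map_eq_zero _).2 fun v hv =>
    hnd v fun w => by rw [hv]; rfl
  let e : V ≃ₗ[ℝ] Dual ℝ V :=
    LinearMap.linearEquivOfInjective B hinj (Subspace.dual_finrank_eq).symm
  have he (v) : e v = B v := rfl
  -- The form identifies `V` with its dual and turns `A` into minus its transpose, so the trace of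
  -- `A` equals its own opposite.
  have h1 : e.conj A = (-1 : ℝ) • Dual.transpose A := by
    ext φ w
    obtain ⟨v, rfl⟩ := e.surjective φ
    rw [LinearEquiv.conj_apply_apply, e.symm_apply_apply, he, h]
    rw [LinearMap.smul_apply, LinearMap.smul_apply, neg_one_smul]
    rfl
  have h2 := LinearMap.trace_conj' A e
  rw [h1, map_smul, LinearMap.trace_transpose', neg_one_smul] at h2
  linarith

end LinearAlgebra

/-! ### Symplectic connections: identities and traces of the curvature. -/

section SymplecticConnections

variable {E : Type*} [NormedAddCommGroup E] [NormedSpace ℝ E]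
  {H : Type*} [TopologicalSpace H] {I : ModelWithCorners ℝ E H}
  {M : Type*} [TopologicalSpace M] [ChartedSpace H M] [IsManifold I ∞ M]
  [FiniteDimensional ℝ E] {D : LinearConnection I M} {Ω s : TwoTensor I M}

/-! ### The Ricci tensor as a trace -/

/-- The endomorphism `w ↦ R(u, w)v`. -/
def ricciOp (D : LinearConnection I M) (x : M) (u v : TangentSpace I x) :
    TangentSpace I x →ₗ[ℝ] TangentSpace I x :=
  ((ContinuousLinearMap.coeLM ℝ).comp (curvature I D x u).toLinearMap).flip v

theorem ricciOp_apply (x : M) (u v w : TangentSpace I x) :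
    ricciOp D x u v w = curvature I D x u w v := rfl

theorem ricci_apply (x : M) (u v : TangentSpace I x) :
    ricci I D x u v = LinearMap.trace ℝ (TangentSpace I x) (ricciOp D x u v) := by
  let L : TangentSpace I x →ₗ[ℝ] TangentSpace I x →ₗ[ℝ] ℝ := LinearMap.mk₂ ℝ
    (fun u v => LinearMap.trace ℝ (TangentSpace I x) (ricciOp D x u v))
    (fun u u' v => by
      rw [← map_add]; congr 1; ext w
      exact congr($(ContinuousLinearMap.map_add (curvature I D x) u u') w v))
    (fun c u v => by
      rw [smul_eq_mul, ← smul_eq_mul, ← map_smul]; congr 1; ext w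
      exact congr($(ContinuousLinearMap.map_smul (curvature I D x) c u) w v))
    (fun u v v' => by
      rw [← map_add]; congr 1; ext w
      exact ContinuousLinearMap.map_add (curvature I D x u w) v v')
    (fun c u v => by
      rw [smul_eq_mul, ← smul_eq_mul, ← map_smul]; congr 1; ext w
      exact ContinuousLinearMap.map_smul (curvature I D x u w) c v)
  have : (ricci I D x u).toLinearMap = L u := by
    have h : (ContinuousLinearMap.coeLM ℝ).comp (ricci I D x).toLinearMap = L := by
      refine (tangentBasis I x).ext fun i => (tangentBasis I x).ext fun j => ?_
      change ricci I D x _ _ = _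
      simp only [ricci, ofComponents_tangentBasis]
      rfl
    exact congr($h u)
  exact congr($this v)

/-! ### Nondegenerate forms -/

theorem isInvertible_of_nondegenerate (B : E →L[ℝ] E →L[ℝ] ℝ)
    (h : ∀ v, (∀ w, B v w = 0) → v = 0) : B.IsInvertible := by
  have hinj : Function.Injective B.toLinearMap := (injective_iff_map_eq_zero _).2 fun v hv =>
    h v fun w => congr($hv w)
  have hdim : Module.finrank ℝ E = Module.finrank ℝ (E →L[ℝ] ℝ) := by
    rw [← LinearEquiv.finrank_eq (LinearMap.toContinuousLinearMap (𝕜 := ℝ) (E := E) (F' := ℝ))]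
    exact Subspace.dual_finrank_eq.symm
  refine ⟨(LinearMap.linearEquivOfInjective B.toLinearMap hinj hdim).toContinuousLinearEquiv, ?_⟩
  ext v w
  rfl

theorem IsSymplecticForm.isInvertible (hΩ : IsSymplecticForm I Ω) (x : M) :
    (Ω x).IsInvertible :=
  isInvertible_of_nondegenerate (E := E) (Ω x) (hΩ.nondegenerate x)

theorem IsSymplecticForm.swap (hΩ : IsSymplecticForm I Ω) {x : M} (v w : TangentSpace I x) :
    Ω x v w = -Ω x w v := by
  have h := hΩ.alternating x (v + w)
  simp only [map_add, add_apply, hΩ.alternating] at h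
  linarith

theorem IsSymplecticForm.eq_of_forall (hΩ : IsSymplecticForm I Ω) {x : M}
    {v w : TangentSpace I x} (h : ∀ z, Ω x z v = Ω x z w) : v = w := by
  refine sub_eq_zero.1 (hΩ.nondegenerate x _ fun z => ?_)
  rw [hΩ.swap, map_sub, h, sub_self, neg_zero]

theorem IsSymplecticForm.symplSharp_apply (hΩ : IsSymplecticForm I Ω) (β : OneForm I M) (x : M) :
    Ω x (symplSharp I Ω β x) = β x :=
  (hΩ.isInvertible x).self_apply_inverse _

theorem flipTwo_apply (x : M) (u v : TangentSpace I x) : flipTwo I s x u v = s x v u := by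
  have : flipTwo I s x u = LinearMap.toContinuousLinearMap
      ((ContinuousLinearMap.coeLM ℝ).comp (s x).toLinearMap |>.flip u) := by
    have h : (flipTwo I s x).toLinearMap = LinearMap.toContinuousLinearMap.toLinearMap.comp
      ((ContinuousLinearMap.coeLM ℝ).comp (s x).toLinearMap).flip := by
      refine (tangentBasis I x).ext fun i => clm_ext_tangentBasis fun j => ?_
      change flipTwo I s x _ _ = _
      simp only [flipTwo, ofComponents_tangentBasis]
      rfl
    exact congr($h u)
  rw [this]
  rfl

theorem IsSymplecticForm.symplEnd_apply (hΩ : IsSymplecticForm I Ω) (s : TwoTensor I M) {x : M}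
    (u v : TangentSpace I x) : Ω x u (symplEnd I Ω s x v) = s x u v := by
  have h : Ω x ((Ω x).inverse (flipTwo I s x v)) = flipTwo I s x v :=
    (hΩ.isInvertible x).self_apply_inverse _
  change Ω x u (-((Ω x).inverse (flipTwo I s x v))) = _
  rw [map_neg, ← hΩ.swap, h, flipTwo_apply]

/-! ### Curvature of a symplectic connection -/

theorem curvature_swap (hD : D.ContMDiffCovariantDerivative ∞) [T2Space M] [I.Boundaryless] (x : M)
    (u v w : TangentSpace I x) : curvature I D x u v w = -curvature I D x v u w := by
  obtain ⟨X, hX, rfl⟩ := exists_isSmoothVF_apply_eq x u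
  obtain ⟨Y, hY, rfl⟩ := exists_isSmoothVF_apply_eq x v
  obtain ⟨Z, hZ, rfl⟩ := exists_isSmoothVF_apply_eq x w
  rw [curvature_apply hD hX hY hZ, curvature_apply hD hY hX hZ, curvOp_swap]
  rfl

theorem IsSymplecticConnection.mlieBracket_eq (hD : IsSymplecticConnection I Ω D)
    {X Y : VectorField I M} (hX : IsSmoothVF I X) (hY : IsSmoothVF I Y) :
    mlieBracket I X Y = nabla D X Y - nabla D Y X := by
  have := FiniteDimensional.complete ℝ E
  funext x
  exact (D.torsion_eq_zero_iff.1 hD.torsion_free (hX.diffAt x) (hY.diffAt x)).symm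

theorem IsSymplecticConnection.mvfderiv_apply (hD : IsSymplecticConnection I Ω D)
    {Y Z : VectorField I M} (hY : IsSmoothVF I Y) (hZ : IsSmoothVF I Z) (X : VectorField I M)
    (x : M) : mvfderiv I (fun y => Ω y (Y y) (Z y)) x (X x) =
      Ω x (nabla D X Y x) (Z x) + Ω x (Y x) (nabla D X Z x) :=
  hD.parallel Y Z x (hY.diffAt x) (hZ.diffAt x) (X x)

section

variable [T2Space M] [I.Boundaryless]

/-- Zero torsion turns every bracket into a difference of covariant derivatives; the cyclic sum of
curvatures is then the Jacobi identity. -/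
theorem IsSymplecticConnection.first_bianchi (hD : IsSymplecticConnection I Ω D) (x : M)
    (u v w : TangentSpace I x) :
    curvature I D x u v w + curvature I D x v w u + curvature I D x w u v = 0 := by
  have := FiniteDimensional.complete ℝ E
  obtain ⟨X, hX, rfl⟩ := exists_isSmoothVF_apply_eq x u
  obtain ⟨Y, hY, rfl⟩ := exists_isSmoothVF_apply_eq x v
  obtain ⟨Z, hZ, rfl⟩ := exists_isSmoothVF_apply_eq x w
  have hs := hD.smooth
  rw [curvature_apply hs hX hY hZ, curvature_apply hs hY hZ hX, curvature_apply hs hZ hX hY]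
  have hJ := mlieBracket_jacobi hX hY hZ x
  rw [hD.mlieBracket_eq hX (hY.mlieBracket hZ), hD.mlieBracket_eq (hX.mlieBracket hY) hZ,
    hD.mlieBracket_eq hY (hX.mlieBracket hZ)] at hJ
  rw [hD.mlieBracket_eq hY hZ, hD.mlieBracket_eq hX hY, hD.mlieBracket_eq hX hZ] at hJ
  have n1 {A B : VectorField I M} (hA : IsSmoothVF I A) (hB : IsSmoothVF I B) := hA.nabla hs hB
  rw [nabla_sub_right _ (n1 hY hZ) (n1 hZ hY), nabla_sub_right _ (n1 hX hY) (n1 hY hX),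
    nabla_sub_right _ (n1 hX hZ) (n1 hZ hX)] at hJ
  simp only [curvOp_eq]
  rw [hD.mlieBracket_eq hY hZ, hD.mlieBracket_eq hX hY, hD.mlieBracket_eq hZ hX]
  simp only [nabla_sub_left, Pi.sub_apply] at hJ ⊢
  rw [← sub_eq_zero] at hJ
  rw [← hJ]
  abel

/-- The function `Ω(Z, W)` is differentiated along `[X, Y]` directly and as a commutator. As `Ω` is
parallel, the mixed first-order terms cancel and the curvature acting on `Z` and on `W` is left. -/
theorem IsSymplecticConnection.curvature_skew (hΩ : IsSymplecticForm I Ω)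
    (hD : IsSymplecticConnection I Ω D) (x : M) (u v w z : TangentSpace I x) :
    Ω x (curvature I D x u v w) z = -Ω x w (curvature I D x u v z) := by
  have := FiniteDimensional.complete ℝ E
  obtain ⟨X, hX, rfl⟩ := exists_isSmoothVF_apply_eq x u
  obtain ⟨Y, hY, rfl⟩ := exists_isSmoothVF_apply_eq x v
  obtain ⟨Z, hZ, rfl⟩ := exists_isSmoothVF_apply_eq x w
  obtain ⟨W, hW, rfl⟩ := exists_isSmoothVF_apply_eq x z
  have hs := hD.smooth
  rw [curvature_apply hs hX hY hZ, curvature_apply hs hX hY hW]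
  have h := mvfderiv_mlieBracket (hΩ.smooth.apply hZ hW) (hX.diffAt x) (hY.diffAt x)
  rw [hD.mvfderiv_apply hZ hW] at h
  have e (A : VectorField I M) : (fun y => mvfderiv I (fun y => Ω y (Z y) (W y)) y (A y)) =
      (fun y => Ω y (nabla D A Z y) (W y)) + fun y => Ω y (Z y) (nabla D A W y) := by
    funext y; exact hD.mvfderiv_apply hZ hW A y
  have e2 (A B : VectorField I M) (hA : IsSmoothVF I A) :
      mvfderiv I (fun y => mvfderiv I (fun y => Ω y (Z y) (W y)) y (A y)) x (B x) =
      Ω x (nabla D B (nabla D A Z) x) (W x) + Ω x (nabla D A Z x) (nabla D B W x)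
      + (Ω x (nabla D B Z x) (nabla D A W x) + Ω x (Z x) (nabla D B (nabla D A W) x)) := by
    have hAZ := hA.nabla hs hZ
    have hAW := hA.nabla hs hW
    rw [e, mvfderiv_add ((hΩ.smooth.apply hAZ hW).mdifferentiable (by simp) x)
      ((hΩ.smooth.apply hZ hAW).mdifferentiable (by simp) x), add_apply,
      hD.mvfderiv_apply hAZ hW, hD.mvfderiv_apply hZ hAW]
  rw [e2 X Y hX, e2 Y X hY] at h
  simp only [curvOp_eq, Pi.sub_apply, map_sub, sub_apply]
  linarith

theorem IsSymplecticConnection.trace_curvature (hΩ : IsSymplecticForm I Ω)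
    (hD : IsSymplecticConnection I Ω D) (x : M) (u v : TangentSpace I x) :
    LinearMap.trace ℝ (TangentSpace I x) (curvature I D x u v).toLinearMap = 0 :=
  trace_eq_zero_of_skew ((ContinuousLinearMap.coeLM ℝ).comp (Ω x).toLinearMap)
    (hΩ.nondegenerate x) _ fun w z => hD.curvature_skew hΩ x u v w z

/-- By the first Bianchi identity the two Ricci operators differ by a curvature endomorphism, which
is skew for `Ω` and hence traceless. -/
theorem IsSymplecticConnection.ricci_symm (hΩ : IsSymplecticForm I Ω)
    (hD : IsSymplecticConnection I Ω D) (x : M) (u v : TangentSpace I x) :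
    ricci I D x u v = ricci I D x v u := by
  have h : ricciOp D x u v - ricciOp D x v u + (curvature I D x v u).toLinearMap = 0 := by
    ext w
    have h1 := hD.first_bianchi x u w v
    rw [curvature_swap hD.smooth x w v u] at h1
    simp only [LinearMap.add_apply, LinearMap.sub_apply, ricciOp_apply]
    rw [sub_eq_add_neg]
    exact h1
  have := congrArg (LinearMap.trace ℝ (TangentSpace I x)) h
  rw [map_add, map_sub, hD.trace_curvature hΩ, ← ricci_apply, ← ricci_apply, map_zero] at this
  linarith

theorem contMDiff_curvature_apply (hD : D.ContMDiffCovariantDerivative ∞) {X Y Z : VectorField I M}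
    (hX : IsSmoothVF I X) (hY : IsSmoothVF I Y) (hZ : IsSmoothVF I Z) :
    IsSmoothVF I (fun x => curvature I D x (X x) (Y x) (Z x)) := by
  have : (fun x => curvature I D x (X x) (Y x) (Z x)) = curvOp I D X Y Z :=
    funext fun x => curvature_apply hD hX hY hZ x
  rw [this]
  exact hX.curvOp hD hY hZ

theorem isSmoothTwoTensor_ricci (hD : D.ContMDiffCovariantDerivative ∞) :
    IsSmoothTwoTensor I (ricci I D) :=
  isSmoothTwoTensor_of_forall fun X Y hX hY => by
    simp only [ricci_apply]
    exact contMDiff_trace fun Z hZ => contMDiff_curvature_apply hD hX hZ hY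

theorem IsSmoothTwoTensor.symplEnd (hs : IsSmoothTwoTensor I s) (hΩ : IsSymplecticForm I Ω) :
    IsSmoothEnd (symplEnd I Ω s) :=
  isSmoothEnd_of_forall fun X hX =>
    isSmoothVF_of_nondegenerate hΩ.smooth hΩ.nondegenerate fun Y hY => by
      have : (fun x => Ω x (SymplecticInduction.symplEnd I Ω s x (X x)) (Y x)) =
          fun x => -s x (Y x) (X x) := by
        funext x; rw [hΩ.swap, hΩ.symplEnd_apply]
      rw [this]
      exact (hs.apply hY hX).neg

theorem IsSmoothOneForm.symplSharp {β : OneForm I M} (hβ : IsSmoothOneForm I β)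
    (hΩ : IsSymplecticForm I Ω) : IsSmoothVF I (symplSharp I Ω β) :=
  isSmoothVF_of_nondegenerate hΩ.smooth hΩ.nondegenerate fun Y hY => by
    simp only [hΩ.symplSharp_apply]
    exact hβ.apply hY

/-! ### Covariant derivative of an endomorphism field -/

theorem tensorialAt_covDerivEnd {σ : EndField I M} (hσ : IsSmoothEnd σ) (x : M) :
    TensorialAt I E (fun Y : VectorField I M =>
      (D (fun y => σ y (Y y)) x - (σ x).comp (D Y x) : TangentSpace I x →L[ℝ] TangentSpace I x))
      x := by
  refine ⟨fun {f} {Y} hf hY => ?_, fun {Y} {Y'} hY hY' => ?_⟩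
  · have e : (fun y => σ y ((f • Y) y)) = f • fun y => σ y (Y y) := by
      funext y; simp [Pi.smul_apply']
    rw [e, D.isCovariantDerivativeOn.leibniz hY hf,
      D.isCovariantDerivativeOn.leibniz (hσ.diffVFAt_apply hY) hf]
    ext v
    simp
    module
  · have e : (fun y => σ y ((Y + Y') y)) = (fun y => σ y (Y y)) + fun y => σ y (Y' y) := by
      funext y; simp
    rw [e, D.isCovariantDerivativeOn.add hY hY',
      D.isCovariantDerivativeOn.add (hσ.diffVFAt_apply hY) (hσ.diffVFAt_apply hY')]
    ext v
    simp
    abel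

end

end SymplecticConnections

/-! ### Linear algebra of the contact condition. -/

section LinearAlgebra

open Module

variable {V : Type*} [AddCommGroup V] [Module ℝ V]

theorem eq_zero_or_odd_or_even {n : ℕ} (j : Fin (2 * n + 1)) :
    j = 0 ∨ (∃ i : Fin n, j = ⟨2 * i.1 + 1, by omega⟩) ∨
      ∃ i : Fin n, j = ⟨2 * i.1 + 2, by omega⟩ := by
  rcases Nat.even_or_odd' j.1 with ⟨m, hm | hm⟩
  · rcases Nat.eq_zero_or_pos m with rfl | hm0
    · exact Or.inl (Fin.ext (by simpa using hm))
    · exact Or.inr (Or.inr ⟨⟨m - 1, by omega⟩, Fin.ext (by simp; omega)⟩)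
  · exact Or.inr (Or.inl ⟨⟨m, by omega⟩, Fin.ext (by simp; omega)⟩)

/-- The slot `j` occurs in exactly one factor: in `φ` if `j = 0`, in the first argument of some `B`
if `j` is odd, in the second if `j > 0` is even. The other factors form a constant. -/
theorem exists_linear_contactProduct (n : ℕ) (φ : V →ₗ[ℝ] ℝ) (B : V →ₗ[ℝ] V →ₗ[ℝ] ℝ)
    (v : Fin (2 * n + 1) → V) (j : Fin (2 * n + 1)) : ∃ L : V →ₗ[ℝ] ℝ, ∀ a,
    φ (Function.update v j a 0) * ∏ i : Fin n, B (Function.update v j a ⟨2 * i.1 + 1, by omega⟩)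
      (Function.update v j a ⟨2 * i.1 + 2, by omega⟩) = L a := by
  rcases eq_zero_or_odd_or_even j with rfl | ⟨i₀, rfl⟩ | ⟨i₀, rfl⟩
  · refine ⟨(∏ i : Fin n, B (v ⟨2 * i.1 + 1, by omega⟩) (v ⟨2 * i.1 + 2, by omega⟩)) • φ,
      fun a => ?_⟩
    simp [mul_comm]
  · refine ⟨(φ (v 0) * ∏ i ∈ Finset.univ.erase i₀, B (v ⟨2 * i.1 + 1, by omega⟩)
      (v ⟨2 * i.1 + 2, by omega⟩)) • B.flip (v ⟨2 * i₀.1 + 2, by omega⟩), fun a => ?_⟩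
    have h0 : (0 : Fin (2 * n + 1)) ≠ ⟨2 * i₀.1 + 1, by omega⟩ := by simp [Fin.ext_iff]
    rw [Function.update_of_ne h0, ← Finset.mul_prod_erase _ _ (Finset.mem_univ i₀),
      Function.update_self, Function.update_of_ne (by simp [Fin.ext_iff]),
      Finset.prod_congr rfl (g := fun i : Fin n => B (v ⟨2 * i.1 + 1, by omega⟩)
        (v ⟨2 * i.1 + 2, by omega⟩)) fun i hi => ?_]
    · simp only [LinearMap.smul_apply, smul_eq_mul, LinearMap.flip_apply]; ring
    · have hi : i.1 ≠ i₀.1 := fun h => (Finset.mem_erase.1 hi).1 (Fin.ext h)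
      rw [Function.update_of_ne (by simp [Fin.ext_iff]; omega),
        Function.update_of_ne (by simp [Fin.ext_iff]; omega)]
  · refine ⟨(φ (v 0) * ∏ i ∈ Finset.univ.erase i₀, B (v ⟨2 * i.1 + 1, by omega⟩)
      (v ⟨2 * i.1 + 2, by omega⟩)) • B (v ⟨2 * i₀.1 + 1, by omega⟩), fun a => ?_⟩
    have h0 : (0 : Fin (2 * n + 1)) ≠ ⟨2 * i₀.1 + 2, by omega⟩ := by simp [Fin.ext_iff]
    rw [Function.update_of_ne h0, ← Finset.mul_prod_erase _ _ (Finset.mem_univ i₀),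
      Function.update_self, Function.update_of_ne (by simp [Fin.ext_iff]),
      Finset.prod_congr rfl (g := fun i : Fin n => B (v ⟨2 * i.1 + 1, by omega⟩)
        (v ⟨2 * i.1 + 2, by omega⟩)) fun i hi => ?_]
    · simp only [LinearMap.smul_apply, smul_eq_mul]; ring
    · have hi : i.1 ≠ i₀.1 := fun h => (Finset.mem_erase.1 hi).1 (Fin.ext h)
      rw [Function.update_of_ne (by simp [Fin.ext_iff]; omega),
        Function.update_of_ne (by simp [Fin.ext_iff]; omega)]

/-- The multilinear map `v ↦ φ(v₀) B(v₁, v₂) ⋯ B(v_{2n-1}, v_{2n})`. -/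
def contactMultilinear (n : ℕ) (φ : V →ₗ[ℝ] ℝ) (B : V →ₗ[ℝ] V →ₗ[ℝ] ℝ) :
    MultilinearMap ℝ (fun _ : Fin (2 * n + 1) => V) ℝ :=
  MultilinearMap.mk' (fun v => φ (v 0) *
      ∏ i : Fin n, B (v ⟨2 * i.1 + 1, by omega⟩) (v ⟨2 * i.1 + 2, by omega⟩))
    (fun v j a b => by
      obtain ⟨L, hL⟩ := exists_linear_contactProduct n φ B v j
      rw [hL, hL, hL, map_add])
    (fun v j c a => by
      obtain ⟨L, hL⟩ := exists_linear_contactProduct n φ B v j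
      rw [hL, hL, map_smul])

/-- If `φ ∧ B^n` is nonzero in dimension `2n + 1`, then `φ` and `B` have no common kernel. -/
theorem eq_zero_of_contact {n : ℕ} (φ : V →ₗ[ℝ] ℝ) (B : V →ₗ[ℝ] V →ₗ[ℝ] ℝ)
    (hdim : finrank ℝ V = 2 * n + 1) (x : Fin (2 * n + 1) → V)
    (hx : ∑ τ : Equiv.Perm (Fin (2 * n + 1)), ((Equiv.Perm.sign τ : ℤ) : ℝ) *
      (φ (x (τ 0)) * ∏ i : Fin n,
        B (x (τ ⟨2 * i.1 + 1, by omega⟩)) (x (τ ⟨2 * i.1 + 2, by omega⟩))) ≠ 0)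
    {v : V} (hφ : φ v = 0) (hB : ∀ w, B v w = 0) (hB' : ∀ w, B w v = 0) : v = 0 := by
  by_contra hv
  have : FiniteDimensional ℝ V := FiniteDimensional.of_finrank_pos (by omega)
  let Θ := MultilinearMap.alternatization (contactMultilinear n φ B)
  have hΘ (y : Fin (2 * n + 1) → V) : Θ y =
      ∑ τ : Equiv.Perm (Fin (2 * n + 1)), ((Equiv.Perm.sign τ : ℤ) : ℝ) *
      (φ (y (τ 0)) * ∏ i : Fin n,
        B (y (τ ⟨2 * i.1 + 1, by omega⟩)) (y (τ ⟨2 * i.1 + 2, by omega⟩))) := by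
    simp only [Θ, MultilinearMap.alternatization_apply]
    refine Finset.sum_congr rfl fun τ _ => ?_
    rw [Units.smul_def, zsmul_eq_mul]
    rfl
  -- The vector `v` is completed to a basis. Each term of the alternating sum on this basis has `v`
  -- as an argument of `φ` or of some `B`, so it vanishes; an alternating form of top degree that
  -- vanishes on a basis is zero, contrary to `hx`.
  have hli : LinearIndepOn ℝ id ({v} : Set V) := by
    simpa using (LinearIndepOn.singleton (R := ℝ) (v := id) hv)
  let b₀ := Basis.extend hli
  have : Fintype (hli.extend (Set.subset_univ _)) := FiniteDimensional.fintypeBasisIndex b₀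
  let b : Basis (Fin (2 * n + 1)) ℝ V :=
    b₀.reindex (Fintype.equivFinOfCardEq (by rw [← finrank_eq_card_basis b₀, hdim]))
  obtain ⟨j, hj⟩ : ∃ j, b j = v := by
    have hm : v ∈ hli.extend (Set.subset_univ _) := hli.subset_extend _ rfl
    refine ⟨Fintype.equivFinOfCardEq (by rw [← finrank_eq_card_basis b₀, hdim])
      (⟨v, hm⟩ : hli.extend (Set.subset_univ _)), ?_⟩
    simp only [b, Basis.reindex_apply, Equiv.symm_apply_apply]
    exact Basis.extend_apply_self hli _
  have h0 : Θ b = 0 := by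
    rw [hΘ]
    refine Finset.sum_eq_zero fun τ _ => ?_
    obtain ⟨k, rfl⟩ := τ.surjective j
    rcases eq_zero_or_odd_or_even k with rfl | ⟨i, rfl⟩ | ⟨i, rfl⟩
    · rw [hj, hφ, zero_mul, mul_zero]
    · rw [Finset.prod_eq_zero (Finset.mem_univ i) (by rw [hj, hB]), mul_zero, mul_zero]
    · rw [Finset.prod_eq_zero (Finset.mem_univ i) (by rw [hj, hB']), mul_zero, mul_zero]
  apply hx
  rw [← hΘ, Θ.eq_smul_basis_det b, h0, zero_smul]
  rfl

end LinearAlgebra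

/-! ### Tangent spaces of `P`, their splitting, and the generating fields. -/

section Quadruple

variable {n : ℕ}
  {M : Type*} [TopologicalSpace M] [ChartedSpace (EuclideanSpace ℝ (Fin (2 * n))) M]
  [IsManifold (𝓡 (2 * n)) ∞ M]
  {N : Type*} [TopologicalSpace N] [ChartedSpace (EuclideanSpace ℝ (Fin (2 * n + 1))) N]
  [IsManifold (𝓡 (2 * n + 1)) ∞ N]

namespace ContactQuadruple

theorem mfderiv_fst_mkTangent (p : N × ℝ) (v : TangentSpace (𝓡 (2 * n + 1)) p.1) (c : ℝ) :
    mfderiv (modelP n) (𝓡 (2 * n + 1)) Prod.fst p (mkTangent p v c) = v := by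
  rw [mfderiv_fst]; rfl

theorem mvfderiv_snd_mkTangent (p : N × ℝ) (v : TangentSpace (𝓡 (2 * n + 1)) p.1) (c : ℝ) :
    mvfderiv (modelP n) (Prod.snd : N × ℝ → ℝ) p (mkTangent p v c) = c := by
  rw [mvfderiv, mfderiv_snd]; rfl

theorem eq_mkTangent (p : N × ℝ) (w : TangentSpace (modelP n) p) :
    w = mkTangent p (mfderiv (modelP n) (𝓡 (2 * n + 1)) Prod.fst p w)
      (mvfderiv (modelP n) (Prod.snd : N × ℝ → ℝ) p w) := by
  rw [mvfderiv, mfderiv_snd, mfderiv_fst]; rfl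

variable (Q : ContactQuadruple n M N)

/-- The kernel of `π_*` lies in that of `dα = π^*Ω`, which meets the kernel of `α` only in zero.
This is where the contact condition enters. -/
theorem eq_zero_of_mem_ker (y : N) (v : TangentSpace (𝓡 (2 * n + 1)) y)
    (h : mfderiv (𝓡 (2 * n + 1)) (𝓡 (2 * n)) Q.π y v = 0) (hα : Q.α y v = 0) : v = 0 := by
  obtain ⟨x, hx⟩ := Q.contact.2 y
  refine eq_zero_of_contact (Q.α y).toLinearMap ((ContinuousLinearMap.coeLM ℝ).comp
    (extDerivOne (𝓡 (2 * n + 1)) Q.α y).toLinearMap) finrank_euclideanSpace_fin x hx hα ?_ ?_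
  · intro w
    change extDerivOne (𝓡 (2 * n + 1)) Q.α y v w = 0
    rw [Q.dα_eq, h, map_zero]; rfl
  · intro w
    change extDerivOne (𝓡 (2 * n + 1)) Q.α y w v = 0
    rw [Q.dα_eq, h, map_zero]

/-- The differential of the projection `P → M`. -/
abbrev dproj (p : N × ℝ) : TangentSpace (modelP n) p →L[ℝ] TangentSpace (𝓡 (2 * n)) (Q.proj p) :=
  mfderiv (modelP n) (𝓡 (2 * n)) Q.proj p

/-- The 1-form `ds` on `P`. -/
abbrev ds (_Q : ContactQuadruple n M N) : OneForm (modelP n) (N × ℝ) := fun p =>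
  mvfderiv (modelP n) (Prod.snd : N × ℝ → ℝ) p

theorem contMDiff_proj : ContMDiff (modelP n) (𝓡 (2 * n)) ∞ Q.proj :=
  Q.smooth_π.comp contMDiff_fst

theorem dproj_apply (p : N × ℝ) (w : TangentSpace (modelP n) p) :
    Q.dproj p w = mfderiv (𝓡 (2 * n + 1)) (𝓡 (2 * n)) Q.π p.1
      (mfderiv (modelP n) (𝓡 (2 * n + 1)) Prod.fst p w) :=
  mfderiv_comp_apply p (Q.smooth_π.mdifferentiable (by simp) _) mdifferentiableAt_fst w

theorem αP_apply (p : N × ℝ) (w : TangentSpace (modelP n) p) :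
    Q.αP p w = Q.α p.1 (mfderiv (modelP n) (𝓡 (2 * n + 1)) Prod.fst p w) := rfl

theorem tangent_ext {p : N × ℝ} {w w' : TangentSpace (modelP n) p}
    (h : Q.dproj p w = Q.dproj p w') (hα : Q.αP p w = Q.αP p w') (hs : Q.ds p w = Q.ds p w') :
    w = w' := by
  rw [← sub_eq_zero] at *
  rw [← map_sub] at *
  rw [dproj_apply] at h
  have h0 := Q.eq_zero_of_mem_ker _ _ h hα
  rw [eq_mkTangent p (w - w'), h0, hs]
  rfl

end ContactQuadruple
end Quadruple

section Quadruple

variable {n : ℕ}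
  {M : Type*} [TopologicalSpace M] [ChartedSpace (EuclideanSpace ℝ (Fin (2 * n))) M]
  [IsManifold (𝓡 (2 * n)) ∞ M]
  {N : Type*} [TopologicalSpace N] [ChartedSpace (EuclideanSpace ℝ (Fin (2 * n + 1))) N]
  [IsManifold (𝓡 (2 * n + 1)) ∞ N]

namespace ContactQuadruple

variable (Q : ContactQuadruple n M N)

/-! ### The splitting of the tangent spaces of `P` -/

/-- The map `(p_*, p₁^*α, ds)` is injective by `tangent_ext`, and both sides have dimension `2n +
2`. This provides the vectors chosen by `epsilon` in `hlift` and `reeb`. -/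
theorem exists_components (p : N × ℝ) (v : TangentSpace (𝓡 (2 * n)) (Q.proj p)) (a c : ℝ) :
    ∃ w : TangentSpace (modelP n) p, Q.dproj p w = v ∧ Q.αP p w = a ∧ Q.ds p w = c := by
  let L : TangentSpace (modelP n) p →ₗ[ℝ] TangentSpace (𝓡 (2 * n)) (Q.proj p) × ℝ × ℝ :=
    (Q.dproj p).toLinearMap.prod ((Q.αP p).toLinearMap.prod (Q.ds p).toLinearMap)
  have hinj : Function.Injective L := fun w w' h =>
    Q.tangent_ext (congrArg Prod.fst h) (congrArg (fun z => z.2.1) h) (congrArg (fun z => z.2.2) h)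
  have h1 : Module.finrank ℝ (TangentSpace (modelP n) p) = 2 * n + 1 + 1 := by
    change Module.finrank ℝ (EuclideanSpace ℝ (Fin (2 * n + 1)) × ℝ) = _
    simp
  have h2 : Module.finrank ℝ (TangentSpace (𝓡 (2 * n)) (Q.proj p) × ℝ × ℝ) = 2 * n + 1 + 1 := by
    change Module.finrank ℝ (EuclideanSpace ℝ (Fin (2 * n)) × ℝ × ℝ) = _
    simp
  obtain ⟨w, hw⟩ := (LinearMap.injective_iff_surjective_of_finrank_eq_finrank
    (h1.trans h2.symm)).1 hinj (v, a, c)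
  exact ⟨w, congrArg Prod.fst hw, congrArg (fun z => z.2.1) hw, congrArg (fun z => z.2.2) hw⟩

theorem hlift_spec (p : N × ℝ) (v : TangentSpace (𝓡 (2 * n)) (Q.proj p)) :
    Q.dproj p (Q.hlift p v) = v ∧ Q.αP p (Q.hlift p v) = 0 ∧ Q.ds p (Q.hlift p v) = 0 :=
  Classical.epsilon_spec (Q.exists_components p v 0 0)

theorem dproj_hlift (p : N × ℝ) (v : TangentSpace (𝓡 (2 * n)) (Q.proj p)) :
    Q.dproj p (Q.hlift p v) = v := (Q.hlift_spec p v).1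

theorem αP_hlift (p : N × ℝ) (v : TangentSpace (𝓡 (2 * n)) (Q.proj p)) :
    Q.αP p (Q.hlift p v) = 0 := (Q.hlift_spec p v).2.1

theorem ds_hlift (p : N × ℝ) (v : TangentSpace (𝓡 (2 * n)) (Q.proj p)) :
    Q.ds p (Q.hlift p v) = 0 := (Q.hlift_spec p v).2.2

theorem reeb_spec (y : N) : (∀ w, extDerivOne (𝓡 (2 * n + 1)) Q.α y (Q.reeb y) w = 0) ∧
    Q.α y (Q.reeb y) = 1 := by
  refine Classical.epsilon_spec (p := fun z : TangentSpace (𝓡 (2 * n + 1)) y =>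
    (∀ w, extDerivOne (𝓡 (2 * n + 1)) Q.α y z w = 0) ∧ Q.α y z = 1) ?_
  obtain ⟨w, hw, hα, -⟩ := Q.exists_components (y, 0) 0 1 0
  rw [dproj_apply] at hw
  refine ⟨_, fun z => ?_, hα⟩
  rw [Q.dα_eq]
  refine (congrArg (fun u => Q.Ω (Q.π y) u
    (mfderiv (𝓡 (2 * n + 1)) (𝓡 (2 * n)) Q.π y z)) hw).trans ?_
  change Q.Ω (Q.π y) 0 _ = 0
  rw [map_zero]
  rfl

/-- The Reeb vector annihilates `dα = π^*Ω`; as `π_*` is onto and `Ω` nondegenerate, its projection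
to `M` vanishes. -/
theorem dproj_E (p : N × ℝ) : Q.dproj p (Q.E p) = 0 := by
  rw [dproj_apply, E, mfderiv_fst_mkTangent]
  refine Q.symplectic.nondegenerate _ _ fun w => ?_
  obtain ⟨z, rfl⟩ := Q.submersion_π p.1 w
  have := (Q.reeb_spec p.1).1 z
  rwa [Q.dα_eq] at this

theorem αP_E (p : N × ℝ) : Q.αP p (Q.E p) = 1 := by
  rw [αP_apply, E, mfderiv_fst_mkTangent]
  exact (Q.reeb_spec p.1).2

theorem ds_E (p : N × ℝ) : Q.ds p (Q.E p) = 0 := mvfderiv_snd_mkTangent _ _ _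

theorem dproj_S (p : N × ℝ) : Q.dproj p (Q.S p) = 0 := by
  rw [dproj_apply, S, mfderiv_fst_mkTangent, map_zero]
  rfl

theorem αP_S (p : N × ℝ) : Q.αP p (Q.S p) = 0 := by
  rw [αP_apply, S, mfderiv_fst_mkTangent, map_zero]

theorem ds_S (p : N × ℝ) : Q.ds p (Q.S p) = 1 := mvfderiv_snd_mkTangent _ _ _

/-- The tangent vector to `P` with given components. -/
def vec (p : N × ℝ) (v : TangentSpace (𝓡 (2 * n)) (Q.proj p)) (a c : ℝ) :
    TangentSpace (modelP n) p := Q.hlift p v + a • Q.E p + c • Q.S p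

theorem dproj_vec (p : N × ℝ) (v : TangentSpace (𝓡 (2 * n)) (Q.proj p)) (a c : ℝ) :
    Q.dproj p (Q.vec p v a c) = v := by
  simp only [vec, map_add, map_smul]
  rw [dproj_hlift, dproj_E, dproj_S]; simp

theorem αP_vec (p : N × ℝ) (v : TangentSpace (𝓡 (2 * n)) (Q.proj p)) (a c : ℝ) :
    Q.αP p (Q.vec p v a c) = a := by
  simp only [vec, map_add, map_smul]
  rw [αP_hlift, αP_E, αP_S]; simp

theorem ds_vec (p : N × ℝ) (v : TangentSpace (𝓡 (2 * n)) (Q.proj p)) (a c : ℝ) :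
    Q.ds p (Q.vec p v a c) = c := by
  simp only [vec, map_add, map_smul]
  rw [ds_hlift, ds_E, ds_S]; simp

theorem vec_components (p : N × ℝ) (w : TangentSpace (modelP n) p) :
    Q.vec p (Q.dproj p w) (Q.αP p w) (Q.ds p w) = w :=
  Q.tangent_ext (Q.dproj_vec ..) (Q.αP_vec ..) (Q.ds_vec ..)

theorem eq_vec_iff {p : N × ℝ} {w : TangentSpace (modelP n) p}
    {v : TangentSpace (𝓡 (2 * n)) (Q.proj p)} {a c : ℝ} :
    w = Q.vec p v a c ↔ Q.dproj p w = v ∧ Q.αP p w = a ∧ Q.ds p w = c := by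
  constructor
  · rintro rfl; exact ⟨Q.dproj_vec .., Q.αP_vec .., Q.ds_vec ..⟩
  · rintro ⟨rfl, rfl, rfl⟩; exact (Q.vec_components p w).symm

theorem hlift_eq_vec (p : N × ℝ) (v : TangentSpace (𝓡 (2 * n)) (Q.proj p)) :
    Q.hlift p v = Q.vec p v 0 0 := by simp [vec]

theorem hlift_zero (p : N × ℝ) : Q.hlift p 0 = 0 :=
  Q.tangent_ext (by rw [dproj_hlift, map_zero]) (by rw [αP_hlift, map_zero])
    (by rw [ds_hlift, map_zero])

theorem E_eq_vec (p : N × ℝ) : Q.E p = Q.vec p 0 1 0 := by simp [vec, hlift_zero]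

theorem S_eq_vec (p : N × ℝ) : Q.S p = Q.vec p 0 0 1 := by simp [vec, hlift_zero]

theorem vec_add (p : N × ℝ) (v v' : TangentSpace (𝓡 (2 * n)) (Q.proj p)) (a a' c c' : ℝ) :
    Q.vec p v a c + Q.vec p v' a' c' = Q.vec p (v + v') (a + a') (c + c') :=
  Q.tangent_ext (by simp only [map_add, dproj_vec]) (by simp only [map_add, αP_vec])
    (by simp only [map_add, ds_vec])

theorem vec_sub (p : N × ℝ) (v v' : TangentSpace (𝓡 (2 * n)) (Q.proj p)) (a a' c c' : ℝ) :
    Q.vec p v a c - Q.vec p v' a' c' = Q.vec p (v - v') (a - a') (c - c') :=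
  Q.tangent_ext (by simp only [map_sub, dproj_vec]) (by simp only [map_sub, αP_vec])
    (by simp only [map_sub, ds_vec])

theorem vec_smul (p : N × ℝ) (t : ℝ) (v : TangentSpace (𝓡 (2 * n)) (Q.proj p)) (a c : ℝ) :
    t • Q.vec p v a c = Q.vec p (t • v) (t * a) (t * c) :=
  Q.tangent_ext (by simp only [map_smul, dproj_vec])
    (by simp only [map_smul, αP_vec, smul_eq_mul])
    (by simp only [map_smul, ds_vec, smul_eq_mul])

theorem vec_zero (p : N × ℝ) : Q.vec p 0 0 0 = 0 := by simp [vec, hlift_zero]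

/-! ### Smoothness of fields on `P` -/

theorem mvfderiv_comp_proj {F : Type*} [NormedAddCommGroup F] [NormedSpace ℝ F] {g : M → F}
    {p : N × ℝ} (hg : MDifferentiableAt (𝓡 (2 * n)) 𝓘(ℝ, F) g (Q.proj p))
    (w : TangentSpace (modelP n) p) :
    mvfderiv (modelP n) (fun q => g (Q.proj q)) p w =
      mvfderiv (𝓡 (2 * n)) g (Q.proj p) (Q.dproj p w) :=
  mfderiv_comp_apply p hg (Q.contMDiff_proj.mdifferentiable (by simp) p) w

theorem isSmoothOneForm_αP [T2Space N] : IsSmoothOneForm (modelP n) Q.αP := by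
  refine isSmoothOneForm_of_forall fun X hX => ?_
  have h1 : ContMDiff (modelP n).tangent (𝓡 (2 * n + 1)).tangent ∞
      (tangentMap (modelP n) (𝓡 (2 * n + 1)) (Prod.fst : N × ℝ → N)) :=
    (contMDiff_fst : ContMDiff (modelP n) (𝓡 (2 * n + 1)) ∞
      (Prod.fst : N × ℝ → N)).contMDiff_tangentMap (by simp)
  have h2 := ContMDiff.clm_bundle_apply (F₁ := EuclideanSpace ℝ (Fin (2 * n + 1))) (F₂ := ℝ)
    (E₁ := (TangentSpace (𝓡 (2 * n + 1)) : N → Type _)) (E₂ := Bundle.Trivial N ℝ)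
    (b := (Prod.fst : N × ℝ → N)) (Q.contact.1.comp contMDiff_fst) (h1.comp hX)
  exact fun x => (contMDiffAt_totalSpace.1 (h2 x)).2

theorem isSmoothOneForm_ds [T2Space N] : IsSmoothOneForm (modelP n) Q.ds :=
  isSmoothOneForm_of_forall fun _ hX => contMDiff_mvfderiv_apply contMDiff_snd hX

variable [T2Space M] [T2Space N]

/-- The component `p_*W` is not a field on `M`, so its smoothness is expressed through functions `g`
on `M`. With `g` separating vectors at the base point, `(d(g ∘ p), p₁^*α, ds)` is an injective
smooth form. -/
theorem isSmoothVF_of_components {W : VectorField (modelP n) (N × ℝ)}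
    (h1 : ∀ g : M → EuclideanSpace ℝ (Fin (2 * n)), ContMDiff (𝓡 (2 * n)) 𝓘(ℝ, EuclideanSpace ℝ (Fin (2 * n))) ∞ g →
      ContMDiff (modelP n) 𝓘(ℝ, EuclideanSpace ℝ (Fin (2 * n))) ∞ fun p => mvfderiv (𝓡 (2 * n)) g (Q.proj p) (Q.dproj p (W p)))
    (h2 : ContMDiff (modelP n) 𝓘(ℝ, ℝ) ∞ fun p => Q.αP p (W p))
    (h3 : ContMDiff (modelP n) 𝓘(ℝ, ℝ) ∞ fun p => Q.ds p (W p)) : IsSmoothVF (modelP n) W := by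
  intro p
  obtain ⟨g, hg, hinj⟩ := exists_separating_function (I := 𝓡 (2 * n)) (Q.proj p)
  refine contMDiffAt_of_form_injective (Λ := fun q =>
    ((mvfderiv (𝓡 (2 * n)) g (Q.proj q)).comp (Q.dproj q)).prod ((Q.αP q).prod (Q.ds q))) ?_ ?_ ?_
  · intro X hX
    refine ContMDiff.prodMk_space ?_ ((Q.isSmoothOneForm_αP.apply hX).prodMk_space
      (Q.isSmoothOneForm_ds.apply hX))
    have := contMDiff_mvfderiv_apply (hg.comp Q.contMDiff_proj) hX
    refine this.congr fun q => ?_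
    exact (Q.mvfderiv_comp_proj (hg.mdifferentiable (by simp) _) (X q)).symm
  · intro w w' h
    exact Q.tangent_ext (hinj (congrArg Prod.fst h)) (congrArg (fun z => z.2.1) h)
      (congrArg (fun z => z.2.2) h)
  · exact ((h1 g hg).prodMk_space (h2.prodMk_space h3)) p

/-- The field on `P` with components given by a field and two functions on `M`. -/
def comb (X : VectorField (𝓡 (2 * n)) M) (f g : M → ℝ) : VectorField (modelP n) (N × ℝ) :=
  fun p => Q.vec p (X (Q.proj p)) (f (Q.proj p)) (g (Q.proj p))

theorem isSmoothVF_comb {X : VectorField (𝓡 (2 * n)) M} {f g : M → ℝ}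
    (hX : IsSmoothVF (𝓡 (2 * n)) X) (hf : ContMDiff (𝓡 (2 * n)) 𝓘(ℝ, ℝ) ∞ f)
    (hg : ContMDiff (𝓡 (2 * n)) 𝓘(ℝ, ℝ) ∞ g) : IsSmoothVF (modelP n) (Q.comb X f g) := by
  refine Q.isSmoothVF_of_components (fun h hh => ?_) ?_ ?_
  · simp only [comb, dproj_vec]
    exact (contMDiff_mvfderiv_apply hh hX).comp Q.contMDiff_proj
  · simp only [comb, αP_vec]
    exact hf.comp Q.contMDiff_proj
  · simp only [comb, ds_vec]
    exact hg.comp Q.contMDiff_proj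

theorem lift_eq_comb (X : VectorField (𝓡 (2 * n)) M) : Q.lift X = Q.comb X 0 0 :=
  funext fun p => Q.hlift_eq_vec p _

theorem E_eq_comb : Q.E = Q.comb 0 1 0 := funext fun p => Q.E_eq_vec p

theorem S_eq_comb : Q.S = Q.comb 0 0 1 := funext fun p => Q.S_eq_vec p

theorem isSmoothVF_lift {X : VectorField (𝓡 (2 * n)) M} (hX : IsSmoothVF (𝓡 (2 * n)) X) :
    IsSmoothVF (modelP n) (Q.lift X) :=
  Q.lift_eq_comb X ▸ Q.isSmoothVF_comb hX contMDiff_const contMDiff_const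

theorem isSmoothVF_E : IsSmoothVF (modelP n) Q.E :=
  Q.E_eq_comb ▸ Q.isSmoothVF_comb isSmoothVF_zero contMDiff_const contMDiff_const

theorem isSmoothVF_S : IsSmoothVF (modelP n) Q.S :=
  Q.S_eq_comb ▸ Q.isSmoothVF_comb isSmoothVF_zero contMDiff_const contMDiff_const

/-- Every tangent vector is the value of a field `comb X a c` with constant `a`, `c`. -/
theorem exists_comb_apply_eq (p : N × ℝ) (w : TangentSpace (modelP n) p) :
    ∃ X, IsSmoothVF (𝓡 (2 * n)) X ∧
      w = Q.comb X (fun _ => Q.αP p w) (fun _ => Q.ds p w) p := by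
  obtain ⟨X, hX, hXp⟩ := exists_isSmoothVF_apply_eq (I := 𝓡 (2 * n)) (Q.proj p) (Q.dproj p w)
  refine ⟨X, hX, ?_⟩
  rw [comb, hXp, vec_components]

/-! ### The exterior derivative of `αP` and brackets -/

/-- Exterior derivatives commute with pullback: each vector is extended to a field on `P` projecting
to a field on `N`, and the brackets of such fields project too. -/
theorem extDerivOne_αP (p : N × ℝ) (v w : TangentSpace (modelP n) p) :
    extDerivOne (modelP n) Q.αP p v w = Q.Ω (Q.proj p) (Q.dproj p v) (Q.dproj p w) := by
  have key (u : TangentSpace (modelP n) p) : ∃ (V : VectorField (𝓡 (2 * n + 1)) N)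
      (W : VectorField (modelP n) (N × ℝ)), IsSmoothVF (𝓡 (2 * n + 1)) V ∧
      IsSmoothVF (modelP n) W ∧ W p = u ∧
      ∀ q, mfderiv (modelP n) (𝓡 (2 * n + 1)) Prod.fst q (W q) = V q.1 := by
    obtain ⟨V, hV, hVp⟩ := exists_isSmoothVF_apply_eq (I := 𝓡 (2 * n + 1)) p.1
      (mfderiv (modelP n) (𝓡 (2 * n + 1)) Prod.fst p u)
    refine ⟨V, fun q => mkTangent q (V q.1) (Q.ds p u), hV, ?_, ?_, fun q =>
      mfderiv_fst_mkTangent _ _ _⟩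
    · intro q
      obtain ⟨g, hg, hinj⟩ := exists_separating_function (I := 𝓡 (2 * n + 1)) q.1
      refine contMDiffAt_of_form_injective (Λ := fun q => (mvfderiv (modelP n)
        (fun q : N × ℝ => g q.1) q).prod (Q.ds q)) ?_ ?_ ?_
      · intro X hX
        exact (contMDiff_mvfderiv_apply (hg.comp contMDiff_fst) hX).prodMk_space
          (Q.isSmoothOneForm_ds.apply hX)
      · intro w w' h
        have h1 : mfderiv (modelP n) (𝓡 (2 * n + 1)) Prod.fst q w =
            mfderiv (modelP n) (𝓡 (2 * n + 1)) Prod.fst q w' := by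
          apply hinj
          have h2 := congrArg Prod.fst h
          exact (mfderiv_comp_apply q (hg.mdifferentiable (by simp) _) mdifferentiableAt_fst
            w).symm.trans (h2.trans
            (mfderiv_comp_apply q (hg.mdifferentiable (by simp) _) mdifferentiableAt_fst w'))
        rw [eq_mkTangent q w, eq_mkTangent q w', h1]
        exact congrArg _ (congrArg Prod.snd h)
      · refine ContMDiff.prodMk_space ?_ ?_ q
        · have := (contMDiff_mvfderiv_apply hg hV).comp
            (contMDiff_fst : ContMDiff (modelP n) (𝓡 (2 * n + 1)) ∞ (Prod.fst : N × ℝ → N))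
          refine this.congr fun q => ?_
          refine (mfderiv_comp_apply q (hg.mdifferentiable (by simp) _) mdifferentiableAt_fst
            _).trans ?_
          rw [mfderiv_fst_mkTangent]; rfl
        · exact (contMDiff_const (c := Q.ds p u)).congr fun q => mvfderiv_snd_mkTangent _ _ _
    · change mkTangent p (V p.1) _ = u
      rw [hVp]; exact (eq_mkTangent p u).symm
  obtain ⟨V, V', hV, hV', rfl, hr⟩ := key v
  obtain ⟨W, W', hW, hW', rfl, hr'⟩ := key w
  rw [extDerivOne_apply Q.isSmoothOneForm_αP (hV'.diffAt p) (hW'.diffAt p)]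
  simp only [αP_apply, hr, hr']
  rw [mfderiv_mlieBracket_of_related contMDiff_fst (hV'.diffAt p) (hW'.diffAt p)
    (hV.diffAt _) (hW.diffAt _) hr hr']
  have e (A : VectorField (𝓡 (2 * n + 1)) N) (hA : IsSmoothVF (𝓡 (2 * n + 1)) A)
      (u : TangentSpace (modelP n) p) : mvfderiv (modelP n) (fun q : N × ℝ => Q.α q.1 (A q.1)) p u
      = mvfderiv (𝓡 (2 * n + 1)) (fun y => Q.α y (A y)) p.1
        (mfderiv (modelP n) (𝓡 (2 * n + 1)) Prod.fst p u) :=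
    mfderiv_comp_apply p ((Q.contact.1.apply hA).mdifferentiable (by simp) _)
      mdifferentiableAt_fst u
  rw [e W hW, e V hV, hr, hr', ← extDerivOne_apply Q.contact.1 (hV.diffAt _) (hW.diffAt _),
    Q.dα_eq, dproj_apply, dproj_apply, hr, hr']
  rfl

end ContactQuadruple
end Quadruple

/-! ### Brackets of combs and the explicit form of `μ`. -/

section Quadruple

variable {n : ℕ}
  {M : Type*} [TopologicalSpace M] [ChartedSpace (EuclideanSpace ℝ (Fin (2 * n))) M]
  [IsManifold (𝓡 (2 * n)) ∞ M]
  {N : Type*} [TopologicalSpace N] [ChartedSpace (EuclideanSpace ℝ (Fin (2 * n + 1))) N]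
  [IsManifold (𝓡 (2 * n + 1)) ∞ N] [T2Space M] [T2Space N]

namespace ContactQuadruple

variable (Q : ContactQuadruple n M N)

section Comb

variable {X Y : VectorField (𝓡 (2 * n)) M} {a b f g : M → ℝ}

theorem dproj_comb (p : N × ℝ) : Q.dproj p (Q.comb X a b p) = X (Q.proj p) := Q.dproj_vec ..

theorem αP_comb (p : N × ℝ) : Q.αP p (Q.comb X a b p) = a (Q.proj p) := Q.αP_vec ..

theorem ds_comb (p : N × ℝ) : Q.ds p (Q.comb X a b p) = b (Q.proj p) := Q.ds_vec ..

/-- One reason for each component: combs project to `M`; `d(p₁^*α) = p^*Ω` gives the `E`-component,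
with `-Ω(X, Y)` measuring the non-integrability of the horizontal distribution; and the commutator
formula applied to the function `s` gives the last one. -/
theorem mlieBracket_comb (hX : IsSmoothVF (𝓡 (2 * n)) X) (hY : IsSmoothVF (𝓡 (2 * n)) Y)
    (ha : ContMDiff (𝓡 (2 * n)) 𝓘(ℝ, ℝ) ∞ a) (hb : ContMDiff (𝓡 (2 * n)) 𝓘(ℝ, ℝ) ∞ b)
    (hf : ContMDiff (𝓡 (2 * n)) 𝓘(ℝ, ℝ) ∞ f) (hg : ContMDiff (𝓡 (2 * n)) 𝓘(ℝ, ℝ) ∞ g) :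
    mlieBracket (modelP n) (Q.comb X a b) (Q.comb Y f g) =
      Q.comb (mlieBracket (𝓡 (2 * n)) X Y)
        (fun x => mvfderiv (𝓡 (2 * n)) f x (X x) - mvfderiv (𝓡 (2 * n)) a x (Y x)
          - Q.Ω x (X x) (Y x))
        (fun x => mvfderiv (𝓡 (2 * n)) g x (X x) - mvfderiv (𝓡 (2 * n)) b x (Y x)) := by
  funext p
  have h1 := Q.isSmoothVF_comb hX ha hb
  have h2 := Q.isSmoothVF_comb hY hf hg
  have e (h : M → ℝ) (hh : ContMDiff (𝓡 (2 * n)) 𝓘(ℝ, ℝ) ∞ h) (w : TangentSpace (modelP n) p) :=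
    Q.mvfderiv_comp_proj (p := p) (hh.mdifferentiable (by simp) _) w
  refine Q.eq_vec_iff.2 ⟨?_, ?_, ?_⟩
  · exact mfderiv_mlieBracket_of_related Q.contMDiff_proj (h1.diffAt p) (h2.diffAt p)
      (hX.diffAt _) (hY.diffAt _) (fun q => Q.dproj_comb q) (fun q => Q.dproj_comb q)
  · have h := extDerivOne_apply Q.isSmoothOneForm_αP (h1.diffAt p) (h2.diffAt p)
    simp only [extDerivOne_αP, dproj_comb, αP_comb] at h
    rw [e f hf, e a ha, dproj_comb, dproj_comb] at h
    linarith
  · have h := mvfderiv_mlieBracket (contMDiff_snd : ContMDiff (modelP n) 𝓘(ℝ, ℝ) ∞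
      (Prod.snd : N × ℝ → ℝ)) (h1.diffAt p) (h2.diffAt p)
    have e1 : (fun q : N × ℝ => mvfderiv (modelP n) (Prod.snd : N × ℝ → ℝ) q (Q.comb Y f g q)) =
      fun q => g (Q.proj q) := funext fun q => Q.ds_comb q
    have e2 : (fun q : N × ℝ => mvfderiv (modelP n) (Prod.snd : N × ℝ → ℝ) q (Q.comb X a b q)) =
      fun q => b (Q.proj q) := funext fun q => Q.ds_comb q
    rw [e1, e2, e g hg, e b hb, dproj_comb, dproj_comb] at h
    exact h

end Comb

/-! ### The symplectic form of `P` -/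

theorem contMDiff_exp : ContMDiff (modelP n) 𝓘(ℝ, ℝ) ∞ fun p : N × ℝ => Real.exp (2 * p.2) :=
  (Real.contDiff_exp.contMDiff).comp ((contDiff_const.mul contDiff_id).contMDiff.comp contMDiff_snd)

theorem mvfderiv_exp (p : N × ℝ) (w : TangentSpace (modelP n) p) :
    mvfderiv (modelP n) (fun p : N × ℝ => Real.exp (2 * p.2)) p w =
      2 * Real.exp (2 * p.2) * Q.ds p w := by
  have h1 : HasDerivAt (fun t : ℝ => Real.exp (2 * t)) (Real.exp (2 * p.2) * (2 * 1)) p.2 :=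
    ((hasDerivAt_id p.2).const_mul 2).exp
  have h2 : mfderiv (modelP n) 𝓘(ℝ, ℝ) (fun p : N × ℝ => Real.exp (2 * p.2)) p w =
      mfderiv 𝓘(ℝ, ℝ) 𝓘(ℝ, ℝ) (fun t : ℝ => Real.exp (2 * t)) p.2
        (mfderiv (modelP n) 𝓘(ℝ, ℝ) (Prod.snd : N × ℝ → ℝ) p w) :=
    mfderiv_comp_apply (g := fun t : ℝ => Real.exp (2 * t)) (f := (Prod.snd : N × ℝ → ℝ)) p
      h1.differentiableAt.mdifferentiableAt mdifferentiableAt_snd w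
  have h3 : fderiv ℝ (fun t : ℝ => Real.exp (2 * t)) p.2 (Q.ds p w) =
      2 * Real.exp (2 * p.2) * Q.ds p w := by
    rw [h1.hasFDerivAt.fderiv]
    simp
    ring
  rw [mfderiv_eq_fderiv] at h2
  exact h2.trans h3

theorem isSmoothOneForm_exp_smul_αP :
    IsSmoothOneForm (modelP n) (fun p => Real.exp (2 * p.2) • Q.αP p) :=
  isSmoothOneForm_of_forall fun X hX => by
    have := contMDiff_exp.mul (Q.isSmoothOneForm_αP.apply hX)
    exact this

/-- The product rule `d(e^{2s} p₁^*α) = e^{2s}(2 ds ∧ p₁^*α + p^*Ω)`. -/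
theorem μ_apply (p : N × ℝ) (v w : TangentSpace (modelP n) p) :
    Q.μ p v w = Real.exp (2 * p.2) * (2 * (Q.ds p v * Q.αP p w - Q.ds p w * Q.αP p v)
      + Q.Ω (Q.proj p) (Q.dproj p v) (Q.dproj p w)) := by
  obtain ⟨V, hV, rfl⟩ := exists_isSmoothVF_apply_eq p v
  obtain ⟨W, hW, rfl⟩ := exists_isSmoothVF_apply_eq p w
  have e (A : VectorField (modelP n) (N × ℝ)) (hA : IsSmoothVF (modelP n) A)
      (u : TangentSpace (modelP n) p) :
      mvfderiv (modelP n) (fun q => (Real.exp (2 * q.2) • Q.αP q) (A q)) p u =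
        Real.exp (2 * p.2) * mvfderiv (modelP n) (fun q => Q.αP q (A q)) p u
          + Q.αP p (A p) * (2 * Real.exp (2 * p.2) * Q.ds p u) := by
    have h1 := mvfderiv_mul (f := fun q : N × ℝ => Real.exp (2 * q.2))
      (contMDiff_exp.mdifferentiable (by simp) p)
      ((Q.isSmoothOneForm_αP.apply hA).mdifferentiable (by simp) p)
    have h2 : mvfderiv (modelP n) (fun q => (Real.exp (2 * q.2) • Q.αP q) (A q)) p u = _ :=
      congrArg (fun L => L u) h1
    rw [h2]
    simp only [add_apply, smul_apply, smul_eq_mul, Q.mvfderiv_exp]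
  rw [μ, extDerivOne_apply Q.isSmoothOneForm_exp_smul_αP (hV.diffAt p) (hW.diffAt p),
    e V hV, e W hW, ← extDerivOne_αP,
    extDerivOne_apply Q.isSmoothOneForm_αP (hV.diffAt p) (hW.diffAt p)]
  simp only [smul_apply, smul_eq_mul]
  ring

end ContactQuadruple
end Quadruple

/-! ### Exact 2-forms, and tensoriality of Lie derivatives and of `∇Ω`. -/

section General

variable {E : Type*} [NormedAddCommGroup E] [NormedSpace ℝ E]
  {H : Type*} [TopologicalSpace H] {I : ModelWithCorners ℝ E H}
  {M : Type*} [TopologicalSpace M] [ChartedSpace H M] [IsManifold I ∞ M]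
  [FiniteDimensional ℝ E] [T2Space M] [I.Boundaryless]

/-! ### Exact 2-forms -/

theorem mvfderiv_smul_apply_left {Ω : TwoTensor I M} (hΩ : IsSmoothTwoTensor I Ω)
    {f : M → ℝ} {X Y : VectorField I M} {x : M} (hf : MDifferentiableAt I 𝓘(ℝ, ℝ) f x)
    (hX : DiffVFAt I X x) (hY : DiffVFAt I Y x) (v : TangentSpace I x) :
    mvfderiv I (fun y => Ω y ((f • X) y) (Y y)) x v =
      f x * mvfderiv I (fun y => Ω y (X y) (Y y)) x v + mvfderiv I f x v * Ω x (X x) (Y x) := by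
  have e : (fun y => Ω y ((f • X) y) (Y y)) = f * fun y => Ω y (X y) (Y y) := by
    funext y; simp [Pi.smul_apply']
  rw [e, mvfderiv_mul hf (hΩ.mdifferentiableAt_apply hX hY)]
  simp only [add_apply, smul_apply, smul_eq_mul]
  ring

theorem mvfderiv_add_apply_left {Ω : TwoTensor I M} (hΩ : IsSmoothTwoTensor I Ω)
    {X X' Y : VectorField I M} {x : M}
    (hX : DiffVFAt I X x) (hX' : DiffVFAt I X' x) (hY : DiffVFAt I Y x) (v : TangentSpace I x) :
    mvfderiv I (fun y => Ω y ((X + X') y) (Y y)) x v =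
      mvfderiv I (fun y => Ω y (X y) (Y y)) x v + mvfderiv I (fun y => Ω y (X' y) (Y y)) x v := by
  have e : (fun y => Ω y ((X + X') y) (Y y)) =
      (fun y => Ω y (X y) (Y y)) + fun y => Ω y (X' y) (Y y) := by
    funext y; simp
  rw [e, mvfderiv_add (hΩ.mdifferentiableAt_apply hX hY) (hΩ.mdifferentiableAt_apply hX' hY)]
  rfl

theorem swap_of_alternating {Ω : TwoTensor I M} (h : ∀ x v, Ω x v v = 0) {x : M}
    (v w : TangentSpace I x) : Ω x v w = -Ω x w v := by
  have h1 := h x (v + w)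
  simp only [map_add, add_apply, h] at h1
  linarith

theorem mvfderiv_swap_of_alternating {Ω : TwoTensor I M} (h : ∀ x v, Ω x v v = 0)
    (X Y : VectorField I M) (x : M) (v : TangentSpace I x) :
    mvfderiv I (fun y => Ω y (X y) (Y y)) x v = -mvfderiv I (fun y => Ω y (Y y) (X y)) x v := by
  have e : (fun y => Ω y (X y) (Y y)) = -fun y => Ω y (Y y) (X y) :=
    funext fun y => swap_of_alternating h _ _
  rw [e, mvfderiv_neg]
  rfl

/-- The value `dΩ(X, Y, Z)` of the exterior derivative of a 2-form. -/
def extDerivTwo (Ω : TwoTensor I M) (x : M) (X Y Z : VectorField I M) : ℝ :=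
  mvfderiv I (fun y => Ω y (Y y) (Z y)) x (X x)
      + mvfderiv I (fun y => Ω y (Z y) (X y)) x (Y x)
      + mvfderiv I (fun y => Ω y (X y) (Y y)) x (Z x)
      - Ω x (mlieBracket I X Y x) (Z x)
      - Ω x (mlieBracket I Y Z x) (X x)
      - Ω x (mlieBracket I Z X x) (Y x)

theorem extDerivTwo_rotate (Ω : TwoTensor I M) (x : M) (X Y Z : VectorField I M) :
    extDerivTwo Ω x X Y Z = extDerivTwo Ω x Y Z X := by
  simp only [extDerivTwo]; ring

theorem tensorialAt_extDerivTwo {Ω : TwoTensor I M} (hΩ : IsSmoothTwoTensor I Ω)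
    (halt : ∀ x v, Ω x v v = 0) {x : M} {Y Z : VectorField I M} (hY : DiffVFAt I Y x)
    (hZ : DiffVFAt I Z x) : TensorialAt I E (fun X : VectorField I M => extDerivTwo Ω x X Y Z) x := by
  have := FiniteDimensional.complete ℝ E
  refine ⟨fun {f} {X} hf hX => ?_, fun {X} {X'} hX hX' => ?_⟩
  · simp only [extDerivTwo]
    rw [mvfderiv_swap_of_alternating halt Z (f • X), mvfderiv_swap_of_alternating halt Z X,
      mvfderiv_smul_apply_left hΩ hf hX hZ, mvfderiv_smul_apply_left hΩ hf hX hY,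
      mlieBracket_smul_left hf hX, mlieBracket_smul_right hf hX]
    simp only [Pi.smul_apply', map_add, map_smul, map_neg, neg_smul, add_apply, smul_apply,
      neg_apply, smul_eq_mul]
    rw [swap_of_alternating halt (X x) (Z x)]
    ring
  · simp only [extDerivTwo]
    rw [mvfderiv_swap_of_alternating halt Z (X + X'), mvfderiv_swap_of_alternating halt Z X,
      mvfderiv_swap_of_alternating halt Z X',
      mvfderiv_add_apply_left hΩ hX hX' hZ, mvfderiv_add_apply_left hΩ hX hX' hY,
      mlieBracket_add_left hX hX', mlieBracket_add_right hX hX']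
    simp only [Pi.add_apply, map_add, add_apply]
    ring

/-- A 2-form is closed if it is closed on smooth fields. -/
theorem extDerivTwo_eq_zero {Ω : TwoTensor I M} (hΩ : IsSmoothTwoTensor I Ω)
    (halt : ∀ x v, Ω x v v = 0) {x : M}
    (h : ∀ X Y Z : VectorField I M, IsSmoothVF I X → IsSmoothVF I Y → IsSmoothVF I Z →
      extDerivTwo Ω x X Y Z = 0) {X Y Z : VectorField I M} (hX : DiffVFAt I X x)
    (hY : DiffVFAt I Y x) (hZ : DiffVFAt I Z x) : extDerivTwo Ω x X Y Z = 0 := by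
  obtain ⟨X', hX', hXx⟩ := exists_isSmoothVF_apply_eq x (X x)
  obtain ⟨Y', hY', hYx⟩ := exists_isSmoothVF_apply_eq x (Y x)
  obtain ⟨Z', hZ', hZx⟩ := exists_isSmoothVF_apply_eq x (Z x)
  have e1 := (tensorialAt_extDerivTwo hΩ halt hY hZ).pointwise hX (hX'.diffAt x) hXx.symm
  have e2 := (tensorialAt_extDerivTwo hΩ halt hZ (hX'.diffAt x)).pointwise hY (hY'.diffAt x)
    hYx.symm
  have e3 := (tensorialAt_extDerivTwo hΩ halt (hX'.diffAt x) (hY'.diffAt x)).pointwise hZ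
    (hZ'.diffAt x) hZx.symm
  rw [e1, extDerivTwo_rotate, e2, extDerivTwo_rotate, e3]
  exact h _ _ _ hZ' hX' hY'

theorem isSmoothTwoTensor_extDerivOne {α : OneForm I M} (hα : IsSmoothOneForm I α) :
    IsSmoothTwoTensor I (extDerivOne I α) := by
  have := FiniteDimensional.complete ℝ E
  refine isSmoothTwoTensor_of_forall fun X Y hX hY => ?_
  simp only [fun x => extDerivOne_apply hα (hX.diffAt x) (hY.diffAt x)]
  exact ((contMDiff_mvfderiv_apply (hα.apply hY) hX).sub
    (contMDiff_mvfderiv_apply (hα.apply hX) hY)).sub (hα.apply (hX.mlieBracket hY))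

/-- Second derivatives of the functions `α(X)` cancel by the commutator formula, the terms `α([[X,
Y], Z])` by the Jacobi identity. -/
theorem extDerivTwo_extDerivOne {α : OneForm I M} (hα : IsSmoothOneForm I α) {x : M}
    {X Y Z : VectorField I M} (hX : IsSmoothVF I X) (hY : IsSmoothVF I Y) (hZ : IsSmoothVF I Z) :
    extDerivTwo (extDerivOne I α) x X Y Z = 0 := by
  have := FiniteDimensional.complete ℝ E
  have e (A B C : VectorField I M) (hA : IsSmoothVF I A) (hB : IsSmoothVF I B)
      (hC : IsSmoothVF I C) : mvfderiv I (fun y => extDerivOne I α y (B y) (C y)) x (A x) =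
      mvfderiv I (fun y => mvfderiv I (fun z => α z (C z)) y (B y)) x (A x)
      - mvfderiv I (fun y => mvfderiv I (fun z => α z (B z)) y (C y)) x (A x)
      - mvfderiv I (fun y => α y (mlieBracket I B C y)) x (A x) := by
    simp only [fun y => extDerivOne_apply hα (hB.diffAt y) (hC.diffAt y)]
    have h1 := (contMDiff_mvfderiv_apply (hα.apply hC) hB).mdifferentiable (by simp) x
    have h2 := (contMDiff_mvfderiv_apply (hα.apply hB) hC).mdifferentiable (by simp) x
    have h3 := (hα.apply (hB.mlieBracket hC)).mdifferentiable (by simp) x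
    refine (congrArg (fun L => L (A x)) (mvfderiv_sub (h1.sub h2) h3)).trans ?_
    rw [sub_apply, mvfderiv_sub h1 h2]
    rfl
  simp only [extDerivTwo]
  rw [e X Y Z hX hY hZ, e Y Z X hY hZ hX, e Z X Y hZ hX hY,
    extDerivOne_apply hα ((hX.mlieBracket hY).diffAt x) (hZ.diffAt x),
    extDerivOne_apply hα ((hY.mlieBracket hZ).diffAt x) (hX.diffAt x),
    extDerivOne_apply hα ((hZ.mlieBracket hX).diffAt x) (hY.diffAt x),
    mvfderiv_mlieBracket (hα.apply hZ) (hX.diffAt x) (hY.diffAt x),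
    mvfderiv_mlieBracket (hα.apply hX) (hY.diffAt x) (hZ.diffAt x),
    mvfderiv_mlieBracket (hα.apply hY) (hZ.diffAt x) (hX.diffAt x)]
  have hJ := congrArg (α x) (mlieBracket_jacobi hX hY hZ x)
  rw [mlieBracket_swap_apply (V := X) (W := mlieBracket I Y Z),
    mlieBracket_swap_apply (V := Y) (W := mlieBracket I X Z),
    mlieBracket_swap (V := X) (W := Z)] at hJ
  have h2 : mlieBracket I (-mlieBracket I Z X) Y x = -mlieBracket I (mlieBracket I Z X) Y x := by
    have := mlieBracket_const_smul_left (I := I) (c := (-1 : ℝ)) (W := Y)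
      ((hZ.mlieBracket hX).diffAt x)
    simpa using this
  rw [h2] at hJ
  simp only [map_add, map_neg, neg_neg] at hJ
  linarith

/-! ### Reductions to generators -/

/-- Together with skew-symmetry in `X` and `Y`, this reduces Lie derivatives of `μ` to combs. -/
theorem smoothTensorialAt_lieDerivTwo {μ : TwoTensor I M} (hμ : IsSmoothTwoTensor I μ)
    (V : VectorField I M) {Y : VectorField I M} (hY : IsSmoothVF I Y) (x : M) :
    SmoothTensorialAt I (fun X => lieDerivTwo I μ V X Y x) x := by
  have := FiniteDimensional.complete ℝ E
  refine ⟨fun {f} {X} hf hX => ?_, fun {X} {X'} hX hX' => ?_⟩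
  · have hf := hf.mdifferentiable (by simp) x
    simp only [lieDerivTwo]
    rw [mvfderiv_smul_apply_left hμ hf (hX.diffAt x) (hY.diffAt x),
      mlieBracket_smul_right hf (hX.diffAt x)]
    simp only [Pi.smul_apply', map_add, map_smul, add_apply, smul_apply, smul_eq_mul]
    ring
  · simp only [lieDerivTwo]
    rw [mvfderiv_add_apply_left hμ (hX.diffAt x) (hX'.diffAt x) (hY.diffAt x),
      mlieBracket_add_right (hX.diffAt x) (hX'.diffAt x)]
    simp only [Pi.add_apply, map_add, add_apply]
    ring

theorem lieDerivTwo_swap {μ : TwoTensor I M} (halt : ∀ x v, μ x v v = 0)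
    (V X Y : VectorField I M) (x : M) :
    lieDerivTwo I μ V X Y x = -lieDerivTwo I μ V Y X x := by
  simp only [lieDerivTwo]
  rw [mvfderiv_swap_of_alternating halt, swap_of_alternating halt _ (Y x),
    swap_of_alternating halt (X x)]
  ring

variable {D : LinearConnection I M}

/-- `(L_V ∇)_X Y`. -/
def lieDerivConnection (D : LinearConnection I M) (V X Y : VectorField I M) : VectorField I M :=
  mlieBracket I V (nabla D X Y) - nabla D (mlieBracket I V X) Y - nabla D X (mlieBracket I V Y)

theorem smoothTensorialAt_lieDerivConnection_left (hD : D.ContMDiffCovariantDerivative ∞)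
    (V : VectorField I M) {Y : VectorField I M} (hY : IsSmoothVF I Y) (x : M) :
    SmoothTensorialAt I (fun X => lieDerivConnection D V X Y x) x := by
  have := FiniteDimensional.complete ℝ E
  refine ⟨fun {f} {X} hf hX => ?_, fun {X} {X'} hX hX' => ?_⟩
  · have hf' := hf.mdifferentiable (by simp) x
    simp only [lieDerivConnection, Pi.sub_apply, nabla_smul_left]
    rw [mlieBracket_smul_right hf' ((hX.nabla hD hY).diffAt x), nabla_apply, nabla_apply,
      mlieBracket_smul_right hf' (hX.diffAt x), map_add, map_smul, map_smul, nabla_apply]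
    simp only [Pi.smul_apply', nabla_apply]
    module
  · simp only [lieDerivConnection, Pi.sub_apply, nabla_add_left]
    rw [mlieBracket_add_right ((hX.nabla hD hY).diffAt x) ((hX'.nabla hD hY).diffAt x),
      nabla_apply, mlieBracket_add_right (hX.diffAt x) (hX'.diffAt x), map_add]
    simp only [nabla_apply, Pi.add_apply]
    module

/-- The second derivatives of `f` add up to `V(Xf) - X(Vf) - [V, X]f = 0`. -/
theorem smoothTensorialAt_lieDerivConnection_right (hD : D.ContMDiffCovariantDerivative ∞)
    {V : VectorField I M} (hV : IsSmoothVF I V) {X : VectorField I M} (hX : IsSmoothVF I X)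
    (x : M) : SmoothTensorialAt I (fun Y => lieDerivConnection D V X Y x) x := by
  have := FiniteDimensional.complete ℝ E
  have hs (f : M → ℝ) (hf : ContMDiff I 𝓘(ℝ, ℝ) ∞ f) (Y : VectorField I M) (hY : IsSmoothVF I Y) :
      mlieBracket I V (f • Y) = f • mlieBracket I V Y + (fun x => mvfderiv I f x (V x)) • Y := by
    funext y
    rw [mlieBracket_smul_right (hf.mdifferentiable (by simp) y) (hY.diffAt y), add_comm]
    rfl
  have ha (Y Y' : VectorField I M) (hY : IsSmoothVF I Y) (hY' : IsSmoothVF I Y') :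
      mlieBracket I V (Y + Y') = mlieBracket I V Y + mlieBracket I V Y' := by
    funext y
    exact mlieBracket_add_right (hY.diffAt y) (hY'.diffAt y)
  refine ⟨fun {f} {Y} hf hY => ?_, fun {Y} {Y'} hY hY' => ?_⟩
  · have hfX := contMDiff_mvfderiv_apply hf hX
    have hfV := contMDiff_mvfderiv_apply hf hV
    have h := mvfderiv_mlieBracket hf (hV.diffAt x) (hX.diffAt x)
    simp only [lieDerivConnection]
    rw [nabla_smul_right X hf hY, nabla_smul_right _ hf hY,
      ha _ _ (.smul hf (hX.nabla hD hY)) (.smul hfX hY), hs f hf _ (hX.nabla hD hY),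
      hs _ hfX _ hY, hs f hf _ hY, nabla_add_right _ (.smul hf (hV.mlieBracket hY)) (.smul hfV hY),
      nabla_smul_right _ hf (hV.mlieBracket hY), nabla_smul_right _ hfV hY]
    simp only [Pi.sub_apply, Pi.add_apply, Pi.smul_apply', h]
    module
  · simp only [lieDerivConnection]
    rw [nabla_add_right _ hY hY', nabla_add_right _ hY hY',
      ha _ _ (hX.nabla hD hY) (hX.nabla hD hY'), ha _ _ hY hY',
      nabla_add_right _ (hV.mlieBracket hY) (hV.mlieBracket hY')]
    simp only [Pi.sub_apply, Pi.add_apply]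
    abel

theorem tensorialAt_parallel {Ω : TwoTensor I M} (hΩ : IsSmoothTwoTensor I Ω) {x : M}
    {Z : VectorField I M} (hZ : DiffVFAt I Z x) (v : TangentSpace I x) :
    TensorialAt I E (fun Y : VectorField I M => mvfderiv I (fun y => Ω y (Y y) (Z y)) x v
      - Ω x (D Y x v) (Z x) - Ω x (Y x) (D Z x v)) x := by
  refine ⟨fun {f} {Y} hf hY => ?_, fun {Y} {Y'} hY hY' => ?_⟩
  · rw [mvfderiv_smul_apply_left hΩ hf hY hZ, D.isCovariantDerivativeOn.leibniz hY hf]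
    simp
    ring
  · rw [mvfderiv_add_apply_left hΩ hY hY' hZ, D.isCovariantDerivativeOn.add hY hY']
    simp
    ring

/-- `∇Ω = 0` can be tested on one choice of fields through each tangent vector. -/
theorem parallel_of_generators {Ω : TwoTensor I M} (hΩ : IsSmoothTwoTensor I Ω)
    (halt : ∀ x v, Ω x v v = 0) {x : M} {G : VectorField I M → Prop}
    (hG : ∀ X, G X → IsSmoothVF I X) (hGx : ∀ w : TangentSpace I x, ∃ X, G X ∧ X x = w)
    (h : ∀ Y Z, G Y → G Z → ∀ v : TangentSpace I x, mvfderiv I (fun y => Ω y (Y y) (Z y)) x v =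
      Ω x (D Y x v) (Z x) + Ω x (Y x) (D Z x v)) {Y Z : VectorField I M}
    (hY : DiffVFAt I Y x) (hZ : DiffVFAt I Z x) (v : TangentSpace I x) :
    mvfderiv I (fun y => Ω y (Y y) (Z y)) x v = Ω x (D Y x v) (Z x) + Ω x (Y x) (D Z x v) := by
  obtain ⟨Y', hY', hYx⟩ := hGx (Y x)
  obtain ⟨Z', hZ', hZx⟩ := hGx (Z x)
  have e1 := (tensorialAt_parallel (D := D) hΩ hZ v).pointwise hY ((hG _ hY').diffAt x) hYx.symm
  have e2 := (tensorialAt_parallel (D := D) hΩ ((hG _ hY').diffAt x) v).pointwise hZ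
    ((hG _ hZ').diffAt x) hZx.symm
  have e3 := h Y' Z' hY' hZ' v
  have e4 := mvfderiv_swap_of_alternating halt Y' Z x v
  have e5 := mvfderiv_swap_of_alternating halt Y' Z' x v
  rw [swap_of_alternating halt (D Z x v), swap_of_alternating halt (Z x),
    swap_of_alternating halt (D Z' x v), swap_of_alternating halt (Z' x)] at e2
  linarith

end General

/-! ### The symplectic form of `P`, its Lie derivatives, and the connection formulas on combs. -/

section Quadruple

variable {n : ℕ}
  {M : Type*} [TopologicalSpace M] [ChartedSpace (EuclideanSpace ℝ (Fin (2 * n))) M]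
  [IsManifold (𝓡 (2 * n)) ∞ M]
  {N : Type*} [TopologicalSpace N] [ChartedSpace (EuclideanSpace ℝ (Fin (2 * n + 1))) N]
  [IsManifold (𝓡 (2 * n + 1)) ∞ N] [T2Space M] [T2Space N]

namespace ContactQuadruple

variable (Q : ContactQuadruple n M N)

theorem isSymplecticForm_μ : IsSymplecticForm (modelP n) Q.μ := by
  have halt : ∀ (p : N × ℝ) (v : TangentSpace (modelP n) p), Q.μ p v v = 0 := fun p v => by
    rw [μ_apply, Q.symplectic.alternating]; ring
  have hsm : IsSmoothTwoTensor (modelP n) Q.μ :=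
    isSmoothTwoTensor_extDerivOne Q.isSmoothOneForm_exp_smul_αP
  refine ⟨hsm, halt, fun p v hv => ?_, fun X Y Z p hX hY hZ => ?_⟩
  -- Pairing `v` with horizontal lifts, with `∂_s` and with `E` isolates in turn its components
  -- `p_*v`, `p₁^*α(v)` and `ds(v)`.
  · simp only [μ_apply, mul_eq_zero, Real.exp_ne_zero, false_or] at hv
    refine Q.tangent_ext ?_ ?_ ?_
    · rw [map_zero]
      refine Q.symplectic.nondegenerate _ _ fun w => ?_
      have := hv (Q.hlift p w)
      rw [dproj_hlift, αP_hlift, ds_hlift] at this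
      linarith
    · have := hv (Q.S p)
      rw [dproj_S, αP_S, ds_S, map_zero] at this
      rw [map_zero]; linarith
    · have := hv (Q.E p)
      rw [dproj_E, αP_E, ds_E, map_zero] at this
      rw [map_zero]; linarith
  · exact extDerivTwo_eq_zero hsm halt (fun A B C hA hB hC =>
      extDerivTwo_extDerivOne Q.isSmoothOneForm_exp_smul_αP hA hB hC) hX hY hZ

section Comb

variable {X Y : VectorField (𝓡 (2 * n)) M} {a b f g : M → ℝ}

/-- The coefficients of a comb are pulled back from `M`, hence constant along `E`, and the
coefficients of `E` itself are constant. As `∇^P` preserves combs, this is the reason why `E` is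
affine; the next lemma plays the same role for `∂_s`. -/
theorem mlieBracket_E_comb (hX : IsSmoothVF (𝓡 (2 * n)) X)
    (hf : ContMDiff (𝓡 (2 * n)) 𝓘(ℝ, ℝ) ∞ f) (hg : ContMDiff (𝓡 (2 * n)) 𝓘(ℝ, ℝ) ∞ g) :
    mlieBracket (modelP n) Q.E (Q.comb X f g) = 0 := by
  rw [E_eq_comb, Q.mlieBracket_comb (a := 1) (b := 0) isSmoothVF_zero hX contMDiff_const contMDiff_const hf hg]
  funext p
  have h1 : mvfderiv (𝓡 (2 * n)) (1 : M → ℝ) = 0 := funext fun _ => mvfderiv_const 1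
  simp [comb, h1, vec_zero]

theorem mlieBracket_S_comb (hX : IsSmoothVF (𝓡 (2 * n)) X)
    (hf : ContMDiff (𝓡 (2 * n)) 𝓘(ℝ, ℝ) ∞ f) (hg : ContMDiff (𝓡 (2 * n)) 𝓘(ℝ, ℝ) ∞ g) :
    mlieBracket (modelP n) Q.S (Q.comb X f g) = 0 := by
  rw [S_eq_comb, Q.mlieBracket_comb (a := 0) (b := 1) isSmoothVF_zero hX contMDiff_const contMDiff_const hf hg]
  funext p
  have h1 : mvfderiv (𝓡 (2 * n)) (1 : M → ℝ) = 0 := funext fun _ => mvfderiv_const 1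
  simp [comb, h1, vec_zero]

theorem μ_comb (p : N × ℝ) : Q.μ p (Q.comb X a b p) (Q.comb Y f g p) =
    Real.exp (2 * p.2) * (2 * (b (Q.proj p) * f (Q.proj p) - g (Q.proj p) * a (Q.proj p))
      + Q.Ω (Q.proj p) (X (Q.proj p)) (Y (Q.proj p))) := by
  rw [μ_apply]; simp only [ds_comb, αP_comb, dproj_comb]

theorem mvfderiv_μ_comb (hX : IsSmoothVF (𝓡 (2 * n)) X) (hY : IsSmoothVF (𝓡 (2 * n)) Y)
    (a b f g : ℝ) (p : N × ℝ) (w : TangentSpace (modelP n) p) :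
    mvfderiv (modelP n) (fun q => Q.μ q (Q.comb X (fun _ => a) (fun _ => b) q)
      (Q.comb Y (fun _ => f) (fun _ => g) q)) p w =
    Real.exp (2 * p.2) * (2 * Q.ds p w * (2 * (b * f - g * a)
      + Q.Ω (Q.proj p) (X (Q.proj p)) (Y (Q.proj p))) +
      mvfderiv (𝓡 (2 * n)) (fun x => Q.Ω x (X x) (Y x)) (Q.proj p) (Q.dproj p w)) := by
  simp only [μ_comb]
  have hc : ContMDiff (𝓡 (2 * n)) 𝓘(ℝ, ℝ) ∞
      fun x => 2 * (b * f - g * a) + Q.Ω x (X x) (Y x) :=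
    contMDiff_const.add (Q.symplectic.smooth.apply hX hY)
  have h1 := mvfderiv_mul (f := fun q : N × ℝ => Real.exp (2 * q.2))
      (contMDiff_exp.mdifferentiable (by simp) p)
      ((hc.comp Q.contMDiff_proj).mdifferentiable (by simp) p)
  refine (congrArg (fun L => L w) h1).trans ?_
  have h2 := Q.mvfderiv_comp_proj (p := p) (hc.mdifferentiable (by simp) _) w
  have h3 : mvfderiv (𝓡 (2 * n)) (fun x => 2 * (b * f - g * a) + Q.Ω x (X x) (Y x)) (Q.proj p) =
      mvfderiv (𝓡 (2 * n)) (fun x => Q.Ω x (X x) (Y x)) (Q.proj p) := by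
    have := mvfderiv_add (g := fun _ : M => 2 * (b * f - g * a)) (x := Q.proj p)
      (mdifferentiableAt_const (I := 𝓡 (2 * n)))
      ((Q.symplectic.smooth.apply hX hY).mdifferentiable (by simp) _)
    refine Eq.trans this ?_
    rw [mvfderiv_const]; simp
  rw [h3] at h2
  simp only [add_apply, smul_apply, smul_eq_mul, Q.mvfderiv_exp]
  erw [h2]
  simp only [Function.comp]
  ring

end Comb

theorem lieDerivTwo_of_comb {V : VectorField (modelP n) (N × ℝ)} {t : ℝ} {p : N × ℝ}
    (h : ∀ X Y, IsSmoothVF (𝓡 (2 * n)) X → IsSmoothVF (𝓡 (2 * n)) Y → ∀ a b c d : ℝ,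
      lieDerivTwo (modelP n) Q.μ V (Q.comb X (fun _ => a) fun _ => b)
        (Q.comb Y (fun _ => c) fun _ => d) p =
      t * Q.μ p (Q.comb X (fun _ => a) (fun _ => b) p) (Q.comb Y (fun _ => c) (fun _ => d) p))
    {X Y : VectorField (modelP n) (N × ℝ)} (hX : IsSmoothVF (modelP n) X)
    (hY : IsSmoothVF (modelP n) Y) :
    lieDerivTwo (modelP n) Q.μ V X Y p = t * Q.μ p (X p) (Y p) := by
  obtain ⟨X', hX', hXp⟩ := Q.exists_comb_apply_eq p (X p)
  obtain ⟨Y', hY', hYp⟩ := Q.exists_comb_apply_eq p (Y p)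
  have hsm := Q.isSymplecticForm_μ.smooth
  have halt := Q.isSymplecticForm_μ.alternating
  have hcX := Q.isSmoothVF_comb hX' (contMDiff_const (c := Q.αP p (X p)))
    (contMDiff_const (c := Q.ds p (X p)))
  have hcY := Q.isSmoothVF_comb hY' (contMDiff_const (c := Q.αP p (Y p)))
    (contMDiff_const (c := Q.ds p (Y p)))
  rw [(smoothTensorialAt_lieDerivTwo hsm V hY p).pointwise hX hcX hXp,
    lieDerivTwo_swap halt, (smoothTensorialAt_lieDerivTwo hsm V hcX p).pointwise hY hcY hYp,
    ← lieDerivTwo_swap halt, h X' Y' hX' hY', ← hXp, ← hYp]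

theorem lieDerivTwo_E {X Y : VectorField (modelP n) (N × ℝ)} (hX : IsSmoothVF (modelP n) X)
    (hY : IsSmoothVF (modelP n) Y) (p : N × ℝ) : lieDerivTwo (modelP n) Q.μ Q.E X Y p = 0 := by
  rw [Q.lieDerivTwo_of_comb (t := 0) (fun X Y hX hY a b c d => ?_) hX hY, zero_mul]
  rw [lieDerivTwo, Q.mlieBracket_E_comb hX contMDiff_const contMDiff_const,
    Q.mlieBracket_E_comb hY contMDiff_const contMDiff_const, Q.mvfderiv_μ_comb hX hY, ds_E, dproj_E]
  simp

theorem lieDerivTwo_S {X Y : VectorField (modelP n) (N × ℝ)} (hX : IsSmoothVF (modelP n) X)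
    (hY : IsSmoothVF (modelP n) Y) (p : N × ℝ) :
    lieDerivTwo (modelP n) Q.μ Q.S X Y p = 2 * Q.μ p (X p) (Y p) := by
  refine Q.lieDerivTwo_of_comb (fun X Y hX hY a b c d => ?_) hX hY
  rw [lieDerivTwo, Q.mlieBracket_S_comb hX contMDiff_const contMDiff_const,
    Q.mlieBracket_S_comb hY contMDiff_const contMDiff_const, Q.mvfderiv_μ_comb hX hY, ds_S,
    dproj_S, μ_comb]
  simp
  ring

/-! ### The connection on combinations of generators -/

theorem vec_congr {p : N × ℝ} {v v' : TangentSpace (𝓡 (2 * n)) (Q.proj p)} {a a' c c' : ℝ}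
    (hv : v = v') (ha : a = a') (hc : c = c') : Q.vec p v a c = Q.vec p v' a' c' := by
  rw [hv, ha, hc]

variable {Q} {D : LinearConnection (𝓡 (2 * n)) M} {s : TwoTensor (𝓡 (2 * n)) M}
    {U : VectorField (𝓡 (2 * n)) M} {F : M → ℝ} {DP : LinearConnection (modelP n) (N × ℝ)}

theorem IsInduced.apply_lift (h : Q.IsInduced D s U F DP) {Y : VectorField (𝓡 (2 * n)) M}
    (hY : IsSmoothVF (𝓡 (2 * n)) Y) (p : N × ℝ) (v : TangentSpace (𝓡 (2 * n)) (Q.proj p))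
    (a c : ℝ) : DP (Q.lift Y) p (Q.vec p v a c) = Q.vec p
      (D Y (Q.proj p) v + (2 * a) • symplEnd (𝓡 (2 * n)) Q.Ω s (Q.proj p) (Y (Q.proj p))
        + c • Y (Q.proj p))
      (-(1 / 2 * Q.Ω (Q.proj p) v (Y (Q.proj p))))
      (-s (Q.proj p) v (Y (Q.proj p)) + a * Q.Ω (Q.proj p) (Y (Q.proj p)) (U (Q.proj p))) := by
  obtain ⟨X, hX, rfl⟩ := exists_isSmoothVF_apply_eq (I := 𝓡 (2 * n)) (Q.proj p) v
  have h1 := h.lift_lift X Y hX hY p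
  have h2 := h.E_lift Y hY p
  have h3 := h.S_lift Y hY p
  rw [lift] at h1
  rw [vec, map_add, map_add, map_smul, map_smul, h1, h2, h3]
  simp only [lift, Q.hlift_eq_vec, Q.E_eq_vec, Q.S_eq_vec, vec_smul, vec_add, vec_sub]
  refine Q.vec_congr ?_ ?_ ?_
  · module
  · ring
  · ring

theorem IsInduced.apply_E (h : Q.IsInduced D s U F DP) (p : N × ℝ)
    (v : TangentSpace (𝓡 (2 * n)) (Q.proj p)) (a c : ℝ) : DP Q.E p (Q.vec p v a c) = Q.vec p
      ((2 : ℝ) • symplEnd (𝓡 (2 * n)) Q.Ω s (Q.proj p) v - (2 * a) • U (Q.proj p)) c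
      (Q.Ω (Q.proj p) v (U (Q.proj p)) + a * F (Q.proj p)) := by
  obtain ⟨X, hX, rfl⟩ := exists_isSmoothVF_apply_eq (I := 𝓡 (2 * n)) (Q.proj p) v
  have h1 := h.lift_E X hX p
  have h2 := h.E_E p
  have h3 := h.S_E p
  rw [lift] at h1
  rw [vec, map_add, map_add, map_smul, map_smul, h1, h2, h3]
  simp only [lift, Q.hlift_eq_vec, Q.E_eq_vec, Q.S_eq_vec, vec_smul, vec_add, vec_sub]
  refine Q.vec_congr ?_ ?_ ?_
  · module
  · ring
  · ring

theorem IsInduced.apply_S (h : Q.IsInduced D s U F DP) (p : N × ℝ)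
    (v : TangentSpace (𝓡 (2 * n)) (Q.proj p)) (a c : ℝ) :
    DP Q.S p (Q.vec p v a c) = Q.vec p v a c := by
  obtain ⟨X, hX, rfl⟩ := exists_isSmoothVF_apply_eq (I := 𝓡 (2 * n)) (Q.proj p) v
  have h1 := h.lift_S X hX p
  rw [lift] at h1
  rw [vec, map_add, map_add, map_smul, map_smul, h1, h.E_S, h.S_S]

/-- The induced connection on a combination of generators. -/
theorem IsInduced.apply_comb (h : Q.IsInduced D s U F DP) {Y : VectorField (𝓡 (2 * n)) M}
    {f g : M → ℝ} (hY : IsSmoothVF (𝓡 (2 * n)) Y) (hf : ContMDiff (𝓡 (2 * n)) 𝓘(ℝ, ℝ) ∞ f)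
    (hg : ContMDiff (𝓡 (2 * n)) 𝓘(ℝ, ℝ) ∞ g) (p : N × ℝ)
    (v : TangentSpace (𝓡 (2 * n)) (Q.proj p)) (a c : ℝ) :
    DP (Q.comb Y f g) p (Q.vec p v a c) = Q.vec p
      (D Y (Q.proj p) v + (2 * a) • symplEnd (𝓡 (2 * n)) Q.Ω s (Q.proj p) (Y (Q.proj p))
        + c • Y (Q.proj p) + (2 * f (Q.proj p)) • symplEnd (𝓡 (2 * n)) Q.Ω s (Q.proj p) v
        - (2 * a * f (Q.proj p)) • U (Q.proj p) + g (Q.proj p) • v)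
      (mvfderiv (𝓡 (2 * n)) f (Q.proj p) v - 1 / 2 * Q.Ω (Q.proj p) v (Y (Q.proj p))
        + f (Q.proj p) * c + g (Q.proj p) * a)
      (mvfderiv (𝓡 (2 * n)) g (Q.proj p) v - s (Q.proj p) v (Y (Q.proj p))
        + a * Q.Ω (Q.proj p) (Y (Q.proj p)) (U (Q.proj p))
        + f (Q.proj p) * (Q.Ω (Q.proj p) v (U (Q.proj p)) + a * F (Q.proj p))
        + g (Q.proj p) * c) := by
  have hf' := hf.comp Q.contMDiff_proj
  have hg' := hg.comp Q.contMDiff_proj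
  have e : Q.comb Y f g = Q.lift Y + (f ∘ Q.proj) • Q.E + (g ∘ Q.proj) • Q.S := rfl
  have hl := Q.isSmoothVF_lift hY
  have hE := IsSmoothVF.smul hf' Q.isSmoothVF_E
  have hS := IsSmoothVF.smul hg' Q.isSmoothVF_S
  have d1 := Q.mvfderiv_comp_proj (p := p) (hf.mdifferentiable (by simp) _) (Q.vec p v a c)
  have d2 := Q.mvfderiv_comp_proj (p := p) (hg.mdifferentiable (by simp) _) (Q.vec p v a c)
  rw [dproj_vec] at d1 d2
  rw [e, DP.isCovariantDerivativeOn.add ((hl.add hE).diffAt p) (hS.diffAt p),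
    DP.isCovariantDerivativeOn.add (hl.diffAt p) (hE.diffAt p),
    DP.isCovariantDerivativeOn.leibniz (Q.isSmoothVF_E.diffAt p)
      (hf'.mdifferentiable (by simp) p),
    DP.isCovariantDerivativeOn.leibniz (Q.isSmoothVF_S.diffAt p)
      (hg'.mdifferentiable (by simp) p)]
  simp only [add_apply, smul_apply, ContinuousLinearMap.smulRight_apply]
  rw [h.apply_lift hY, h.apply_E, h.apply_S]
  change _ + (f (Q.proj p) • _ + mvfderiv (modelP n) (fun q => f (Q.proj q)) p _ • Q.E p)
    + (g (Q.proj p) • _ + mvfderiv (modelP n) (fun q => g (Q.proj q)) p _ • Q.S p) = _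
  rw [d1, d2]
  simp only [Q.E_eq_vec, Q.S_eq_vec, vec_smul, vec_add]
  refine Q.vec_congr ?_ ?_ ?_
  · module
  · ring
  · ring

end ContactQuadruple
end Quadruple

/-! ### Expansion of fields on `P` in generators. -/

section Quadruple

variable {n : ℕ}
  {M : Type*} [TopologicalSpace M] [ChartedSpace (EuclideanSpace ℝ (Fin (2 * n))) M]
  [IsManifold (𝓡 (2 * n)) ∞ M]
  {N : Type*} [TopologicalSpace N] [ChartedSpace (EuclideanSpace ℝ (Fin (2 * n + 1))) N]
  [IsManifold (𝓡 (2 * n + 1)) ∞ N]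

namespace ContactQuadruple

variable (Q : ContactQuadruple n M N)

section Coefficients

variable {x₀ : M} {ι : Type*} [Fintype ι]
  (b : Module.Basis ι ℝ (EuclideanSpace ℝ (Fin (2 * n))))

/-- The vectors `p_*W` form a section along `p`, not a field on `M`. Their coefficients are read in
the bundle chart from the tangent map of `p`, which is smooth. -/
theorem localFrameCoeff_dproj_eventuallyEq {p : N × ℝ}
    (hp : Q.proj p ∈ (trivializationAt (EuclideanSpace ℝ (Fin (2 * n)))
      (TangentSpace (𝓡 (2 * n)) : M → Type _) x₀).baseSet) (W : VectorField (modelP n) (N × ℝ))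
    (i : ι) :
    (fun q => (trivializationAt (EuclideanSpace ℝ (Fin (2 * n)))
      (TangentSpace (𝓡 (2 * n)) : M → Type _) x₀).localFrameCoeff (𝓡 (2 * n)) b i (Q.proj q)
        (Q.dproj q (W q))) =ᶠ[𝓝 p]
    fun q => b.equivFunL (trivializationAt (EuclideanSpace ℝ (Fin (2 * n)))
      (TangentSpace (𝓡 (2 * n)) : M → Type _) x₀
        (tangentMap (modelP n) (𝓡 (2 * n)) Q.proj ⟨q, W q⟩)).2 i := by
  filter_upwards [Q.contMDiff_proj.continuous.continuousAt.preimage_mem_nhds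
    ((trivializationAt (EuclideanSpace ℝ (Fin (2 * n)))
      (TangentSpace (𝓡 (2 * n)) : M → Type _) x₀).open_baseSet.mem_nhds hp)] with q hq
  classical
  -- Frame coefficients are formulated for fields; a field supported at the single point `Q.proj q`
  -- carries the given vector.
  have h := (trivializationAt (EuclideanSpace ℝ (Fin (2 * n)))
      (TangentSpace (𝓡 (2 * n)) : M → Type _) x₀).localFrameCoeff_eq_coeff (I := 𝓡 (2 * n)) (b := b)
      (s := Function.update 0 (Q.proj q) (Q.dproj q (W q))) hq (i := i)
  simp only [Function.update_self] at h
  rw [h]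
  rfl

theorem contMDiffAt_localFrameCoeff_dproj {p : N × ℝ}
    (hp : Q.proj p ∈ (trivializationAt (EuclideanSpace ℝ (Fin (2 * n)))
      (TangentSpace (𝓡 (2 * n)) : M → Type _) x₀).baseSet) {W : VectorField (modelP n) (N × ℝ)}
    (hW : IsSmoothVF (modelP n) W) (i : ι) :
    ContMDiffAt (modelP n) 𝓘(ℝ, ℝ) ∞
      (fun q => (trivializationAt (EuclideanSpace ℝ (Fin (2 * n)))
        (TangentSpace (𝓡 (2 * n)) : M → Type _) x₀).localFrameCoeff (𝓡 (2 * n)) b i (Q.proj q)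
          (Q.dproj q (W q))) p := by
  refine ContMDiffAt.congr_of_eventuallyEq ?_ (Q.localFrameCoeff_dproj_eventuallyEq b hp W i)
  have h1 : ContMDiff (modelP n).tangent (𝓡 (2 * n)).tangent ∞
      (tangentMap (modelP n) (𝓡 (2 * n)) Q.proj) := Q.contMDiff_proj.contMDiff_tangentMap (by simp)
  have h2 := ((trivializationAt (EuclideanSpace ℝ (Fin (2 * n)))
    (TangentSpace (𝓡 (2 * n)) : M → Type _) x₀).contMDiffOn (IB := 𝓡 (2 * n)) (n := ∞)).contMDiffAt
      (((trivializationAt (EuclideanSpace ℝ (Fin (2 * n)))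
        (TangentSpace (𝓡 (2 * n)) : M → Type _) x₀).open_source.mem_nhds
        ((Trivialization.mem_source _ (x := tangentMap (modelP n) (𝓡 (2 * n)) Q.proj ⟨p, W p⟩)).2 hp)))
  have h3 := ContMDiffAt.comp p h2 ((h1.comp hW) p)
  exact contMDiffAt_pi_space.1 ((b.equivFunL.contDiff.contMDiff.contMDiffAt).comp p h3.snd) i

theorem mdifferentiableAt_localFrameCoeff_dproj {p : N × ℝ}
    (hp : Q.proj p ∈ (trivializationAt (EuclideanSpace ℝ (Fin (2 * n)))
      (TangentSpace (𝓡 (2 * n)) : M → Type _) x₀).baseSet) {W : VectorField (modelP n) (N × ℝ)}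
    (hW : DiffVFAt (modelP n) W p) (i : ι) :
    MDifferentiableAt (modelP n) 𝓘(ℝ, ℝ)
      (fun q => (trivializationAt (EuclideanSpace ℝ (Fin (2 * n)))
        (TangentSpace (𝓡 (2 * n)) : M → Type _) x₀).localFrameCoeff (𝓡 (2 * n)) b i (Q.proj q)
          (Q.dproj q (W q))) p := by
  refine MDifferentiableAt.congr_of_eventuallyEq ?_
    (Q.localFrameCoeff_dproj_eventuallyEq b hp W i)
  have h1 : ContMDiff (modelP n).tangent (𝓡 (2 * n)).tangent ∞
      (tangentMap (modelP n) (𝓡 (2 * n)) Q.proj) := Q.contMDiff_proj.contMDiff_tangentMap (by simp)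
  have h2 := ((trivializationAt (EuclideanSpace ℝ (Fin (2 * n)))
    (TangentSpace (𝓡 (2 * n)) : M → Type _) x₀).contMDiffOn (IB := 𝓡 (2 * n)) (n := ∞)).contMDiffAt
      (((trivializationAt (EuclideanSpace ℝ (Fin (2 * n)))
        (TangentSpace (𝓡 (2 * n)) : M → Type _) x₀).open_source.mem_nhds
        ((Trivialization.mem_source _ (x := tangentMap (modelP n) (𝓡 (2 * n)) Q.proj ⟨p, W p⟩)).2 hp)))
  have h4 : ContMDiffAt ((𝓡 (2 * n)).prod 𝓘(ℝ, EuclideanSpace ℝ (Fin (2 * n)))) 𝓘(ℝ, ℝ) ∞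
      (fun z : TangentBundle (𝓡 (2 * n)) M => b.equivFunL
        (trivializationAt (EuclideanSpace ℝ (Fin (2 * n)))
          (TangentSpace (𝓡 (2 * n)) : M → Type _) x₀ z).2 i)
      (tangentMap (modelP n) (𝓡 (2 * n)) Q.proj ⟨p, W p⟩) :=
    contMDiffAt_pi_space.1 ((b.equivFunL.contDiff.contMDiff.contMDiffAt).comp _ h2.snd) i
  exact (h4.mdifferentiableAt (by simp)).comp p
    (((h1 _).mdifferentiableAt (by simp)).comp p hW)

end Coefficients

variable [T2Space M] [T2Space N]

/-- Fields on `P` expand, after multiplication by a cutoff function, in generators. -/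
theorem exists_cutoff_generators (p : N × ℝ) :
    ∃ (χ : N × ℝ → ℝ) (G : (Fin (2 * n) ⊕ Bool) →
        VectorField (modelP n) (N × ℝ))
      (c : (Fin (2 * n) ⊕ Bool) →
        VectorField (modelP n) (N × ℝ) → N × ℝ → ℝ),
      ContMDiff (modelP n) 𝓘(ℝ, ℝ) ∞ χ ∧ χ =ᶠ[𝓝 p] 1 ∧
      (∀ i, ∃ (X : VectorField (𝓡 (2 * n)) M) (f g : M → ℝ), IsSmoothVF (𝓡 (2 * n)) X ∧
        ContMDiff (𝓡 (2 * n)) 𝓘(ℝ, ℝ) ∞ f ∧ ContMDiff (𝓡 (2 * n)) 𝓘(ℝ, ℝ) ∞ g ∧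
        G i = Q.comb X f g) ∧
      (∀ i W, IsSmoothVF (modelP n) W → ContMDiff (modelP n) 𝓘(ℝ, ℝ) ∞ (c i W)) ∧
      (∀ W, χ • W = ∑ i, c i W • G i) := by
  let t := trivializationAt (EuclideanSpace ℝ (Fin (2 * n)))
    (TangentSpace (𝓡 (2 * n)) : M → Type _) (Q.proj p)
  let b := (EuclideanSpace.basisFun (Fin (2 * n)) ℝ).toBasis
  obtain ⟨ψ, -, hψ⟩ := (SmoothBumpFunction.nhds_basis_tsupport (I := 𝓡 (2 * n)) (Q.proj p)).mem_iff.1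
    (t.open_baseSet.mem_nhds (FiberBundle.mem_baseSet_trivializationAt' (Q.proj p)))
  have hψ0 (y) (hy : y ∉ t.baseSet) : ψ y = 0 :=
    image_eq_zero_of_notMem_tsupport fun h => hy (hψ h)
  have hψs : ContMDiff (modelP n) 𝓘(ℝ, ℝ) ∞ fun q => ψ (Q.proj q) :=
    ψ.contMDiff.comp Q.contMDiff_proj
  have hc1 (c : ℝ) : ContMDiff (𝓡 (2 * n)) 𝓘(ℝ, ℝ) ∞ fun _ : M => c := contMDiff_const
  -- The cutoff is pulled back from `M`, so that the generators stay combs: lifts of cut-off frame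
  -- fields, together with `E` and `∂_s`. It is squared because fields and coefficients each take a
  -- factor.
  refine ⟨fun q => ψ (Q.proj q) * ψ (Q.proj q),
    Sum.elim (fun i => Q.lift ((ψ : M → ℝ) • t.localFrame b i)) (fun z => if z then Q.E else Q.S),
    Sum.elim (fun i W q => ψ (Q.proj q) *
      t.localFrameCoeff (𝓡 (2 * n)) b i (Q.proj q) (Q.dproj q (W q)))
      (fun z W q => (ψ (Q.proj q) * ψ (Q.proj q)) * if z then Q.αP q (W q) else Q.ds q (W q)),
    hψs.mul hψs, ?_, ?_, ?_, ?_⟩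
  · filter_upwards [Q.contMDiff_proj.continuous.continuousAt.eventually ψ.eventuallyEq_one]
      with q hq
    simp [hq]
  · rintro (i | z)
    · exact ⟨_, 0, 0, ContMDiffOn.smul_section_of_tsupport ψ.contMDiff.contMDiffOn t.open_baseSet hψ
        (t.contMDiffOn_localFrame_baseSet ∞ b i), hc1 0, hc1 0, Q.lift_eq_comb _⟩
    · cases z
      · exact ⟨0, 0, 1, isSmoothVF_zero, hc1 0, hc1 1, Q.S_eq_comb⟩
      · exact ⟨0, 1, 0, isSmoothVF_zero, hc1 1, hc1 0, Q.E_eq_comb⟩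
  · rintro (i | z) W hW
    · refine contMDiff_of_tsupport fun q hq => ?_
      have hq' : Q.proj q ∈ t.baseSet := hψ (tsupport_comp_subset_preimage ψ
        Q.contMDiff_proj.continuous (tsupport_mul_subset_left hq))
      exact (hψs q).mul (Q.contMDiffAt_localFrameCoeff_dproj b hq' hW i)
    · cases z
      · exact (hψs.mul hψs).mul (Q.isSmoothOneForm_ds.apply hW)
      · exact (hψs.mul hψs).mul (Q.isSmoothOneForm_αP.apply hW)
  · intro W
    funext q
    simp only [Fintype.sum_sum_type, Fintype.sum_bool, Sum.elim_inl, Sum.elim_inr, if_true,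
      Bool.false_eq_true, if_false, Finset.sum_apply, Pi.smul_apply']
    refine Q.tangent_ext ?_ ?_ ?_
    · simp only [map_add, map_sum, map_smul]
      simp only [lift, dproj_hlift, dproj_E, dproj_S, smul_zero, add_zero, Pi.smul_apply']
      by_cases hq : Q.proj q ∈ t.baseSet
      · classical
        have h := t.eq_sum_localFrameCoeff_smul (I := 𝓡 (2 * n)) (b := b)
          (s := Function.update 0 (Q.proj q) (Q.dproj q (W q))) hq
        simp only [Function.update_self] at h
        conv_lhs => rw [h]
        rw [Finset.smul_sum]
        exact Finset.sum_congr rfl fun i _ => by rw [smul_smul, smul_smul]; ring_nf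
      · simp [hψ0 _ hq]
    · simp only [map_add, map_sum, map_smul]
      simp only [lift, αP_hlift, αP_E, αP_S, add_zero, Finset.sum_const_zero, zero_add,
        smul_eq_mul, mul_one, mul_zero]
    · simp only [map_add, map_sum, map_smul]
      simp only [lift, ds_hlift, ds_E, ds_S, Finset.sum_const_zero, zero_add,
        smul_eq_mul, mul_one, mul_zero]

end ContactQuadruple
end Quadruple

/-! ### Connections tested on generators. -/

section General

variable {E : Type*} [NormedAddCommGroup E] [NormedSpace ℝ E] [FiniteDimensional ℝ E]
  {H : Type*} [TopologicalSpace H] {I : ModelWithCorners ℝ E H}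
  {M : Type*} [TopologicalSpace M] [ChartedSpace H M] [IsManifold I ∞ M]
  {D D' : LinearConnection I M}

theorem mvfderiv_eq_zero_of_eventuallyEq_one {χ : M → ℝ} {x : M} (h : χ =ᶠ[𝓝 x] 1) :
    mvfderiv I χ x = 0 := by
  have h1 : mvfderiv I χ x = mvfderiv I (fun _ => (1 : ℝ)) x := by
    rw [mvfderiv, mvfderiv, Filter.EventuallyEq.mfderiv_eq h, h.eq_of_nhds]
    rfl
  rw [h1]
  exact mvfderiv_const 1

theorem isSmoothVF_sum {ι : Type*} {t : Finset ι} {X : ι → VectorField I M}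
    (h : ∀ i ∈ t, IsSmoothVF I (X i)) : IsSmoothVF I (∑ i ∈ t, X i) := by
  classical
  induction t using Finset.induction_on with
  | empty => exact isSmoothVF_zero
  | insert i t hi ih =>
    rw [Finset.sum_insert hi]
    exact (h i (Finset.mem_insert_self ..)).add
      (ih fun j hj => h j (Finset.mem_insert_of_mem hj))

theorem isSmoothVF_nabla_sum_right {ι : Type*} {t : Finset ι} {X : VectorField I M}
    {G : ι → VectorField I M} {c : ι → M → ℝ} (hX : IsSmoothVF I X)
    (hG : ∀ i, IsSmoothVF I (G i)) (hc : ∀ i, ContMDiff I 𝓘(ℝ, ℝ) ∞ (c i))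
    (h : ∀ i, IsSmoothVF I (nabla D X (G i))) :
    IsSmoothVF I (nabla D X (∑ i ∈ t, c i • G i)) := by
  classical
  induction t using Finset.induction_on with
  | empty =>
    have : nabla D X (∑ i ∈ ∅, c i • G i) = 0 := by
      funext x
      rw [Finset.sum_empty, nabla_apply, D.zero]; rfl
    rw [this]
    exact isSmoothVF_zero
  | insert i t hi ih =>
    rw [Finset.sum_insert hi, nabla_add_right _ (.smul (hc i) (hG i))
      (isSmoothVF_sum fun j _ => .smul (hc j) (hG j)), nabla_smul_right _ (hc i) (hG i)]
    exact ((IsSmoothVF.smul (hc i) (h i)).add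
      (.smul (contMDiff_mvfderiv_apply (hc i) hX) (hG i))).add ih

theorem nabla_sum_left {ι : Type*} (t : Finset ι) (X : ι → VectorField I M) (c : ι → M → ℝ)
    (Y : VectorField I M) :
    nabla D (∑ i ∈ t, c i • X i) Y = ∑ i ∈ t, c i • nabla D (X i) Y := by
  funext x
  simp only [nabla_apply, Finset.sum_apply, Pi.smul_apply', map_sum, map_smul]

/-- Smoothness of a connection can be tested on local generators. -/
theorem contMDiffCovariantDerivative_of_generators [T2Space M] {ι : Type*} [Fintype ι]
    (h : ∀ x : M, ∃ (χ : M → ℝ) (G : ι → VectorField I M) (c : ι → VectorField I M → M → ℝ),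
      ContMDiff I 𝓘(ℝ, ℝ) ∞ χ ∧ χ =ᶠ[𝓝 x] 1 ∧ (∀ i, IsSmoothVF I (G i)) ∧
      (∀ i W, IsSmoothVF I W → ContMDiff I 𝓘(ℝ, ℝ) ∞ (c i W)) ∧
      (∀ W, χ • W = ∑ i, c i W • G i) ∧ ∀ i j, IsSmoothVF I (nabla D (G i) (G j))) :
    D.ContMDiffCovariantDerivative ∞ := by
  refine ⟨⟨fun {W} hW => contMDiffOn_univ.2 (contMDiff_hom_of_forall _ fun X hX x => ?_)⟩⟩
  replace hW : IsSmoothVF I W := (contMDiffOn_univ.1 hW)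
  obtain ⟨χ, G, c, hχ, hχ1, hG, hc, hexp, hGG⟩ := h x
  -- This is a combination of the smooth fields `∇_{Gᵢ} Gⱼ` and `Gⱼ` with smooth coefficients. Near
  -- `x` the cutoff is 1 with zero differential, so the germ is that of `∇_X W`.
  have h1 : IsSmoothVF I (nabla D (χ • X) (χ • W)) := by
    rw [hexp X, hexp W, nabla_sum_left]
    exact isSmoothVF_sum fun i _ => .smul (hc i X hX)
      (isSmoothVF_nabla_sum_right (hG i) hG (fun j => hc j W hW) (hGG i))
  refine (h1 x).congr_of_eventuallyEq ?_
  filter_upwards [eventually_eventually_nhds.2 hχ1] with y hy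
  have e : nabla D (χ • X) (χ • W) y = nabla D X W y := by
    rw [nabla_smul_left, nabla_smul_right _ hχ hW]
    simp only [Pi.smul_apply', Pi.add_apply, mvfderiv_eq_zero_of_eventuallyEq_one hy,
      hy.self_of_nhds, Pi.one_apply]
    simp
  rw [e]
  rfl

/-- Two connections agreeing on smooth fields agree. -/
theorem linearConnection_eq_of_forall [T2Space M] {x : M} {W : VectorField I M}
    (hW : DiffVFAt I W x) {X : VectorField I M} (hX : IsSmoothVF I X) (hXW : X x = W x)
    (h : D X x = D' X x) : D W x = D' W x := by
  -- The difference of two connections is a tensor: its value on `W` is its value on any field with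
  -- the same value at `x`.
  have e (Y : VectorField I M) (hY : DiffVFAt I Y x) :=
    D.isCovariantDerivativeOn.difference_apply (s := Set.univ) D'.isCovariantDerivativeOn
      (x := x) (σ := Y) trivial hY
  have h1 := e W hW
  rw [← hXW, e X (hX.diffAt x), h, sub_self] at h1
  exact (sub_eq_zero.1 h1.symm)

end General

/-! ### The induced connection: uniqueness, smoothness, symplecticity, affine fields. -/

section Quadruple

variable {n : ℕ}
  {M : Type*} [TopologicalSpace M] [ChartedSpace (EuclideanSpace ℝ (Fin (2 * n))) M]
  [IsManifold (𝓡 (2 * n)) ∞ M]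
  {N : Type*} [TopologicalSpace N] [ChartedSpace (EuclideanSpace ℝ (Fin (2 * n + 1))) N]
  [IsManifold (𝓡 (2 * n + 1)) ∞ N] [T2Space M] [T2Space N]

namespace ContactQuadruple

variable {Q : ContactQuadruple n M N} {D : LinearConnection (𝓡 (2 * n)) M}
  {s : TwoTensor (𝓡 (2 * n)) M} {U : VectorField (𝓡 (2 * n)) M} {F : M → ℝ}
  {DP DP' : LinearConnection (modelP n) (N × ℝ)}

/-- The formulas and the Leibniz rule fix the connection on combs; every tangent vector is the value
of a comb, and the difference of two connections is a tensor. -/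
theorem IsInduced.eq (h : Q.IsInduced D s U F DP) (h' : Q.IsInduced D s U F DP')
    {W : VectorField (modelP n) (N × ℝ)} {p : N × ℝ} (hW : DiffVFAt (modelP n) W p) :
    DP W p = DP' W p := by
  obtain ⟨X, hX, hXp⟩ := Q.exists_comb_apply_eq p (W p)
  refine linearConnection_eq_of_forall hW
    (Q.isSmoothVF_comb hX contMDiff_const contMDiff_const) hXp.symm ?_
  ext w : 1
  rw [← Q.vec_components p w, h.apply_comb hX contMDiff_const contMDiff_const,
    h'.apply_comb hX contMDiff_const contMDiff_const]

variable {X Y : VectorField (𝓡 (2 * n)) M} {a b f g : M → ℝ}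

theorem IsInduced.nabla_comb (h : Q.IsInduced D s U F DP)
    (hY : IsSmoothVF (𝓡 (2 * n)) Y) (hf : ContMDiff (𝓡 (2 * n)) 𝓘(ℝ, ℝ) ∞ f)
    (hg : ContMDiff (𝓡 (2 * n)) 𝓘(ℝ, ℝ) ∞ g) :
    nabla DP (Q.comb X a b) (Q.comb Y f g) = Q.comb
      (fun x => D Y x (X x) + (2 * a x) • symplEnd (𝓡 (2 * n)) Q.Ω s x (Y x)
        + b x • Y x + (2 * f x) • symplEnd (𝓡 (2 * n)) Q.Ω s x (X x)
        - (2 * a x * f x) • U x + g x • X x)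
      (fun x => mvfderiv (𝓡 (2 * n)) f x (X x) - 1 / 2 * Q.Ω x (X x) (Y x) + f x * b x + g x * a x)
      (fun x => mvfderiv (𝓡 (2 * n)) g x (X x) - s x (X x) (Y x) + a x * Q.Ω x (Y x) (U x)
        + f x * (Q.Ω x (X x) (U x) + a x * F x) + g x * b x) :=
  funext fun _ => h.apply_comb hY hf hg _ _ _ _

/-- Stability of combs under the connection, on which smoothness, affineness of `E` and `∂_s`, and
the argument for local symmetry all rest. -/
theorem IsInduced.exists_nabla_comb_eq (h : Q.IsInduced D s U F DP)
    (hD : D.ContMDiffCovariantDerivative ∞) (hs : IsSmoothTwoTensor (𝓡 (2 * n)) s)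
    (hU : IsSmoothVF (𝓡 (2 * n)) U) (hF : ContMDiff (𝓡 (2 * n)) 𝓘(ℝ, ℝ) ∞ F)
    (hX : IsSmoothVF (𝓡 (2 * n)) X) (ha : ContMDiff (𝓡 (2 * n)) 𝓘(ℝ, ℝ) ∞ a)
    (hb : ContMDiff (𝓡 (2 * n)) 𝓘(ℝ, ℝ) ∞ b)
    (hY : IsSmoothVF (𝓡 (2 * n)) Y) (hf : ContMDiff (𝓡 (2 * n)) 𝓘(ℝ, ℝ) ∞ f)
    (hg : ContMDiff (𝓡 (2 * n)) 𝓘(ℝ, ℝ) ∞ g) :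
    ∃ (Z : VectorField (𝓡 (2 * n)) M) (c d : M → ℝ), IsSmoothVF (𝓡 (2 * n)) Z ∧
      ContMDiff (𝓡 (2 * n)) 𝓘(ℝ, ℝ) ∞ c ∧ ContMDiff (𝓡 (2 * n)) 𝓘(ℝ, ℝ) ∞ d ∧
      nabla DP (Q.comb X a b) (Q.comb Y f g) = Q.comb Z c d := by
  have hσ := hs.symplEnd Q.symplectic
  have hΩ := Q.symplectic.smooth
  have h2 : ContMDiff (𝓡 (2 * n)) 𝓘(ℝ, ℝ) ∞ fun _ : M => (2 : ℝ) := contMDiff_const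
  refine ⟨_, _, _, ?_, ?_, ?_, h.nabla_comb hY hf hg⟩
  · exact ((((((hX.nabla hD hY).add (.smul (h2.mul ha) (hσ.apply hY))).add (.smul hb hY)).add
      (.smul (h2.mul hf) (hσ.apply hX))).sub (.smul ((h2.mul ha).mul hf) hU)).add (.smul hg hX))
  · exact (((contMDiff_mvfderiv_apply hf hX).sub (contMDiff_const.mul (hΩ.apply hX hY))).add
      (hf.mul hb)).add (hg.mul ha)
  · exact ((((contMDiff_mvfderiv_apply hg hX).sub (hs.apply hX hY)).add
      (ha.mul (hΩ.apply hY hU))).add (hf.mul ((hΩ.apply hX hU).add (ha.mul hF)))).add (hg.mul hb)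

theorem IsInduced.contMDiff (h : Q.IsInduced D s U F DP)
    (hD : D.ContMDiffCovariantDerivative ∞) (hs : IsSmoothTwoTensor (𝓡 (2 * n)) s)
    (hU : IsSmoothVF (𝓡 (2 * n)) U) (hF : ContMDiff (𝓡 (2 * n)) 𝓘(ℝ, ℝ) ∞ F) :
    DP.ContMDiffCovariantDerivative ∞ := by
  refine contMDiffCovariantDerivative_of_generators (ι := Fin (2 * n) ⊕ Bool) fun p => ?_
  obtain ⟨χ, G, c, hχ, hχ1, hG, hc, hexp⟩ := Q.exists_cutoff_generators p
  refine ⟨χ, G, c, hχ, hχ1, fun i => ?_, hc, hexp, fun i j => ?_⟩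
  · obtain ⟨X, f, g, hX, hf, hg, e⟩ := hG i
    rw [e]
    exact Q.isSmoothVF_comb hX hf hg
  · obtain ⟨X, a, b, hX, ha, hb, e⟩ := hG i
    obtain ⟨Y, f, g, hY, hf, hg, e'⟩ := hG j
    rw [e, e']
    obtain ⟨Z, c, d, hZ, hc, hd, e⟩ := h.exists_nabla_comb_eq hD hs hU hF hX ha hb hY hf hg
    rw [e]
    exact Q.isSmoothVF_comb hZ hc hd

theorem symplEnd_skew (hss : ∀ x u v, s x u v = s x v u) {x : M}
    (u v : TangentSpace (𝓡 (2 * n)) x) :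
    Q.Ω x (symplEnd (𝓡 (2 * n)) Q.Ω s x u) v = -s x u v := by
  rw [Q.symplectic.swap, Q.symplectic.symplEnd_apply, hss]

/-- On combs the two terms `-½Ω` of the `E`-component match the term `-Ω(X, Y)` of the bracket, and
the `∂_s`-component vanishes by the symmetry of `s`. -/
theorem IsInduced.torsion_eq_zero (h : Q.IsInduced D s U F DP)
    (hD : IsSymplecticConnection (𝓡 (2 * n)) Q.Ω D) (hss : ∀ x u v, s x u v = s x v u) :
    DP.torsion = 0 := by
  funext p
  ext v w : 2
  obtain ⟨X, hX, hv⟩ := Q.exists_comb_apply_eq p v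
  obtain ⟨Y, hY, hw⟩ := Q.exists_comb_apply_eq p w
  have hc (c : ℝ) : ContMDiff (𝓡 (2 * n)) 𝓘(ℝ, ℝ) ∞ fun _ : M => c := contMDiff_const
  have hcX := Q.isSmoothVF_comb hX (hc (Q.αP p v)) (hc (Q.ds p v))
  have hcY := Q.isSmoothVF_comb hY (hc (Q.αP p w)) (hc (Q.ds p w))
  have ht := DP.torsion_apply (hcX.diffAt p) (hcY.diffAt p)
  rw [← hv, ← hw] at ht
  rw [ht]
  have e1 := congrFun (h.nabla_comb (X := X) (a := fun _ => Q.αP p v) (b := fun _ => Q.ds p v)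
    hY (hc (Q.αP p w)) (hc (Q.ds p w))) p
  have e2 := congrFun (h.nabla_comb (X := Y) (a := fun _ => Q.αP p w) (b := fun _ => Q.ds p w)
    hX (hc (Q.αP p v)) (hc (Q.ds p v))) p
  rw [nabla_apply, ← hv] at e1
  rw [nabla_apply, ← hw] at e2
  rw [e1, e2, Q.mlieBracket_comb hX hY (hc _) (hc _) (hc _) (hc _), hD.mlieBracket_eq hX hY]
  simp only [comb, vec_sub, mvfderiv_const]
  refine Eq.trans ?_ (Q.vec_zero p)
  refine Q.vec_congr ?_ ?_ ?_
  · simp only [Pi.sub_apply, nabla_apply]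
    module
  · have := Q.symplectic.swap (Y (Q.proj p)) (X (Q.proj p))
    simp only [zero_apply]
    linarith
  · have := hss _ (Y (Q.proj p)) (X (Q.proj p))
    simp only [zero_apply]
    linarith

/-- On combs with constant coefficients, the derivative `2 e^{2s} ds` of the conformal factor is
balanced because `∇_{∂_s}` fixes each generator. The terms in `σ` and `U` cancel by the skewness of
`Ω` and the symmetry of `s`. -/
theorem IsInduced.parallel (h : Q.IsInduced D s U F DP)
    (hD : IsSymplecticConnection (𝓡 (2 * n)) Q.Ω D) (hss : ∀ x u v, s x u v = s x v u)
    {Y Z : VectorField (modelP n) (N × ℝ)} {p : N × ℝ} (hY : DiffVFAt (modelP n) Y p)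
    (hZ : DiffVFAt (modelP n) Z p) (v : TangentSpace (modelP n) p) :
    mvfderiv (modelP n) (fun y => Q.μ y (Y y) (Z y)) p v =
      Q.μ p (DP Y p v) (Z p) + Q.μ p (Y p) (DP Z p v) := by
  refine parallel_of_generators Q.isSymplecticForm_μ.smooth Q.isSymplecticForm_μ.alternating
    (G := fun W => ∃ (X : VectorField (𝓡 (2 * n)) M) (a b : ℝ), IsSmoothVF (𝓡 (2 * n)) X ∧
      W = Q.comb X (fun _ => a) fun _ => b) ?_ ?_ ?_ hY hZ v
  · rintro _ ⟨X, a, b, hX, rfl⟩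
    exact Q.isSmoothVF_comb hX contMDiff_const contMDiff_const
  · intro w
    obtain ⟨X, hX, e⟩ := Q.exists_comb_apply_eq p w
    exact ⟨_, ⟨X, _, _, hX, rfl⟩, e.symm⟩
  · rintro _ _ ⟨X, a, b, hX, rfl⟩ ⟨Y, f, g, hY, rfl⟩ v
    rw [Q.mvfderiv_μ_comb hX hY, ← Q.vec_components p v]
    rw [h.apply_comb hX contMDiff_const contMDiff_const,
      h.apply_comb hY contMDiff_const contMDiff_const, μ_apply, μ_apply,
      hD.parallel X Y _ (hX.diffAt _) (hY.diffAt _)]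
    simp only [dproj_vec, αP_vec, ds_vec, dproj_comb, αP_comb, ds_comb, mvfderiv_const, map_add,
      map_sub, map_smul, add_apply, sub_apply, smul_apply, smul_eq_mul, symplEnd_skew hss,
      Q.symplectic.symplEnd_apply, zero_apply]
    have e1 := Q.symplectic.swap (U (Q.proj p)) (Y (Q.proj p))
    have e2 := Q.symplectic.swap (Q.dproj p v) (X (Q.proj p))
    have e3 := hss _ (Q.dproj p v) (X (Q.proj p))
    rw [e1, e2, e3]
    ring

theorem IsInduced.isSymplecticConnection (h : Q.IsInduced D s U F DP)
    (hD : IsSymplecticConnection (𝓡 (2 * n)) Q.Ω D) (hs : IsSmoothTwoTensor (𝓡 (2 * n)) s)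
    (hss : ∀ x u v, s x u v = s x v u)
    (hU : IsSmoothVF (𝓡 (2 * n)) U) (hF : ContMDiff (𝓡 (2 * n)) 𝓘(ℝ, ℝ) ∞ F) :
    IsSymplecticConnection (modelP n) Q.μ DP :=
  ⟨h.contMDiff hD.smooth hs hU hF, h.torsion_eq_zero hD hss,
    fun _ _ _ hY hZ v => h.parallel hD hss hY hZ v⟩

/-- `L_V ∇` is a tensor, and on combs each of its three brackets is a bracket of `V` with a comb. -/
theorem IsInduced.isAffineVF (h : Q.IsInduced D s U F DP)
    (hD : D.ContMDiffCovariantDerivative ∞) (hs : IsSmoothTwoTensor (𝓡 (2 * n)) s)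
    (hU : IsSmoothVF (𝓡 (2 * n)) U) (hF : ContMDiff (𝓡 (2 * n)) 𝓘(ℝ, ℝ) ∞ F)
    {V : VectorField (modelP n) (N × ℝ)} (hV : IsSmoothVF (modelP n) V)
    (hV0 : ∀ (X : VectorField (𝓡 (2 * n)) M) (f g : M → ℝ), IsSmoothVF (𝓡 (2 * n)) X →
      ContMDiff (𝓡 (2 * n)) 𝓘(ℝ, ℝ) ∞ f → ContMDiff (𝓡 (2 * n)) 𝓘(ℝ, ℝ) ∞ g →
      mlieBracket (modelP n) V (Q.comb X f g) = 0) :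
    IsAffineVF (modelP n) DP V := by
  have hDP := h.contMDiff hD hs hU hF
  refine ⟨hV, fun X Y hX hY p => ?_⟩
  change lieDerivConnection DP V X Y p = 0
  have hc (c : ℝ) : ContMDiff (𝓡 (2 * n)) 𝓘(ℝ, ℝ) ∞ fun _ : M => c := contMDiff_const
  obtain ⟨X', hX', eX⟩ := Q.exists_comb_apply_eq p (X p)
  obtain ⟨Y', hY', eY⟩ := Q.exists_comb_apply_eq p (Y p)
  have hcX := Q.isSmoothVF_comb hX' (hc (Q.αP p (X p))) (hc (Q.ds p (X p)))
  have hcY := Q.isSmoothVF_comb hY' (hc (Q.αP p (Y p))) (hc (Q.ds p (Y p)))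
  rw [(smoothTensorialAt_lieDerivConnection_left hDP V hY p).pointwise hX hcX eX,
    (smoothTensorialAt_lieDerivConnection_right hDP hV hcX p).pointwise hY hcY eY,
    lieDerivConnection, hV0 _ _ _ hX' (hc _) (hc _), hV0 _ _ _ hY' (hc _) (hc _)]
  have h0 : nabla DP (Q.comb X' (fun _ => Q.αP p (X p)) fun _ => Q.ds p (X p)) 0 = 0 := by
    funext q
    rw [nabla_apply, DP.zero]; rfl
  have h1 (W : VectorField (modelP n) (N × ℝ)) : nabla DP 0 W = 0 := by
    funext q
    rw [nabla_apply, Pi.zero_apply, map_zero]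
  obtain ⟨Z, c, d, hZ, hc', hd', e⟩ :=
    h.exists_nabla_comb_eq hD hs hU hF hX' (hc (Q.αP p (X p))) (hc (Q.ds p (X p))) hY'
      (hc (Q.αP p (Y p))) (hc (Q.ds p (Y p)))
  rw [h0, h1, e, hV0 _ _ _ hZ hc' hd']
  simp

end ContactQuadruple
end Quadruple

/-! ### Existence of the induced connection. -/

section General

variable {E : Type*} [NormedAddCommGroup E] [NormedSpace ℝ E]
  {H : Type*} [TopologicalSpace H] {I : ModelWithCorners ℝ E H}
  {M : Type*} [TopologicalSpace M] [ChartedSpace H M] [IsManifold I ∞ M]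
  {D : LinearConnection I M}

theorem diffVFAt_sum {ι : Type*} {t : Finset ι} {X : ι → VectorField I M} {x : M}
    (h : ∀ i ∈ t, DiffVFAt I (X i) x) : DiffVFAt I (∑ i ∈ t, X i) x := by
  classical
  induction t using Finset.induction_on with
  | empty => exact isSmoothVF_zero.diffAt x
  | insert i t hi ih =>
    rw [Finset.sum_insert hi]
    exact mdifferentiableAt_add_section (h i (Finset.mem_insert_self ..))
      (ih fun j hj => h j (Finset.mem_insert_of_mem hj))

theorem connection_sum {ι : Type*} {t : Finset ι} {c : ι → M → ℝ} {F : ι → VectorField I M} {x : M}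
    (hc : ∀ i, MDifferentiableAt I 𝓘(ℝ, ℝ) (c i) x) (hF : ∀ i, DiffVFAt I (F i) x)
    (v : TangentSpace I x) :
    D (∑ i ∈ t, c i • F i) x v = ∑ i ∈ t, (c i x • D (F i) x v + mvfderiv I (c i) x v • F i x) := by
  classical
  have hd i : DiffVFAt I (c i • F i) x := (hc i).smul_section (hF i)
  induction t using Finset.induction_on with
  | empty => simp [D.zero]
  | insert i t hi ih =>
    rw [Finset.sum_insert hi, Finset.sum_insert hi,
      D.isCovariantDerivativeOn.add (hd i) (diffVFAt_sum fun j _ => hd j),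
      D.isCovariantDerivativeOn.leibniz (hF i) (hc i), add_apply, ih]
    rfl

end General

section Quadruple

variable {n : ℕ}
  {M : Type*} [TopologicalSpace M] [ChartedSpace (EuclideanSpace ℝ (Fin (2 * n))) M]
  [IsManifold (𝓡 (2 * n)) ∞ M]
  {N : Type*} [TopologicalSpace N] [ChartedSpace (EuclideanSpace ℝ (Fin (2 * n + 1))) N]
  [IsManifold (𝓡 (2 * n + 1)) ∞ N] [T2Space M] [T2Space N]

/-- A local frame near `x`. -/
def localBasisField (x : M) (i : Fin (2 * n)) : VectorField (𝓡 (2 * n)) M :=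
  (trivializationAt (EuclideanSpace ℝ (Fin (2 * n)))
    (TangentSpace (𝓡 (2 * n)) : M → Type _) x).localFrame
      (EuclideanSpace.basisFun (Fin (2 * n)) ℝ).toBasis i

/-- The coefficients in the local frame near `x`. -/
def localCoeff (x : M) (i : Fin (2 * n)) (y : M) : TangentSpace (𝓡 (2 * n)) y →ₗ[ℝ] ℝ :=
  (trivializationAt (EuclideanSpace ℝ (Fin (2 * n)))
    (TangentSpace (𝓡 (2 * n)) : M → Type _) x).localFrameCoeff (𝓡 (2 * n))
      (EuclideanSpace.basisFun (Fin (2 * n)) ℝ).toBasis i y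

theorem diffVFAt_localBasisField (x : M) (i : Fin (2 * n)) :
    DiffVFAt (𝓡 (2 * n)) (localBasisField x i) x :=
  (contMDiffAt_localFrame_of_mem 1 _ _ i
    (FiberBundle.mem_baseSet_trivializationAt' x)).mdifferentiableAt (by simp)

theorem mdifferentiableAt_localCoeff {x : M} {Y : VectorField (𝓡 (2 * n)) M}
    (hY : DiffVFAt (𝓡 (2 * n)) Y x) (i : Fin (2 * n)) :
    MDifferentiableAt (𝓡 (2 * n)) 𝓘(ℝ, ℝ) (fun y => localCoeff x i y (Y y)) x :=
  mdifferentiableAt_localFrameCoeff _ (FiberBundle.mem_baseSet_trivializationAt' x) hY i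

theorem eventuallyEq_sum_localCoeff (x : M) (Y : VectorField (𝓡 (2 * n)) M) :
    ∀ᶠ y in 𝓝 x, Y y =
      (∑ i, (fun y => localCoeff x i y (Y y)) • localBasisField x i : VectorField (𝓡 (2 * n)) M) y := by
  filter_upwards [Trivialization.eventually_eq_localFrame_sum_coeff_smul (I := 𝓡 (2 * n))
    (trivializationAt (EuclideanSpace ℝ (Fin (2 * n)))
      (TangentSpace (𝓡 (2 * n)) : M → Type _) x) (EuclideanSpace.basisFun (Fin (2 * n)) ℝ).toBasis
      (s := Y) (FiberBundle.mem_baseSet_trivializationAt' x)] with y hy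
  rw [Finset.sum_apply]
  exact hy

theorem sum_localCoeff (x : M) (v : TangentSpace (𝓡 (2 * n)) x) :
    ∑ i, localCoeff x i x v • localBasisField x i x = v := by
  obtain ⟨Y, -, rfl⟩ := exists_isSmoothVF_apply_eq (I := 𝓡 (2 * n)) x v
  have h := (eventuallyEq_sum_localCoeff x Y).self_of_nhds
  rw [Finset.sum_apply] at h
  exact h.symm

theorem connection_eq_sum {D : LinearConnection (𝓡 (2 * n)) M} {x : M}
    {Y : VectorField (𝓡 (2 * n)) M} (hY : DiffVFAt (𝓡 (2 * n)) Y x)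
    (v : TangentSpace (𝓡 (2 * n)) x) :
    D Y x v = ∑ i, (localCoeff x i x (Y x) • D (localBasisField x i) x v
      + mvfderiv (𝓡 (2 * n)) (fun y => localCoeff x i y (Y y)) x v • localBasisField x i x) := by
  have hc i := mdifferentiableAt_localCoeff hY i
  rw [D.isCovariantDerivativeOn.congr_of_eventuallyEq hY
    (diffVFAt_sum fun i _ => (hc i).smul_section (diffVFAt_localBasisField x i))
    Filter.univ_mem (eventuallyEq_sum_localCoeff x Y),
    connection_sum hc fun i => diffVFAt_localBasisField x i]

namespace ContactQuadruple

variable (Q : ContactQuadruple n M N)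

theorem mdifferentiableAt_localCoeff_dproj {p : N × ℝ} {W : VectorField (modelP n) (N × ℝ)}
    (hW : DiffVFAt (modelP n) W p) (i : Fin (2 * n)) :
    MDifferentiableAt (modelP n) 𝓘(ℝ, ℝ)
      (fun q => localCoeff (Q.proj p) i (Q.proj q) (Q.dproj q (W q))) p :=
  Q.mdifferentiableAt_localFrameCoeff_dproj _ (FiberBundle.mem_baseSet_trivializationAt' _) hW i

/-- The covariant derivative, for the pullback of `∇` by the projection `P → M`, of the section
`p ↦ p_* W`. -/
def pullbackConnection (D : LinearConnection (𝓡 (2 * n)) M) (W : VectorField (modelP n) (N × ℝ))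
    (p : N × ℝ) (w : TangentSpace (modelP n) p) : TangentSpace (𝓡 (2 * n)) (Q.proj p) :=
  ∑ i, (localCoeff (Q.proj p) i (Q.proj p) (Q.dproj p (W p)) •
      D (localBasisField (Q.proj p) i) (Q.proj p) (Q.dproj p w)
    + mvfderiv (modelP n) (fun q => localCoeff (Q.proj p) i (Q.proj q) (Q.dproj q (W q))) p w •
      localBasisField (Q.proj p) i (Q.proj p))

variable {D : LinearConnection (𝓡 (2 * n)) M}

theorem pullbackConnection_add_apply (W : VectorField (modelP n) (N × ℝ)) (p : N × ℝ)
    (w w' : TangentSpace (modelP n) p) : Q.pullbackConnection D W p (w + w') =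
      Q.pullbackConnection D W p w + Q.pullbackConnection D W p w' := by
  simp only [pullbackConnection, map_add, smul_add, add_smul, Finset.sum_add_distrib]
  abel

theorem pullbackConnection_smul_apply (W : VectorField (modelP n) (N × ℝ)) (p : N × ℝ) (r : ℝ)
    (w : TangentSpace (modelP n) p) : Q.pullbackConnection D W p (r • w) =
      r • Q.pullbackConnection D W p w := by
  simp only [pullbackConnection, map_smul, Finset.smul_sum, smul_add, smul_smul, smul_eq_mul,
    mul_comm]

theorem pullbackConnection_add {W W' : VectorField (modelP n) (N × ℝ)} {p : N × ℝ}
    (hW : DiffVFAt (modelP n) W p) (hW' : DiffVFAt (modelP n) W' p) (w : TangentSpace (modelP n) p) :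
    Q.pullbackConnection D (W + W') p w =
      Q.pullbackConnection D W p w + Q.pullbackConnection D W' p w := by
  simp only [pullbackConnection, Pi.add_apply, map_add, ← Finset.sum_add_distrib]
  refine Finset.sum_congr rfl fun i _ => ?_
  have h := mvfderiv_add (Q.mdifferentiableAt_localCoeff_dproj hW i)
    (Q.mdifferentiableAt_localCoeff_dproj hW' i)
  erw [h]
  simp only [add_apply]
  module

theorem pullbackConnection_smul {W : VectorField (modelP n) (N × ℝ)} {f : N × ℝ → ℝ} {p : N × ℝ}
    (hf : MDifferentiableAt (modelP n) 𝓘(ℝ, ℝ) f p)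
    (hW : DiffVFAt (modelP n) W p) (w : TangentSpace (modelP n) p) :
    Q.pullbackConnection D (f • W) p w = f p • Q.pullbackConnection D W p w
      + mvfderiv (modelP n) f p w • Q.dproj p (W p) := by
  conv_rhs => rw [← sum_localCoeff (Q.proj p) (Q.dproj p (W p))]
  simp only [pullbackConnection, Pi.smul_apply', map_smul, Finset.smul_sum,
    ← Finset.sum_add_distrib]
  refine Finset.sum_congr rfl fun i _ => ?_
  have h := mvfderiv_mul hf (Q.mdifferentiableAt_localCoeff_dproj hW i)
  simp only [smul_eq_mul]
  erw [h]
  simp only [add_apply, smul_apply, smul_eq_mul]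
  module

/-- For a field that projects to `Y` the frame coefficients are pulled back from `M`, and the chain
rule gives back `∇Y`. -/
theorem pullbackConnection_comb {Y : VectorField (𝓡 (2 * n)) M} {f g : M → ℝ} {p : N × ℝ}
    (hY : DiffVFAt (𝓡 (2 * n)) Y (Q.proj p)) (w : TangentSpace (modelP n) p) :
    Q.pullbackConnection D (Q.comb Y f g) p w = D Y (Q.proj p) (Q.dproj p w) := by
  rw [connection_eq_sum hY]
  simp only [pullbackConnection, dproj_comb]
  refine Finset.sum_congr rfl fun i _ => ?_
  rw [← Q.mvfderiv_comp_proj (mdifferentiableAt_localCoeff hY i)]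

/-- The values of the induced connection. -/
def inducedFun (D : LinearConnection (𝓡 (2 * n)) M) (s : TwoTensor (𝓡 (2 * n)) M)
    (U : VectorField (𝓡 (2 * n)) M) (F : M → ℝ) (W : VectorField (modelP n) (N × ℝ))
    (p : N × ℝ) : TangentSpace (modelP n) p →L[ℝ] TangentSpace (modelP n) p :=
  LinearMap.toContinuousLinearMap
    -- These are the components of `IsInduced.apply_comb` with `p_*W`, `p₁^*α(W)`, `ds(W)` in place
    -- of `Y`, `f`, `g` and the pullback connection in place of `∇`, so that they make sense for
    -- fields that do not project to `M`.
    { toFun := fun w => Q.vec p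
        (Q.pullbackConnection D W p w
          + (2 * Q.αP p w) • symplEnd (𝓡 (2 * n)) Q.Ω s (Q.proj p) (Q.dproj p (W p))
          + Q.ds p w • Q.dproj p (W p)
          + (2 * Q.αP p (W p)) • symplEnd (𝓡 (2 * n)) Q.Ω s (Q.proj p) (Q.dproj p w)
          - (2 * Q.αP p w * Q.αP p (W p)) • U (Q.proj p) + Q.ds p (W p) • Q.dproj p w)
        (mvfderiv (modelP n) (fun q => Q.αP q (W q)) p w
          - 1 / 2 * Q.Ω (Q.proj p) (Q.dproj p w) (Q.dproj p (W p))
          + Q.αP p (W p) * Q.ds p w + Q.ds p (W p) * Q.αP p w)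
        (mvfderiv (modelP n) (fun q => Q.ds q (W q)) p w
          - s (Q.proj p) (Q.dproj p w) (Q.dproj p (W p))
          + Q.αP p w * Q.Ω (Q.proj p) (Q.dproj p (W p)) (U (Q.proj p))
          + Q.αP p (W p) * (Q.Ω (Q.proj p) (Q.dproj p w) (U (Q.proj p))
            + Q.αP p w * F (Q.proj p))
          + Q.ds p (W p) * Q.ds p w)
      map_add' := fun w w' => by
        rw [vec_add]
        simp only [pullbackConnection_add_apply, map_add, add_apply]
        refine Q.vec_congr ?_ ?_ ?_
        · module
        · ring
        · ring
      map_smul' := fun r w => by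
        rw [RingHom.id_apply, vec_smul]
        simp only [pullbackConnection_smul_apply, map_smul, smul_apply, smul_eq_mul]
        refine Q.vec_congr ?_ ?_ ?_
        · module
        · ring
        · ring }

theorem inducedFun_apply (s : TwoTensor (𝓡 (2 * n)) M)
    (U : VectorField (𝓡 (2 * n)) M) (F : M → ℝ) (W : VectorField (modelP n) (N × ℝ))
    (p : N × ℝ) (w : TangentSpace (modelP n) p) :
    Q.inducedFun D s U F W p w = Q.vec p
        (Q.pullbackConnection D W p w
          + (2 * Q.αP p w) • symplEnd (𝓡 (2 * n)) Q.Ω s (Q.proj p) (Q.dproj p (W p))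
          + Q.ds p w • Q.dproj p (W p)
          + (2 * Q.αP p (W p)) • symplEnd (𝓡 (2 * n)) Q.Ω s (Q.proj p) (Q.dproj p w)
          - (2 * Q.αP p w * Q.αP p (W p)) • U (Q.proj p) + Q.ds p (W p) • Q.dproj p w)
        (mvfderiv (modelP n) (fun q => Q.αP q (W q)) p w
          - 1 / 2 * Q.Ω (Q.proj p) (Q.dproj p w) (Q.dproj p (W p))
          + Q.αP p (W p) * Q.ds p w + Q.ds p (W p) * Q.αP p w)
        (mvfderiv (modelP n) (fun q => Q.ds q (W q)) p w
          - s (Q.proj p) (Q.dproj p w) (Q.dproj p (W p))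
          + Q.αP p w * Q.Ω (Q.proj p) (Q.dproj p (W p)) (U (Q.proj p))
          + Q.αP p (W p) * (Q.Ω (Q.proj p) (Q.dproj p w) (U (Q.proj p))
            + Q.αP p w * F (Q.proj p))
          + Q.ds p (W p) * Q.ds p w) := rfl

theorem mvfderiv_smul_oneForm {β : OneForm (modelP n) (N × ℝ)} (hβ : IsSmoothOneForm (modelP n) β)
    {W : VectorField (modelP n) (N × ℝ)} {f : N × ℝ → ℝ} {p : N × ℝ}
    (hf : MDifferentiableAt (modelP n) 𝓘(ℝ, ℝ) f p) (hW : DiffVFAt (modelP n) W p)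
    (w : TangentSpace (modelP n) p) :
    mvfderiv (modelP n) (fun q => β q ((f • W) q)) p w =
      f p * mvfderiv (modelP n) (fun q => β q (W q)) p w
        + mvfderiv (modelP n) f p w * β p (W p) := by
  have h := mvfderiv_mul hf (hβ.mdifferentiableAt_apply hW)
  simp only [Pi.smul_apply', map_smul, smul_eq_mul]
  erw [h]
  simp only [add_apply, smul_apply, smul_eq_mul]
  ring

theorem mvfderiv_add_oneForm {β : OneForm (modelP n) (N × ℝ)} (hβ : IsSmoothOneForm (modelP n) β)
    {W W' : VectorField (modelP n) (N × ℝ)} {p : N × ℝ}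
    (hW : DiffVFAt (modelP n) W p) (hW' : DiffVFAt (modelP n) W' p)
    (w : TangentSpace (modelP n) p) :
    mvfderiv (modelP n) (fun q => β q ((W + W') q)) p w =
      mvfderiv (modelP n) (fun q => β q (W q)) p w
        + mvfderiv (modelP n) (fun q => β q (W' q)) p w := by
  have h := mvfderiv_add (hβ.mdifferentiableAt_apply hW) (hβ.mdifferentiableAt_apply hW')
  simp only [Pi.add_apply, map_add]
  erw [h]
  simp only [add_apply]

theorem isCovariantDerivativeOn_inducedFun (D : LinearConnection (𝓡 (2 * n)) M)
    (s : TwoTensor (𝓡 (2 * n)) M) (U : VectorField (𝓡 (2 * n)) M) (F : M → ℝ) :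
    IsCovariantDerivativeOn (EuclideanSpace ℝ (Fin (2 * n + 1)) × ℝ) (Q.inducedFun D s U F)
      Set.univ := by
  refine ⟨fun {W W' p} hW hW' _ => ?_, fun {W f p} hW hf _ => ?_⟩
  · ext w : 1
    rw [add_apply, inducedFun_apply, inducedFun_apply, inducedFun_apply, vec_add,
      Q.pullbackConnection_add hW hW', mvfderiv_add_oneForm Q.isSmoothOneForm_αP hW hW',
      mvfderiv_add_oneForm Q.isSmoothOneForm_ds hW hW']
    simp only [Pi.add_apply, map_add, add_apply]
    refine Q.vec_congr ?_ ?_ ?_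
    · module
    · ring
    · ring
  · ext w : 1
    rw [add_apply, smul_apply, ContinuousLinearMap.smulRight_apply, inducedFun_apply,
      inducedFun_apply, Q.pullbackConnection_smul hf hW,
      mvfderiv_smul_oneForm Q.isSmoothOneForm_αP hf hW,
      mvfderiv_smul_oneForm Q.isSmoothOneForm_ds hf hW]
    conv_rhs => enter [2, 2]; rw [← Q.vec_components p (W p)]
    simp only [vec_smul, vec_add, Pi.smul_apply', map_smul, smul_apply, smul_eq_mul]
    refine Q.vec_congr ?_ ?_ ?_
    · module
    · ring
    · ring

/-- The connection induced by `∇`, `ŝ`, `U` and `f`. -/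
def inducedConnection (D : LinearConnection (𝓡 (2 * n)) M)
    (s : TwoTensor (𝓡 (2 * n)) M) (U : VectorField (𝓡 (2 * n)) M) (F : M → ℝ) :
    LinearConnection (modelP n) (N × ℝ) :=
  ⟨Q.inducedFun D s U F, Q.isCovariantDerivativeOn_inducedFun D s U F⟩

theorem inducedConnection_comb (D : LinearConnection (𝓡 (2 * n)) M)
    (s : TwoTensor (𝓡 (2 * n)) M) (U : VectorField (𝓡 (2 * n)) M) (F : M → ℝ)
    {Y : VectorField (𝓡 (2 * n)) M} (hY : IsSmoothVF (𝓡 (2 * n)) Y) (f g : ℝ) (p : N × ℝ)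
    (v : TangentSpace (𝓡 (2 * n)) (Q.proj p)) (a c : ℝ) :
    Q.inducedConnection D s U F (Q.comb Y (fun _ => f) fun _ => g) p (Q.vec p v a c) = Q.vec p
      (D Y (Q.proj p) v + (2 * a) • symplEnd (𝓡 (2 * n)) Q.Ω s (Q.proj p) (Y (Q.proj p))
        + c • Y (Q.proj p) + (2 * f) • symplEnd (𝓡 (2 * n)) Q.Ω s (Q.proj p) v
        - (2 * a * f) • U (Q.proj p) + g • v)
      (-(1 / 2 * Q.Ω (Q.proj p) v (Y (Q.proj p))) + f * c + g * a)
      (- s (Q.proj p) v (Y (Q.proj p)) + a * Q.Ω (Q.proj p) (Y (Q.proj p)) (U (Q.proj p))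
        + f * (Q.Ω (Q.proj p) v (U (Q.proj p)) + a * F (Q.proj p)) + g * c) := by
  refine (Q.inducedFun_apply s U F _ p _).trans ?_
  rw [Q.pullbackConnection_comb (hY.diffAt _)]
  simp only [dproj_comb, αP_comb, ds_comb, dproj_vec, αP_vec, ds_vec, mvfderiv_const, zero_apply]
  refine Q.vec_congr rfl ?_ ?_
  · ring
  · ring

theorem isInduced_inducedConnection (D : LinearConnection (𝓡 (2 * n)) M)
    (s : TwoTensor (𝓡 (2 * n)) M) (U : VectorField (𝓡 (2 * n)) M) (F : M → ℝ) :
    Q.IsInduced D s U F (Q.inducedConnection D s U F) := by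
  have h {Y : VectorField (𝓡 (2 * n)) M} (hY : IsSmoothVF (𝓡 (2 * n)) Y) (p : N × ℝ) :=
    Q.inducedConnection_comb D s U F hY 0 0 p
  have hE (p : N × ℝ) := Q.inducedConnection_comb D s U F isSmoothVF_zero 1 0 p
  have hS (p : N × ℝ) := Q.inducedConnection_comb D s U F isSmoothVF_zero 0 1 p
  have eL (Y : VectorField (𝓡 (2 * n)) M) :
    Q.comb Y (fun _ => 0) (fun _ => 0) = Q.lift Y := (Q.lift_eq_comb Y).symm
  have eE : Q.comb 0 (fun _ => 1) (fun _ => 0) = Q.E := Q.E_eq_comb.symm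
  have eS : Q.comb 0 (fun _ => 0) (fun _ => 1) = Q.S := Q.S_eq_comb.symm
  have l (X : VectorField (𝓡 (2 * n)) M) (p : N × ℝ) :
    Q.lift X p = Q.vec p (X (Q.proj p)) 0 0 := Q.hlift_eq_vec ..
  simp only [eL] at h
  rw [eE] at hE
  rw [eS] at hS
  refine ⟨fun X Y hX hY p => ?_, fun X hX p => ?_, fun X hX p => ?_, fun X hX p => ?_,
    fun X hX p => ?_, fun p => ?_, fun p => ?_, fun p => ?_, fun p => ?_⟩
  all_goals
    simp only [l, E_eq_vec, S_eq_vec, vec_smul, vec_add, vec_sub]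
    first | rw [h hX] | rw [h ‹_›] | rw [hE] | rw [hS]
    refine Q.vec_congr ?_ ?_ ?_
  all_goals simp

end ContactQuadruple
end Quadruple

/-! ### Covariant derivatives of endomorphism fields; admissibility of the special choices. -/

section General

variable {E : Type*} [NormedAddCommGroup E] [NormedSpace ℝ E] [FiniteDimensional ℝ E]
  {H : Type*} [TopologicalSpace H] {I : ModelWithCorners ℝ E H}
  {M : Type*} [TopologicalSpace M] [ChartedSpace H M] [IsManifold I ∞ M]
  [T2Space M] [I.Boundaryless]
  {D : LinearConnection I M} {σ : EndField I M}

/-- The covariant derivative of an endomorphism field: `covDerivEnd D hσ x Y v = (∇_v σ)Y`. -/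
def covDerivEnd (D : LinearConnection I M) (hσ : IsSmoothEnd σ) (x : M) :
    TangentSpace I x →L[ℝ] TangentSpace I x →L[ℝ] TangentSpace I x :=
  TensorialAt.mkHom _ x (tensorialAt_covDerivEnd (D := D) hσ x)

theorem covDerivEnd_apply (hσ : IsSmoothEnd σ) {x : M} {Y : VectorField I M} (hY : DiffVFAt I Y x) :
    covDerivEnd D hσ x (Y x) = D (fun y => σ y (Y y)) x - (σ x).comp (D Y x) :=
  TensorialAt.mkHom_apply _ hY

theorem traceCovDeriv_apply (hσ : IsSmoothEnd σ) (x : M) (u : TangentSpace I x) :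
    traceCovDeriv I D σ x u =
      LinearMap.trace ℝ (TangentSpace I x) (covDerivEnd D hσ x u).toLinearMap := by
  let L : TangentSpace I x →ₗ[ℝ] ℝ := (LinearMap.trace ℝ (TangentSpace I x)).comp
    ((ContinuousLinearMap.coeLM ℝ).comp (covDerivEnd D hσ x).toLinearMap)
  have h : traceCovDeriv I D σ x = LinearMap.toContinuousLinearMap L := by
    refine clm_ext_tangentBasis fun i => ?_
    rw [traceCovDeriv, ofComponents_tangentBasis, ← covDerivEnd_apply hσ (diffVFAt_frame x i),
      frame_self]
    rfl
  rw [h]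
  rfl

theorem isSmoothOneForm_traceCovDeriv (hD : D.ContMDiffCovariantDerivative ∞)
    (hσ : IsSmoothEnd σ) : IsSmoothOneForm I (traceCovDeriv I D σ) := by
  refine isSmoothOneForm_of_forall fun Z hZ => ?_
  simp only [traceCovDeriv_apply hσ]
  refine contMDiff_trace fun X hX => ?_
  have e : (fun x => covDerivEnd D hσ x (Z x) (X x)) =
      nabla D X (fun x => σ x (Z x)) - fun x => σ x (nabla D X Z x) := by
    funext x
    rw [covDerivEnd_apply hσ (hZ.diffAt x)]
    rfl
  exact e ▸ (hX.nabla hD (hσ.apply hZ)).sub (hσ.apply (hX.nabla hD hZ))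

end General

section Quadruple

variable {n : ℕ}
  {M : Type*} [TopologicalSpace M] [ChartedSpace (EuclideanSpace ℝ (Fin (2 * n))) M]
  [IsManifold (𝓡 (2 * n)) ∞ M]
  {N : Type*} [TopologicalSpace N] [ChartedSpace (EuclideanSpace ℝ (Fin (2 * n + 1))) N]
  [IsManifold (𝓡 (2 * n + 1)) ∞ N] [T2Space M]

namespace ContactQuadruple

variable (Q : ContactQuadruple n M N) {D : LinearConnection (𝓡 (2 * n)) M}

theorem isSmoothTwoTensor_specialS (hD : D.ContMDiffCovariantDerivative ∞) :
    IsSmoothTwoTensor (𝓡 (2 * n)) (Q.specialS D) :=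
  isSmoothTwoTensor_of_forall fun _ _ hX hY =>
    contMDiff_const.mul ((isSmoothTwoTensor_ricci hD).apply hX hY)

theorem specialS_symm (hD : IsSymplecticConnection (𝓡 (2 * n)) Q.Ω D) (x : M)
    (u v : TangentSpace (𝓡 (2 * n)) x) : Q.specialS D x u v = Q.specialS D x v u :=
  congrArg (_ * ·) (hD.ricci_symm Q.symplectic x u v)

theorem isSmoothEnd_special (hD : D.ContMDiffCovariantDerivative ∞) :
    IsSmoothEnd (symplEnd (𝓡 (2 * n)) Q.Ω (Q.specialS D)) :=
  (Q.isSmoothTwoTensor_specialS hD).symplEnd Q.symplectic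

theorem specialU_apply (hD : D.ContMDiffCovariantDerivative ∞) (x : M)
    (u : TangentSpace (𝓡 (2 * n)) x) : Q.Ω x (Q.specialU D x) u = 2 / (2 * (n : ℝ) + 1) *
      LinearMap.trace ℝ (TangentSpace (𝓡 (2 * n)) x)
        (covDerivEnd D (Q.isSmoothEnd_special hD) x u).toLinearMap := by
  rw [specialU, Q.symplectic.symplSharp_apply, ← traceCovDeriv_apply]
  rfl

theorem isSmoothVF_specialU (hD : D.ContMDiffCovariantDerivative ∞) :
    IsSmoothVF (𝓡 (2 * n)) (Q.specialU D) := by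
  refine IsSmoothOneForm.symplSharp (isSmoothOneForm_of_forall fun X hX => ?_) Q.symplectic
  exact contMDiff_const.mul
    ((isSmoothOneForm_traceCovDeriv hD (Q.isSmoothEnd_special hD)).apply hX)

theorem contMDiff_specialF (hD : D.ContMDiffCovariantDerivative ∞) :
    ContMDiff (𝓡 (2 * n)) 𝓘(ℝ, ℝ) ∞ (Q.specialF D) := by
  have hρ : IsSmoothEnd (ricciEnd (𝓡 (2 * n)) Q.Ω D) :=
    (isSmoothTwoTensor_ricci hD).symplEnd Q.symplectic
  refine (contMDiff_const.mul (contMDiff_trace fun X hX => ?_)).add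
    (contMDiff_const.mul (contMDiff_trace fun X hX => ?_))
  · exact hρ.apply (hρ.apply hX)
  · exact hX.nabla hD (Q.isSmoothVF_specialU hD)

theorem symplEnd_specialS (x : M) (u : TangentSpace (𝓡 (2 * n)) x) :
    symplEnd (𝓡 (2 * n)) Q.Ω (Q.specialS D) x u =
      (-1 / (2 * ((n : ℝ) + 1))) • ricciEnd (𝓡 (2 * n)) Q.Ω D x u := by
  refine Q.symplectic.eq_of_forall fun z => ?_
  rw [map_smul, Q.symplectic.symplEnd_apply, ricciEnd, Q.symplectic.symplEnd_apply]
  rfl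

end ContactQuadruple
end Quadruple

/-! ### Curvature of the induced connection on generators. -/

section Quadruple

variable {n : ℕ}
  {M : Type*} [TopologicalSpace M] [ChartedSpace (EuclideanSpace ℝ (Fin (2 * n))) M]
  [IsManifold (𝓡 (2 * n)) ∞ M]
  {N : Type*} [TopologicalSpace N] [ChartedSpace (EuclideanSpace ℝ (Fin (2 * n + 1))) N]
  [IsManifold (𝓡 (2 * n + 1)) ∞ N] [T2Space M]

namespace ContactQuadruple

variable (Q : ContactQuadruple n M N) (D : LinearConnection (𝓡 (2 * n)) M)
  {s : TwoTensor (𝓡 (2 * n)) M} (hs : IsSmoothTwoTensor (𝓡 (2 * n)) s)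
  (U : VectorField (𝓡 (2 * n)) M) (F : M → ℝ)

theorem contMDiff_zero_fun : ContMDiff (𝓡 (2 * n)) 𝓘(ℝ, ℝ) ∞ (0 : M → ℝ) := contMDiff_const

theorem contMDiff_cmul (c : ℝ) {g : M → ℝ} (hg : ContMDiff (𝓡 (2 * n)) 𝓘(ℝ, ℝ) ∞ g) :
    ContMDiff (𝓡 (2 * n)) 𝓘(ℝ, ℝ) ∞ fun x => c * g x := contMDiff_const.mul hg

theorem nabla_const_smul_right {D : LinearConnection (𝓡 (2 * n)) M}
    (X : VectorField (𝓡 (2 * n)) M) (c : ℝ) {Y : VectorField (𝓡 (2 * n)) M}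
    (hY : IsSmoothVF (𝓡 (2 * n)) Y) : nabla D X (c • Y) = c • nabla D X Y := by
  funext x
  rw [nabla_apply, D.isCovariantDerivativeOn.smul_const c (hY.diffAt x)]
  rfl

/-! ### The tensors on `M` describing the curvature of the induced connection -/

/-- The tensor `(X, Y) ↦ (∇_X σ)Y + ½ Ω(Y, U) X - ½ Ω(X, Y) U`. -/
def tensorB (x : M) : TangentSpace (𝓡 (2 * n)) x →ₗ[ℝ] TangentSpace (𝓡 (2 * n)) x →ₗ[ℝ]
    TangentSpace (𝓡 (2 * n)) x :=
  LinearMap.mk₂ ℝ (fun u v => covDerivEnd D (hs.symplEnd Q.symplectic) x v u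
      + (1 / 2 * Q.Ω x v (U x)) • u - (1 / 2 * Q.Ω x u v) • U x)
    (fun u u' v => by simp only [map_add, add_apply]; module)
    (fun c u v => by simp only [map_smul, smul_apply, smul_eq_mul]; module)
    (fun u v v' => by simp only [map_add, add_apply]; module)
    (fun c u v => by simp only [map_smul, smul_apply, smul_eq_mul]; module)

theorem tensorB_apply (x : M) (u v : TangentSpace (𝓡 (2 * n)) x) :
    Q.tensorB D hs U x u v = covDerivEnd D (hs.symplEnd Q.symplectic) x v u
      + (1 / 2 * Q.Ω x v (U x)) • u - (1 / 2 * Q.Ω x u v) • U x := rfl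

/-- The endomorphism `X ↦ ∇_X U + 2σ²X - ½ f X`. -/
def tensorA (s : TwoTensor (𝓡 (2 * n)) M) (x : M) :
    TangentSpace (𝓡 (2 * n)) x →ₗ[ℝ] TangentSpace (𝓡 (2 * n)) x :=
  (D U x).toLinearMap + (2 : ℝ) • ((symplEnd (𝓡 (2 * n)) Q.Ω s x).comp
    (symplEnd (𝓡 (2 * n)) Q.Ω s x)).toLinearMap - (1 / 2 * F x) • LinearMap.id

theorem tensorA_apply (s : TwoTensor (𝓡 (2 * n)) M) (x : M) (u : TangentSpace (𝓡 (2 * n)) x) :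
    Q.tensorA D U F s x u = D U x u + (2 : ℝ) • symplEnd (𝓡 (2 * n)) Q.Ω s x
      (symplEnd (𝓡 (2 * n)) Q.Ω s x u) - (1 / 2 * F x) • u := rfl

/-- The 1-form `df + 4 ŝ(·, U)`. -/
def formB (s : TwoTensor (𝓡 (2 * n)) M) (x : M) (u : TangentSpace (𝓡 (2 * n)) x) : ℝ :=
  mvfderiv (𝓡 (2 * n)) F x u + 4 * s x u (U x)

/-- The horizontal component of the curvature on horizontal vectors. -/
def tensorH (s : TwoTensor (𝓡 (2 * n)) M) (x : M) (u v w : TangentSpace (𝓡 (2 * n)) x) :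
    TangentSpace (𝓡 (2 * n)) x :=
  curvature (𝓡 (2 * n)) D x u v w - Q.Ω x v w • symplEnd (𝓡 (2 * n)) Q.Ω s x u
    + Q.Ω x u w • symplEnd (𝓡 (2 * n)) Q.Ω s x v - s x v w • u + s x u w • v
    + (2 * Q.Ω x u v) • symplEnd (𝓡 (2 * n)) Q.Ω s x w

/-- The component along `∂_s` of the curvature on horizontal vectors. -/
def tensorC (x : M) (u v w : TangentSpace (𝓡 (2 * n)) x) : ℝ :=
  Q.Ω x u (Q.tensorB D hs U x v w) - Q.Ω x v (Q.tensorB D hs U x u w)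

variable {Q D U F} {DP : LinearConnection (modelP n) (N × ℝ)} {X Y Z : VectorField (𝓡 (2 * n)) M}

theorem isSmoothVF_tensorB (hD : D.ContMDiffCovariantDerivative ∞)
    (hU : IsSmoothVF (𝓡 (2 * n)) U)
    (hX : IsSmoothVF (𝓡 (2 * n)) X) (hY : IsSmoothVF (𝓡 (2 * n)) Y) :
    IsSmoothVF (𝓡 (2 * n)) fun x => Q.tensorB D hs U x (X x) (Y x) := by
  have hσ := hs.symplEnd Q.symplectic
  have hΩ := Q.symplectic.smooth
  have e : (fun x => Q.tensorB D hs U x (X x) (Y x)) =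
      nabla D X (fun x => symplEnd (𝓡 (2 * n)) Q.Ω s x (Y x))
        - (fun x => symplEnd (𝓡 (2 * n)) Q.Ω s x (nabla D X Y x))
        + (fun x => 1 / 2 * Q.Ω x (Y x) (U x)) • X - (fun x => 1 / 2 * Q.Ω x (X x) (Y x)) • U := by
    funext x
    rw [tensorB_apply, covDerivEnd_apply hσ (hY.diffAt x)]
    rfl
  rw [e]
  exact ((((hX.nabla hD (hσ.apply hY)).sub (hσ.apply (hX.nabla hD hY))).add
    (.smul (contMDiff_const.mul (hΩ.apply hY hU)) hX)).sub
    (.smul (contMDiff_const.mul (hΩ.apply hX hY)) hU))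

theorem isSmoothVF_tensorA (hs : IsSmoothTwoTensor (𝓡 (2 * n)) s)
    (hD : D.ContMDiffCovariantDerivative ∞)
    (hU : IsSmoothVF (𝓡 (2 * n)) U) (hF : ContMDiff (𝓡 (2 * n)) 𝓘(ℝ, ℝ) ∞ F)
    (hX : IsSmoothVF (𝓡 (2 * n)) X) :
    IsSmoothVF (𝓡 (2 * n)) fun x => Q.tensorA D U F s x (X x) := by
  have hσ := hs.symplEnd Q.symplectic
  exact ((hX.nabla hD hU).add (.const_smul 2 (hσ.apply (hσ.apply hX)))).sub
    (.smul (contMDiff_const.mul hF) hX)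

theorem contMDiff_tensorC (hD : D.ContMDiffCovariantDerivative ∞)
    (hU : IsSmoothVF (𝓡 (2 * n)) U) (hX : IsSmoothVF (𝓡 (2 * n)) X)
    (hY : IsSmoothVF (𝓡 (2 * n)) Y) (hZ : IsSmoothVF (𝓡 (2 * n)) Z) :
    ContMDiff (𝓡 (2 * n)) 𝓘(ℝ, ℝ) ∞ fun x => Q.tensorC D hs U x (X x) (Y x) (Z x) :=
  (Q.symplectic.smooth.apply hX (isSmoothVF_tensorB hs hD hU hY hZ)).sub
    (Q.symplectic.smooth.apply hY (isSmoothVF_tensorB hs hD hU hX hZ))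

theorem contMDiff_formB (hs : IsSmoothTwoTensor (𝓡 (2 * n)) s)
    (hU : IsSmoothVF (𝓡 (2 * n)) U) (hF : ContMDiff (𝓡 (2 * n)) 𝓘(ℝ, ℝ) ∞ F)
    (hX : IsSmoothVF (𝓡 (2 * n)) X) :
    ContMDiff (𝓡 (2 * n)) 𝓘(ℝ, ℝ) ∞ fun x => formB U F s x (X x) :=
  (contMDiff_mvfderiv_apply hF hX).add (contMDiff_const.mul (hs.apply hX hU))

/-! ### Curvature of the induced connection on generators -/

variable [T2Space N]

theorem mvfderiv_const_mul {c : ℝ} {g : M → ℝ} (hg : ContMDiff (𝓡 (2 * n)) 𝓘(ℝ, ℝ) ∞ g) (x : M)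
    (v : TangentSpace (𝓡 (2 * n)) x) :
    mvfderiv (𝓡 (2 * n)) (fun y => c * g y) x v = c * mvfderiv (𝓡 (2 * n)) g x v := by
  have h := mvfderiv_mul (mdifferentiableAt_const (I := 𝓡 (2 * n)) (c := c))
    (hg.mdifferentiable (by simp) x)
  refine (congrArg (fun L => L v) h).trans ?_
  rw [mvfderiv_const]
  simp

/-- Writing `s(Y, Z) = Ω(Y, σZ)` with `Ω` parallel makes the covariant derivative of `s` that of
`σ`, paired by `Ω`. -/
theorem mvfderiv_symmTensor (hD : IsSymplecticConnection (𝓡 (2 * n)) Q.Ω D)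
    (hY : IsSmoothVF (𝓡 (2 * n)) Y) (hZ : IsSmoothVF (𝓡 (2 * n)) Z) (x : M) :
    mvfderiv (𝓡 (2 * n)) (fun y => s y (Y y) (Z y)) x (X x) =
      s x (nabla D X Y x) (Z x) + s x (Y x) (nabla D X Z x)
        + Q.Ω x (Y x) (covDerivEnd D (hs.symplEnd Q.symplectic) x (Z x) (X x)) := by
  have hσ := hs.symplEnd Q.symplectic
  have h := hD.mvfderiv_apply hY (hσ.apply hZ) X x
  simp only [Q.symplectic.symplEnd_apply] at h
  rw [h, covDerivEnd_apply hσ (hZ.diffAt x)]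
  simp only [sub_apply, ContinuousLinearMap.comp_apply, map_sub, Q.symplectic.symplEnd_apply,
    nabla_apply]
  ring

variable {f g : M → ℝ}

theorem IsInduced.nabla_lift_comb (h : Q.IsInduced D s U F DP)
    (hY : IsSmoothVF (𝓡 (2 * n)) Y) (hf : ContMDiff (𝓡 (2 * n)) 𝓘(ℝ, ℝ) ∞ f)
    (hg : ContMDiff (𝓡 (2 * n)) 𝓘(ℝ, ℝ) ∞ g) :
    nabla DP (Q.lift X) (Q.comb Y f g) = Q.comb
      (nabla D X Y + ((2 : ℝ) • f) • (fun x => symplEnd (𝓡 (2 * n)) Q.Ω s x (X x)) + g • X)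
      (fun x => mvfderiv (𝓡 (2 * n)) f x (X x) - 1 / 2 * Q.Ω x (X x) (Y x))
      (fun x => mvfderiv (𝓡 (2 * n)) g x (X x) - s x (X x) (Y x) + f x * Q.Ω x (X x) (U x)) := by
  rw [lift_eq_comb, h.nabla_comb hY hf hg]
  funext p
  refine Q.vec_congr ?_ ?_ ?_ <;> simp [nabla_apply, mul_smul]

theorem IsInduced.nabla_E_comb (h : Q.IsInduced D s U F DP)
    (hY : IsSmoothVF (𝓡 (2 * n)) Y) (hf : ContMDiff (𝓡 (2 * n)) 𝓘(ℝ, ℝ) ∞ f)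
    (hg : ContMDiff (𝓡 (2 * n)) 𝓘(ℝ, ℝ) ∞ g) :
    nabla DP Q.E (Q.comb Y f g) = Q.comb
      ((2 : ℝ) • (fun x => symplEnd (𝓡 (2 * n)) Q.Ω s x (Y x)) - ((2 : ℝ) • f) • U) g
      (fun x => Q.Ω x (Y x) (U x) + f x * F x) := by
  rw [E_eq_comb, h.nabla_comb hY hf hg]
  funext p
  refine Q.vec_congr ?_ ?_ ?_ <;> simp [mul_smul]

theorem IsInduced.nabla_S_comb (h : Q.IsInduced D s U F DP)
    (hY : IsSmoothVF (𝓡 (2 * n)) Y) (hf : ContMDiff (𝓡 (2 * n)) 𝓘(ℝ, ℝ) ∞ f)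
    (hg : ContMDiff (𝓡 (2 * n)) 𝓘(ℝ, ℝ) ∞ g) :
    nabla DP Q.S (Q.comb Y f g) = Q.comb Y f g := by
  rw [S_eq_comb, h.nabla_comb hY hf hg]
  funext p
  refine Q.vec_congr ?_ ?_ ?_ <;> simp

/-- The field `∂_s` behaves as the radial field of a flat space, and several later arguments exploit
this: it removes `∂_s` from the curvature and makes the Bianchi identities algebraic. -/
theorem IsInduced.nabla_right_S (h : Q.IsInduced D s U F DP)
    (W : VectorField (modelP n) (N × ℝ)) : nabla DP W Q.S = W := by
  funext p
  rw [nabla_apply, ← Q.vec_components p (W p), h.apply_S]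

theorem IsInduced.nabla_lift_lift (h : Q.IsInduced D s U F DP) (hY : IsSmoothVF (𝓡 (2 * n)) Y) :
    nabla DP (Q.lift X) (Q.lift Y) = Q.comb (nabla D X Y) (fun x => -1 / 2 * Q.Ω x (X x) (Y x))
      fun x => -1 * s x (X x) (Y x) := by
  rw [Q.lift_eq_comb Y, h.nabla_lift_comb hY contMDiff_zero_fun contMDiff_zero_fun]
  funext p
  have h0 : mvfderiv (𝓡 (2 * n)) (0 : M → ℝ) = 0 := funext fun _ => mvfderiv_const 0
  refine Q.vec_congr ?_ ?_ ?_
  · simp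
  · simp only [h0, Pi.zero_apply, zero_apply]; ring
  · simp only [h0, Pi.zero_apply, zero_apply]; ring

theorem IsInduced.nabla_E_lift (h : Q.IsInduced D s U F DP) (hY : IsSmoothVF (𝓡 (2 * n)) Y) :
    nabla DP Q.E (Q.lift Y) = Q.comb ((2 : ℝ) • fun x => symplEnd (𝓡 (2 * n)) Q.Ω s x (Y x)) 0
      (fun x => Q.Ω x (Y x) (U x)) := by
  rw [Q.lift_eq_comb Y, h.nabla_E_comb hY contMDiff_zero_fun contMDiff_zero_fun]
  funext p
  refine Q.vec_congr ?_ ?_ ?_ <;> simp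

theorem IsInduced.nabla_lift_E (h : Q.IsInduced D s U F DP) :
    nabla DP (Q.lift X) Q.E = Q.comb ((2 : ℝ) • fun x => symplEnd (𝓡 (2 * n)) Q.Ω s x (X x)) 0
      (fun x => Q.Ω x (X x) (U x)) := by
  funext p
  rw [nabla_apply, Q.lift_eq_comb X, comb, h.apply_E]
  refine Q.vec_congr ?_ ?_ ?_ <;> simp

theorem IsInduced.nabla_E_E (h : Q.IsInduced D s U F DP) :
    nabla DP Q.E Q.E = Q.comb ((-2 : ℝ) • U) 0 F := by
  funext p
  rw [nabla_apply, Q.E_eq_vec, h.apply_E]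
  refine Q.vec_congr ?_ ?_ ?_ <;> simp

theorem mlieBracket_lift (hX : IsSmoothVF (𝓡 (2 * n)) X) (hY : IsSmoothVF (𝓡 (2 * n)) Y) :
    mlieBracket (modelP n) (Q.lift X) (Q.lift Y) =
      Q.comb (mlieBracket (𝓡 (2 * n)) X Y) (fun x => -1 * Q.Ω x (X x) (Y x)) 0 := by
  rw [Q.lift_eq_comb, Q.lift_eq_comb, Q.mlieBracket_comb hX hY contMDiff_zero_fun contMDiff_zero_fun
    contMDiff_zero_fun contMDiff_zero_fun]
  funext p
  have h0 : mvfderiv (𝓡 (2 * n)) (0 : M → ℝ) = 0 := funext fun _ => mvfderiv_const 0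
  refine Q.vec_congr rfl ?_ ?_ <;> simp

/-- The bracket contributes `-Ω(X, Y) E`, hence the term `2Ω(X, Y) σZ`; the `E`- and `∂_s`-terms of
`∇_Ȳ Z̄` give the other corrections to `R`. The `E`-component cancels as `Ω` is parallel and `∇`
torsion-free; the `∂_s`-component collects `∇σ` and `U`. -/
theorem IsInduced.curvOp_lift_lift_lift (h : Q.IsInduced D s U F DP)
    (hD : IsSymplecticConnection (𝓡 (2 * n)) Q.Ω D)
    (hX : IsSmoothVF (𝓡 (2 * n)) X) (hY : IsSmoothVF (𝓡 (2 * n)) Y)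
    (hZ : IsSmoothVF (𝓡 (2 * n)) Z) :
    curvOp (modelP n) DP (Q.lift X) (Q.lift Y) (Q.lift Z) = Q.comb
      (fun x => tensorH Q D s x (X x) (Y x) (Z x)) 0
      (fun x => tensorC Q D hs U x (X x) (Y x) (Z x)) := by
  have hΩ := Q.symplectic.smooth
  have e (A B : VectorField (𝓡 (2 * n)) M) (hA : IsSmoothVF (𝓡 (2 * n)) A)
      (hB : IsSmoothVF (𝓡 (2 * n)) B) := h.nabla_lift_comb (X := A) (hB.nabla hD.smooth hZ)
    (contMDiff_cmul (-1 / 2) (hΩ.apply hB hZ))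
    (contMDiff_cmul (-1) (hs.apply hB hZ))
  rw [curvOp_eq, mlieBracket_lift hX hY, h.nabla_lift_lift hZ, h.nabla_lift_lift hZ, e X Y hX hY,
    e Y X hY hX, Q.lift_eq_comb, h.nabla_comb hZ contMDiff_zero_fun contMDiff_zero_fun]
  funext p
  simp only [Pi.sub_apply, comb, vec_sub]
  have h0 : mvfderiv (𝓡 (2 * n)) (0 : M → ℝ) = 0 := funext fun _ => mvfderiv_const 0
  have m1 := mvfderiv_const_mul (c := -1 / 2) (hΩ.apply hY hZ) (Q.proj p) (X (Q.proj p))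
  have m2 := mvfderiv_const_mul (c := -1 / 2) (hΩ.apply hX hZ) (Q.proj p) (Y (Q.proj p))
  have m3 := mvfderiv_const_mul (c := -1) (hs.apply hY hZ) (Q.proj p) (X (Q.proj p))
  have m4 := mvfderiv_const_mul (c := -1) (hs.apply hX hZ) (Q.proj p) (Y (Q.proj p))
  rw [hD.mvfderiv_apply hY hZ X] at m1
  rw [hD.mvfderiv_apply hX hZ Y] at m2
  rw [mvfderiv_symmTensor hs hD hY hZ] at m3
  rw [mvfderiv_symmTensor hs hD hX hZ] at m4
  rw [hD.mlieBracket_eq hX hY, h0]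
  refine Q.vec_congr ?_ ?_ ?_
  · rw [tensorH, curvature_apply hD.smooth hX hY hZ, curvOp_eq, hD.mlieBracket_eq hX hY]
    simp only [Pi.sub_apply, Pi.add_apply, Pi.smul_apply', Pi.smul_apply, nabla_apply, map_sub,
      Pi.zero_apply, smul_eq_mul]
    module
  · rw [m1, m2]
    simp only [Pi.sub_apply, Pi.zero_apply, zero_apply, map_sub, sub_apply]
    ring
  · rw [m3, m4, tensorC, tensorB_apply, tensorB_apply]
    have e1 := Q.symplectic.swap (Y (Q.proj p)) (X (Q.proj p))
    simp only [Pi.sub_apply, Pi.zero_apply, zero_apply, map_sub, map_add, map_smul, sub_apply,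
      smul_eq_mul, e1]
    ring

theorem IsInduced.curvOp_lift_E_lift (h : Q.IsInduced D s U F DP)
    (hD : IsSymplecticConnection (𝓡 (2 * n)) Q.Ω D) (hss : ∀ x u v, s x u v = s x v u)
    (hU : IsSmoothVF (𝓡 (2 * n)) U)
    (hX : IsSmoothVF (𝓡 (2 * n)) X) (hY : IsSmoothVF (𝓡 (2 * n)) Y) :
    curvOp (modelP n) DP (Q.lift X) Q.E (Q.lift Y) = Q.comb
      (fun x => (2 : ℝ) • tensorB Q D hs U x (X x) (Y x)) 0
      (fun x => Q.Ω x (Y x) (tensorA Q D U F s x (X x))) := by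
  have hΩ := Q.symplectic.smooth
  have hσ := hs.symplEnd Q.symplectic
  have hb : mlieBracket (modelP n) (Q.lift X) Q.E = 0 := by
    rw [mlieBracket_swap, Q.lift_eq_comb, Q.mlieBracket_E_comb hX contMDiff_zero_fun contMDiff_zero_fun,
      neg_zero]
  rw [curvOp_eq, hb, h.nabla_E_lift hY, h.nabla_lift_lift hY,
    h.nabla_lift_comb (.const_smul 2 (hσ.apply hY)) contMDiff_zero_fun (hΩ.apply hY hU),
    h.nabla_E_comb (hX.nabla hD.smooth hY) (contMDiff_cmul _ (hΩ.apply hX hY))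
      (contMDiff_cmul _ (hs.apply hX hY))]
  have hn : nabla DP 0 (Q.lift Y) = 0 := by
    funext q
    rw [nabla_apply, Pi.zero_apply, map_zero]
  rw [hn, sub_zero]
  funext p
  simp only [Pi.sub_apply, comb, vec_sub]
  have h0 : mvfderiv (𝓡 (2 * n)) (0 : M → ℝ) = 0 := funext fun _ => mvfderiv_const 0
  have e1 : Q.Ω (Q.proj p) (Y (Q.proj p)) (symplEnd (𝓡 (2 * n)) Q.Ω s (Q.proj p)
      (symplEnd (𝓡 (2 * n)) Q.Ω s (Q.proj p) (X (Q.proj p)))) = -s (Q.proj p) (X (Q.proj p))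
        (symplEnd (𝓡 (2 * n)) Q.Ω s (Q.proj p) (Y (Q.proj p))) := by
    rw [Q.symplectic.symplEnd_apply, hss, ← Q.symplectic.symplEnd_apply, symplEnd_skew hss]
  rw [h0]
  refine Q.vec_congr ?_ ?_ ?_
  · rw [tensorB_apply, covDerivEnd_apply hσ (hY.diffAt _)]
    have := congrFun (nabla_const_smul_right (D := D) X 2 (hσ.apply hY)) (Q.proj p)
    simp only [Pi.add_apply, Pi.smul_apply', Pi.smul_apply, nabla_apply,
      Pi.zero_apply, smul_eq_mul, sub_apply, ContinuousLinearMap.comp_apply] at this ⊢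
    rw [this]
    module
  · simp only [Pi.smul_apply, map_smul, Q.symplectic.symplEnd_apply, smul_eq_mul, Pi.zero_apply,
      zero_apply]
    ring
  · rw [hD.mvfderiv_apply hY hU X, tensorA_apply]
    have e2 := Q.symplectic.swap (Y (Q.proj p)) (X (Q.proj p))
    simp only [Pi.smul_apply, map_smul, map_add, map_sub, e1, smul_eq_mul, Pi.zero_apply, e2,
      nabla_apply]
    ring

theorem IsInduced.curvOp_lift_E_E (hs : IsSmoothTwoTensor (𝓡 (2 * n)) s)
    (h : Q.IsInduced D s U F DP)
    (hss : ∀ x u v, s x u v = s x v u)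
    (hU : IsSmoothVF (𝓡 (2 * n)) U) (hF : ContMDiff (𝓡 (2 * n)) 𝓘(ℝ, ℝ) ∞ F)
    (hX : IsSmoothVF (𝓡 (2 * n)) X) :
    curvOp (modelP n) DP (Q.lift X) Q.E Q.E = Q.comb
      (fun x => (-2 : ℝ) • tensorA Q D U F s x (X x)) 0 (fun x => formB U F s x (X x)) := by
  have hΩ := Q.symplectic.smooth
  have hσ := hs.symplEnd Q.symplectic
  have hb : mlieBracket (modelP n) (Q.lift X) Q.E = 0 := by
    rw [mlieBracket_swap, Q.lift_eq_comb, Q.mlieBracket_E_comb hX contMDiff_zero_fun contMDiff_zero_fun,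
      neg_zero]
  rw [curvOp_eq, hb, h.nabla_E_E, h.nabla_lift_E,
    h.nabla_lift_comb (.const_smul (-2) hU) contMDiff_zero_fun hF,
    h.nabla_E_comb (.const_smul 2 (hσ.apply hX)) contMDiff_zero_fun (hΩ.apply hX hU)]
  have hn : nabla DP 0 Q.E = 0 := by
    funext q
    rw [nabla_apply, Pi.zero_apply, map_zero]
  rw [hn, sub_zero]
  funext p
  simp only [Pi.sub_apply, comb, vec_sub]
  have h0 : mvfderiv (𝓡 (2 * n)) (0 : M → ℝ) = 0 := funext fun _ => mvfderiv_const 0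
  rw [h0]
  refine Q.vec_congr ?_ ?_ ?_
  · rw [tensorA_apply]
    have := congrFun (nabla_const_smul_right (D := D) X (-2) hU) (Q.proj p)
    simp only [Pi.add_apply, Pi.smul_apply', Pi.smul_apply, nabla_apply, map_smul,
      Pi.zero_apply, smul_eq_mul] at this ⊢
    rw [this]
    module
  · simp only [Pi.smul_apply, map_smul, smul_eq_mul, Pi.zero_apply, zero_apply]
    ring
  · rw [formB]
    simp only [Pi.smul_apply, map_smul, smul_apply, smul_eq_mul, Pi.zero_apply, symplEnd_skew hss]
    ring

end ContactQuadruple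
end Quadruple

/-! ### The full curvature tensor of the induced connection, and traces on `TP`. -/

section General

variable {E : Type*} [NormedAddCommGroup E] [NormedSpace ℝ E] [FiniteDimensional ℝ E]
  {H : Type*} [TopologicalSpace H] {I : ModelWithCorners ℝ E H}
  {M : Type*} [TopologicalSpace M] [ChartedSpace H M] [IsManifold I ∞ M]
  (D : LinearConnection I M) (x : M) (c : ℝ) (u u' v v' w w' : TangentSpace I x)

theorem curvature_add₁ : curvature I D x (u + u') v w =
    curvature I D x u v w + curvature I D x u' v w :=
  congrArg (fun L => L v w) ((curvature I D x).map_add u u')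

theorem curvature_add₂ : curvature I D x u (v + v') w =
    curvature I D x u v w + curvature I D x u v' w :=
  congrArg (fun L => L w) ((curvature I D x u).map_add v v')

theorem curvature_add₃ : curvature I D x u v (w + w') =
    curvature I D x u v w + curvature I D x u v w' :=
  (curvature I D x u v).map_add w w'

theorem curvature_smul₁ : curvature I D x (c • u) v w = c • curvature I D x u v w :=
  congrArg (fun L => L v w) ((curvature I D x).map_smul c u)

theorem curvature_smul₂ : curvature I D x u (c • v) w = c • curvature I D x u v w :=
  congrArg (fun L => L w) ((curvature I D x u).map_smul c v)

theorem curvature_smul₃ : curvature I D x u v (c • w) = c • curvature I D x u v w :=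
  (curvature I D x u v).map_smul c w

end General

section Quadruple

variable {n : ℕ}
  {M : Type*} [TopologicalSpace M] [ChartedSpace (EuclideanSpace ℝ (Fin (2 * n))) M]
  [IsManifold (𝓡 (2 * n)) ∞ M]
  {N : Type*} [TopologicalSpace N] [ChartedSpace (EuclideanSpace ℝ (Fin (2 * n + 1))) N]
  [IsManifold (𝓡 (2 * n + 1)) ∞ N] [T2Space M] [T2Space N]

namespace ContactQuadruple

variable {Q : ContactQuadruple n M N} {D : LinearConnection (𝓡 (2 * n)) M}
  {s : TwoTensor (𝓡 (2 * n)) M} {U : VectorField (𝓡 (2 * n)) M} {F : M → ℝ}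
  {DP : LinearConnection (modelP n) (N × ℝ)}

/-! ### The curvature tensor of the induced connection -/

theorem exists_isSmoothVF_comb_apply_eq (p : N × ℝ) (w : TangentSpace (modelP n) p) :
    ∃ (X : VectorField (𝓡 (2 * n)) M) (f g : M → ℝ), IsSmoothVF (𝓡 (2 * n)) X ∧
      ContMDiff (𝓡 (2 * n)) 𝓘(ℝ, ℝ) ∞ f ∧ ContMDiff (𝓡 (2 * n)) 𝓘(ℝ, ℝ) ∞ g ∧
      Q.comb X f g p = w := by
  obtain ⟨X, hX, e⟩ := Q.exists_comb_apply_eq p w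
  exact ⟨X, _, _, hX, contMDiff_const, contMDiff_const, e.symm⟩

/-- As `∇_W ∂_s = W`, the curvature on `∂_s` is the torsion. -/
theorem IsInduced.curvature_S_right (h : Q.IsInduced D s U F DP)
    (hDP : IsSymplecticConnection (modelP n) Q.μ DP) (p : N × ℝ)
    (v w : TangentSpace (modelP n) p) : curvature (modelP n) DP p v w (Q.S p) = 0 := by
  obtain ⟨V, hV, rfl⟩ := exists_isSmoothVF_apply_eq p v
  obtain ⟨W, hW, rfl⟩ := exists_isSmoothVF_apply_eq p w
  rw [curvature_apply hDP.smooth hV hW Q.isSmoothVF_S, curvOp_eq, h.nabla_right_S,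
    h.nabla_right_S, h.nabla_right_S, hDP.mlieBracket_eq hV hW, sub_self]
  rfl

/-- On combs `∇_{∂_s}` is the identity and `∂_s` has zero brackets, so the two second-order terms of
the curvature are equal. -/
theorem IsInduced.curvature_S_left (h : Q.IsInduced D s U F DP)
    (hD : D.ContMDiffCovariantDerivative ∞) (hs : IsSmoothTwoTensor (𝓡 (2 * n)) s)
    (hU : IsSmoothVF (𝓡 (2 * n)) U) (hF : ContMDiff (𝓡 (2 * n)) 𝓘(ℝ, ℝ) ∞ F) (p : N × ℝ)
    (v w : TangentSpace (modelP n) p) : curvature (modelP n) DP p (Q.S p) v w = 0 := by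
  obtain ⟨X, a, b, hX, ha, hb, rfl⟩ := exists_isSmoothVF_comb_apply_eq (Q := Q) p v
  obtain ⟨Y, f, g, hY, hf, hg, rfl⟩ := exists_isSmoothVF_comb_apply_eq (Q := Q) p w
  obtain ⟨Z, c, d, hZ, hc, hd, e⟩ := h.exists_nabla_comb_eq hD hs hU hF hX ha hb hY hf hg
  rw [curvature_apply (h.contMDiff hD hs hU hF) Q.isSmoothVF_S (Q.isSmoothVF_comb hX ha hb)
    (Q.isSmoothVF_comb hY hf hg), curvOp_eq, e, h.nabla_S_comb hY hf hg, e,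
    h.nabla_S_comb hZ hc hd, Q.mlieBracket_S_comb hX ha hb]
  simp [nabla_apply]

theorem IsInduced.curvature_hlift (h : Q.IsInduced D s U F DP)
    (hD : IsSymplecticConnection (𝓡 (2 * n)) Q.Ω D) (hs : IsSmoothTwoTensor (𝓡 (2 * n)) s)
    (hU : IsSmoothVF (𝓡 (2 * n)) U) (hF : ContMDiff (𝓡 (2 * n)) 𝓘(ℝ, ℝ) ∞ F) (p : N × ℝ)
    (u v w : TangentSpace (𝓡 (2 * n)) (Q.proj p)) :
    curvature (modelP n) DP p (Q.hlift p u) (Q.hlift p v) (Q.hlift p w) =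
      Q.vec p (tensorH Q D s (Q.proj p) u v w) 0 (tensorC Q D hs U (Q.proj p) u v w) := by
  obtain ⟨X, hX, rfl⟩ := exists_isSmoothVF_apply_eq (Q.proj p) u
  obtain ⟨Y, hY, rfl⟩ := exists_isSmoothVF_apply_eq (Q.proj p) v
  obtain ⟨Z, hZ, rfl⟩ := exists_isSmoothVF_apply_eq (Q.proj p) w
  have := curvature_apply (h.contMDiff hD.smooth hs hU hF) (Q.isSmoothVF_lift hX)
    (Q.isSmoothVF_lift hY) (Q.isSmoothVF_lift hZ) p
  rw [h.curvOp_lift_lift_lift hs hD hX hY hZ] at this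
  exact this

theorem IsInduced.curvature_hlift_E_hlift (h : Q.IsInduced D s U F DP)
    (hD : IsSymplecticConnection (𝓡 (2 * n)) Q.Ω D) (hs : IsSmoothTwoTensor (𝓡 (2 * n)) s)
    (hss : ∀ x u v, s x u v = s x v u)
    (hU : IsSmoothVF (𝓡 (2 * n)) U) (hF : ContMDiff (𝓡 (2 * n)) 𝓘(ℝ, ℝ) ∞ F) (p : N × ℝ)
    (u w : TangentSpace (𝓡 (2 * n)) (Q.proj p)) :
    curvature (modelP n) DP p (Q.hlift p u) (Q.E p) (Q.hlift p w) =
      Q.vec p ((2 : ℝ) • tensorB Q D hs U (Q.proj p) u w) 0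
        (Q.Ω (Q.proj p) w (tensorA Q D U F s (Q.proj p) u)) := by
  obtain ⟨X, hX, rfl⟩ := exists_isSmoothVF_apply_eq (Q.proj p) u
  obtain ⟨Z, hZ, rfl⟩ := exists_isSmoothVF_apply_eq (Q.proj p) w
  have := curvature_apply (h.contMDiff hD.smooth hs hU hF) (Q.isSmoothVF_lift hX)
    Q.isSmoothVF_E (Q.isSmoothVF_lift hZ) p
  rw [h.curvOp_lift_E_lift hs hD hss hU hX hZ] at this
  exact this

theorem IsInduced.curvature_hlift_E_E (h : Q.IsInduced D s U F DP)
    (hD : IsSymplecticConnection (𝓡 (2 * n)) Q.Ω D) (hs : IsSmoothTwoTensor (𝓡 (2 * n)) s)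
    (hss : ∀ x u v, s x u v = s x v u)
    (hU : IsSmoothVF (𝓡 (2 * n)) U) (hF : ContMDiff (𝓡 (2 * n)) 𝓘(ℝ, ℝ) ∞ F) (p : N × ℝ)
    (u : TangentSpace (𝓡 (2 * n)) (Q.proj p)) :
    curvature (modelP n) DP p (Q.hlift p u) (Q.E p) (Q.E p) =
      Q.vec p ((-2 : ℝ) • tensorA Q D U F s (Q.proj p) u) 0 (formB U F s (Q.proj p) u) := by
  obtain ⟨X, hX, rfl⟩ := exists_isSmoothVF_apply_eq (Q.proj p) u
  have := curvature_apply (h.contMDiff hD.smooth hs hU hF) (Q.isSmoothVF_lift hX)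
    Q.isSmoothVF_E Q.isSmoothVF_E p
  rw [h.curvOp_lift_E_E hs hss hU hF hX] at this
  exact this

/-- The curvature of the induced connection. -/
theorem IsInduced.curvature_vec (h : Q.IsInduced D s U F DP)
    (hD : IsSymplecticConnection (𝓡 (2 * n)) Q.Ω D) (hs : IsSmoothTwoTensor (𝓡 (2 * n)) s)
    (hss : ∀ x u v, s x u v = s x v u)
    (hU : IsSmoothVF (𝓡 (2 * n)) U) (hF : ContMDiff (𝓡 (2 * n)) 𝓘(ℝ, ℝ) ∞ F) (p : N × ℝ)
    (u v w : TangentSpace (𝓡 (2 * n)) (Q.proj p)) (a c b d e f : ℝ) :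
    curvature (modelP n) DP p (Q.vec p u a c) (Q.vec p v b d) (Q.vec p w e f) = Q.vec p
      (tensorH Q D s (Q.proj p) u v w + (2 * b) • tensorB Q D hs U (Q.proj p) u w
        - (2 * a) • tensorB Q D hs U (Q.proj p) v w
        + (2 * e) • (tensorB Q D hs U (Q.proj p) u v - tensorB Q D hs U (Q.proj p) v u)
        - (2 * b * e) • tensorA Q D U F s (Q.proj p) u
        + (2 * a * e) • tensorA Q D U F s (Q.proj p) v) 0
      (tensorC Q D hs U (Q.proj p) u v w + b * Q.Ω (Q.proj p) w (tensorA Q D U F s (Q.proj p) u)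
        - a * Q.Ω (Q.proj p) w (tensorA Q D U F s (Q.proj p) v)
        + e * (Q.Ω (Q.proj p) v (tensorA Q D U F s (Q.proj p) u)
          - Q.Ω (Q.proj p) u (tensorA Q D U F s (Q.proj p) v))
        + b * e * formB U F s (Q.proj p) u - a * e * formB U F s (Q.proj p) v) := by
  have hDP := h.isSymplecticConnection hD hs hss hU hF
  have sw := curvature_swap hDP.smooth p
  have s1 := h.curvature_S_right hDP p
  have s2 := h.curvature_S_left hD.smooth hs hU hF p
  have s3 (v w : TangentSpace (modelP n) p) : curvature (modelP n) DP p v (Q.S p) w = 0 := by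
    rw [sw, s2, neg_zero]
  have r1 := h.curvature_hlift_E_hlift hD hs hss hU hF p
  have r2 (u w : TangentSpace (𝓡 (2 * n)) (Q.proj p)) := sw (Q.E p) (Q.hlift p u) (Q.hlift p w)
  have r3 := h.curvature_hlift_E_E hD hs hss hU hF p
  have r4 (u : TangentSpace (𝓡 (2 * n)) (Q.proj p)) := sw (Q.E p) (Q.hlift p u) (Q.E p)
  have r5 (w : TangentSpace (modelP n) p) : curvature (modelP n) DP p (Q.E p) (Q.E p) w = 0 :=
    have e := sw (Q.E p) (Q.E p) w
    have e2 : (2 : ℝ) • curvature (modelP n) DP p (Q.E p) (Q.E p) w = 0 := by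
      rw [two_smul]
      nth_rewrite 1 [e]
      exact neg_add_cancel _
    (smul_eq_zero.1 e2).resolve_left two_ne_zero
  -- The first Bianchi identity yields the one missing type of component from those with `E` in the
  -- second slot.
  have r6 (u v : TangentSpace (𝓡 (2 * n)) (Q.proj p)) :
      curvature (modelP n) DP p (Q.hlift p u) (Q.hlift p v) (Q.E p) =
        curvature (modelP n) DP p (Q.hlift p u) (Q.E p) (Q.hlift p v)
        - curvature (modelP n) DP p (Q.hlift p v) (Q.E p) (Q.hlift p u) := by
    have hb := hDP.first_bianchi p (Q.hlift p u) (Q.hlift p v) (Q.E p)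
    rw [r2] at hb
    rw [← sub_eq_zero, ← hb]
    abel
  have r7 := h.curvature_hlift hD hs hU hF p
  have ev (u : TangentSpace (𝓡 (2 * n)) (Q.proj p)) (a c : ℝ) :
      Q.vec p u a c = Q.hlift p u + a • Q.E p + c • Q.S p := rfl
  rw [ev u a c, ev v b d, ev w e f]
  simp only [curvature_add₁, curvature_add₂, curvature_add₃, curvature_smul₁, curvature_smul₂,
    curvature_smul₃, s1, s2, s3, r2, r4, r5, r6, r1, r3, r7,
    smul_zero, add_zero]
  have e1 (t : TangentSpace (modelP n) p) : -t = (-1 : ℝ) • t := by simp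
  simp only [e1, vec_smul, vec_add, vec_sub]
  refine Q.vec_congr ?_ ?_ ?_
  · module
  · ring
  · ring

/-! ### Traces on the tangent spaces of `P` -/

/-- The horizontal lift as a linear map. -/
def hliftL (Q : ContactQuadruple n M N) (p : N × ℝ) :
    TangentSpace (𝓡 (2 * n)) (Q.proj p) →ₗ[ℝ] TangentSpace (modelP n) p where
  toFun v := Q.hlift p v
  map_add' v w := by rw [hlift_eq_vec, hlift_eq_vec, hlift_eq_vec, vec_add, add_zero]
  map_smul' r v := by rw [hlift_eq_vec, hlift_eq_vec, RingHom.id_apply, vec_smul, mul_zero]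

/-- `T` is the sum of its restrictions to the three summands composed with the projections; the last
two are of rank at most one, and cyclicity of the trace moves the first to `TM`. -/
theorem trace_eq (Q : ContactQuadruple n M N) (p : N × ℝ)
    (T : TangentSpace (modelP n) p →ₗ[ℝ] TangentSpace (modelP n) p) :
    LinearMap.trace ℝ (TangentSpace (modelP n) p) T =
      LinearMap.trace ℝ (TangentSpace (𝓡 (2 * n)) (Q.proj p))
        ((Q.dproj p).toLinearMap ∘ₗ T ∘ₗ Q.hliftL p)
      + Q.αP p (T (Q.E p)) + Q.ds p (T (Q.S p)) := by
  have e : T = (T ∘ₗ Q.hliftL p) ∘ₗ (Q.dproj p).toLinearMap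
      + (Q.αP p).toLinearMap.smulRight (T (Q.E p))
      + (Q.ds p).toLinearMap.smulRight (T (Q.S p)) := by
    ext w : 1
    conv_lhs => rw [← Q.vec_components p w]
    rw [vec, map_add, map_add, map_smul, map_smul]
    rfl
  conv_lhs => rw [e]
  rw [map_add, map_add, LinearMap.trace_smulRight, LinearMap.trace_smulRight,
    LinearMap.trace_comp_comm']
  rfl

end ContactQuadruple
end Quadruple

/-! ### Symmetries and traces on `M`, Ricci-flatness, local symmetry. -/

section Quadruple

variable {n : ℕ}
  {M : Type*} [TopologicalSpace M] [ChartedSpace (EuclideanSpace ℝ (Fin (2 * n))) M]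
  [IsManifold (𝓡 (2 * n)) ∞ M]
  {N : Type*} [TopologicalSpace N] [ChartedSpace (EuclideanSpace ℝ (Fin (2 * n + 1))) N]
  [IsManifold (𝓡 (2 * n + 1)) ∞ N] [T2Space M]

theorem finrank_tangentSpace_euclidean (x : M) :
    Module.finrank ℝ (TangentSpace (𝓡 (2 * n)) x) = 2 * n :=
  finrank_euclideanSpace_fin (𝕜 := ℝ)

theorem trace_id_tangentSpace (x : M) :
    LinearMap.trace ℝ (TangentSpace (𝓡 (2 * n)) x) LinearMap.id = 2 * n := by
  rw [LinearMap.trace_id, finrank_tangentSpace_euclidean]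
  push_cast
  rfl

namespace ContactQuadruple

variable [T2Space N] {Q : ContactQuadruple n M N} {D : LinearConnection (𝓡 (2 * n)) M}
  {s : TwoTensor (𝓡 (2 * n)) M} {U : VectorField (𝓡 (2 * n)) M} {F : M → ℝ}
  {DP : LinearConnection (modelP n) (N × ℝ)}

/-! ### Symmetries and traces of the tensors on `M` -/

/-- The covariant derivative of `s` inherits the symmetry of `s`; equivalently `∇_w σ` is skew for
`Ω`. -/
theorem apply_covDerivEnd_symm (hD : IsSymplecticConnection (𝓡 (2 * n)) Q.Ω D)
    (hs : IsSmoothTwoTensor (𝓡 (2 * n)) s) (hss : ∀ x u v, s x u v = s x v u) (x : M)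
    (u v w : TangentSpace (𝓡 (2 * n)) x) :
    Q.Ω x u (covDerivEnd D (hs.symplEnd Q.symplectic) x v w) =
      Q.Ω x v (covDerivEnd D (hs.symplEnd Q.symplectic) x u w) := by
  obtain ⟨X, hX, rfl⟩ := exists_isSmoothVF_apply_eq x w
  obtain ⟨Y, hY, rfl⟩ := exists_isSmoothVF_apply_eq x u
  obtain ⟨Z, hZ, rfl⟩ := exists_isSmoothVF_apply_eq x v
  have h1 := mvfderiv_symmTensor (X := X) hs hD hY hZ x
  have h2 := mvfderiv_symmTensor (X := X) hs hD hZ hY x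
  simp only [hss _ (Z _) (Y _)] at h2
  rw [h1, hss x (nabla D X Z x), hss x (Z x)] at h2
  linarith

theorem apply_tensorB_symm (hD : IsSymplecticConnection (𝓡 (2 * n)) Q.Ω D)
    (hs : IsSmoothTwoTensor (𝓡 (2 * n)) s) (hss : ∀ x u v, s x u v = s x v u) (x : M)
    (u v w : TangentSpace (𝓡 (2 * n)) x) :
    Q.Ω x u (Q.tensorB D hs U x w v) = Q.Ω x v (Q.tensorB D hs U x w u) := by
  simp only [tensorB_apply, map_add, map_sub, map_smul, smul_eq_mul]
  rw [apply_covDerivEnd_symm hD hs hss x u v w, Q.symplectic.swap u w, Q.symplectic.swap v w]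
  ring

theorem trace_tensorB_right (hD : IsSymplecticConnection (𝓡 (2 * n)) Q.Ω D)
    (hs : IsSmoothTwoTensor (𝓡 (2 * n)) s) (hss : ∀ x u v, s x u v = s x v u) (x : M)
    (u : TangentSpace (𝓡 (2 * n)) x) :
    LinearMap.trace ℝ (TangentSpace (𝓡 (2 * n)) x) (Q.tensorB D hs U x u) = 0 :=
  trace_eq_zero_of_skew ((ContinuousLinearMap.coeLM ℝ).comp (Q.Ω x).toLinearMap)
    (Q.symplectic.nondegenerate x) _ fun v w => by
      change Q.Ω x _ w = -Q.Ω x v _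
      rw [Q.symplectic.swap, apply_tensorB_symm hD hs hss]

/-- This dictates `U`: the trace is `Tr[Y ↦ (∇_Y σ)v] + (n + ½) Ω(v, U)`, where `n` comes from half
the trace of the identity. -/
theorem trace_tensorB_left (hD : D.ContMDiffCovariantDerivative ∞)
    (x : M) (v : TangentSpace (𝓡 (2 * n)) x) :
    LinearMap.trace ℝ (TangentSpace (𝓡 (2 * n)) x)
      ((Q.tensorB D (Q.isSmoothTwoTensor_specialS hD) (Q.specialU D) x).flip v) = 0 := by
  have e : (Q.tensorB D (Q.isSmoothTwoTensor_specialS hD) (Q.specialU D) x).flip v =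
      (covDerivEnd D (Q.isSmoothEnd_special hD) x v).toLinearMap
      + (1 / 2 * Q.Ω x v (Q.specialU D x)) • LinearMap.id
      + (Q.Ω x v).toLinearMap.smulRight ((1 / 2 : ℝ) • Q.specialU D x) := by
    ext w : 1
    change Q.tensorB D (Q.isSmoothTwoTensor_specialS hD) (Q.specialU D) x w v =
      covDerivEnd D (Q.isSmoothEnd_special hD) x v w
      + (1 / 2 * Q.Ω x v (Q.specialU D x)) • w + Q.Ω x v w • (1 / 2 : ℝ) • Q.specialU D x
    rw [tensorB_apply, Q.symplectic.swap w v]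
    module
  have h := Q.specialU_apply hD x v
  have hn : (2 * (n : ℝ) + 1) ≠ 0 := by positivity
  rw [e, map_add, map_add, map_smul, LinearMap.trace_smulRight, trace_id_tangentSpace]
  rw [Q.symplectic.swap] at h
  simp only [smul_eq_mul, map_smul, ContinuousLinearMap.coe_coe]
  rw [div_mul_eq_mul_div, eq_div_iff hn] at h
  linarith

/-- This dictates `f`: the trace is `Tr(∇U) + 2 Tr(σ²) - n f`, and `2σ² = ρ² / (2(n+1)²)`. -/
theorem trace_tensorA (hn : n ≠ 0) (x : M) :
    LinearMap.trace ℝ (TangentSpace (𝓡 (2 * n)) x)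
      (Q.tensorA D (Q.specialU D) (Q.specialF D) (Q.specialS D) x) = 0 := by
  have hn' : (n : ℝ) ≠ 0 := by exact_mod_cast hn
  have hn1 : ((n : ℝ) + 1) ≠ 0 := by positivity
  have e : ((symplEnd (𝓡 (2 * n)) Q.Ω (Q.specialS D) x).comp
      (symplEnd (𝓡 (2 * n)) Q.Ω (Q.specialS D) x)).toLinearMap = (1 / (4 * ((n : ℝ) + 1) ^ 2)) •
      ((ricciEnd (𝓡 (2 * n)) Q.Ω D x).comp (ricciEnd (𝓡 (2 * n)) Q.Ω D x)).toLinearMap := by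
    ext u : 1
    change symplEnd (𝓡 (2 * n)) Q.Ω (Q.specialS D) x
      (symplEnd (𝓡 (2 * n)) Q.Ω (Q.specialS D) x u) = (1 / (4 * ((n : ℝ) + 1) ^ 2)) •
        ricciEnd (𝓡 (2 * n)) Q.Ω D x (ricciEnd (𝓡 (2 * n)) Q.Ω D x u)
    rw [symplEnd_specialS, symplEnd_specialS, map_smul, smul_smul]
    congr 1
    field_simp
    norm_num
  rw [tensorA, e, map_sub, map_add, map_smul, map_smul, map_smul, trace_id_tangentSpace, specialF]
  simp only [smul_eq_mul]
  field_simp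
  ring

theorem tensorH_special (x : M) (u v w : TangentSpace (𝓡 (2 * n)) x) :
    tensorH Q D (Q.specialS D) x u v w = weylPart (𝓡 (2 * n)) n Q.Ω D x u v w := by
  have e (u v : TangentSpace (𝓡 (2 * n)) x) : Q.specialS D x u v =
    (-1 / (2 * ((n : ℝ) + 1))) * ricci (𝓡 (2 * n)) D x u v := rfl
  have hc : (-1 / (2 * ((n : ℝ) + 1))) = -(1 / (2 * ((n : ℝ) + 1))) := by ring
  rw [tensorH, weylPart, ricciPart, e, e, symplEnd_specialS, symplEnd_specialS, symplEnd_specialS,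
    hc]
  module

/-- For symmetric `s` the trace is `r(u, w) + 2(n+1) s(u, w)`, which accounts for the factor in the
special `ŝ`. -/
theorem trace_tensorH (hD : IsSymplecticConnection (𝓡 (2 * n)) Q.Ω D) (x : M)
    (u w : TangentSpace (𝓡 (2 * n)) x)
    (L : TangentSpace (𝓡 (2 * n)) x →ₗ[ℝ] TangentSpace (𝓡 (2 * n)) x)
    (hL : ∀ v, L v = tensorH Q D (Q.specialS D) x u v w) :
    LinearMap.trace ℝ (TangentSpace (𝓡 (2 * n)) x) L = 0 := by
  have hss := Q.specialS_symm hD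
  have hn1 : ((n : ℝ) + 1) ≠ 0 := by positivity
  let σ := symplEnd (𝓡 (2 * n)) Q.Ω (Q.specialS D) x
  have e : L = ricciOp D x u w + (Q.Ω x w).toLinearMap.smulRight (σ u)
      + Q.Ω x u w • σ.toLinearMap - (Q.specialS D x w).toLinearMap.smulRight u
      + Q.specialS D x u w • LinearMap.id
      + (Q.Ω x u).toLinearMap.smulRight ((2 : ℝ) • σ w) := by
    ext v : 1
    rw [hL, tensorH, Q.symplectic.swap v w, hss x v w]
    change _ = curvature (𝓡 (2 * n)) D x u v w + Q.Ω x w v • σ u + Q.Ω x u w • σ v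
      - Q.specialS D x w v • u + Q.specialS D x u w • v + Q.Ω x u v • (2 : ℝ) • σ w
    module
  have hσ : LinearMap.trace ℝ (TangentSpace (𝓡 (2 * n)) x) σ.toLinearMap = 0 :=
    trace_eq_zero_of_skew ((ContinuousLinearMap.coeLM ℝ).comp (Q.Ω x).toLinearMap)
      (Q.symplectic.nondegenerate x) _ fun v w => by
        change Q.Ω x (σ v) w = -Q.Ω x v (σ w)
        rw [symplEnd_skew hss, Q.symplectic.symplEnd_apply]
  rw [e]
  simp only [map_add, map_sub, map_smul, LinearMap.trace_smulRight, trace_id_tangentSpace, hσ,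
    ContinuousLinearMap.coe_coe, smul_eq_mul]
  rw [← ricci_apply, Q.symplectic.symplEnd_apply, Q.symplectic.symplEnd_apply, hss x w u]
  have e2 : Q.specialS D x u w = (-1 / (2 * ((n : ℝ) + 1))) * ricci (𝓡 (2 * n)) D x u w := rfl
  rw [e2]
  field_simp
  ring

/-! ### Ricci-flatness -/

/-- The curvature has no `E`-component and vanishes on `∂_s`, so only the trace over horizontal
lifts survives; it is a combination of the traces of `H`, `B` (in either argument) and `A`. -/
theorem IsInduced.isRicciFlat (hn : n ≠ 0) (hD : IsSymplecticConnection (𝓡 (2 * n)) Q.Ω D)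
    (h : Q.IsInduced D (Q.specialS D) (Q.specialU D) (Q.specialF D) DP) :
    IsRicciFlat (modelP n) DP := by
  have hs := Q.isSmoothTwoTensor_specialS hD.smooth
  have hss := Q.specialS_symm hD
  have hU := Q.isSmoothVF_specialU hD.smooth
  have hF := Q.contMDiff_specialF hD.smooth
  have hR := h.curvature_vec hD hs hss hU hF
  intro p
  ext V W : 2
  rw [ricci_apply, Q.trace_eq, ← Q.vec_components p V, ← Q.vec_components p W]
  generalize Q.dproj p V = u
  generalize Q.αP p V = a
  generalize Q.ds p V = c
  generalize Q.dproj p W = w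
  generalize Q.αP p W = e
  generalize Q.ds p W = f
  let B := Q.tensorB D hs (Q.specialU D) (Q.proj p)
  let A := Q.tensorA D (Q.specialU D) (Q.specialF D) (Q.specialS D) (Q.proj p)
  let T := ricciOp DP p (Q.vec p u a c) (Q.vec p w e f)
  have h1 : Q.αP p (T (Q.E p)) = 0 := by
    rw [ricciOp_apply, Q.E_eq_vec, hR, αP_vec]
  have h2 : Q.ds p (T (Q.S p)) = 0 := by
    rw [ricciOp_apply, Q.S_eq_vec, hR, ds_vec]
    simp [tensorC, formB]
  let K := (Q.dproj p).toLinearMap ∘ₗ T ∘ₗ Q.hliftL p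
  have hK (v : TangentSpace (𝓡 (2 * n)) (Q.proj p)) : K v =
      tensorH Q D (Q.specialS D) (Q.proj p) u v w - (2 * a) • B v w
        + (2 * e) • (B u v - B v u) + (2 * a * e) • A v := by
    change Q.dproj p (curvature (modelP n) DP p (Q.vec p u a c) (Q.hlift p v) (Q.vec p w e f)) = _
    rw [Q.hlift_eq_vec, hR, dproj_vec]
    module
  have h3 := trace_tensorH hD (Q.proj p) u w
    (K + (2 * a) • B.flip w - (2 * e) • (B u - B.flip u) - (2 * a * e) • A) fun v => by
      change K v + (2 * a) • B v w - (2 * e) • (B u v - B v u) - (2 * a * e) • A v = _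
      rw [hK]
      module
  simp only [map_add, map_sub, map_smul, B, A, trace_tensorB_left hD.smooth,
    trace_tensorB_right hD hs hss, trace_tensorA hn] at h3
  change LinearMap.trace ℝ _ K + Q.αP p (T (Q.E p)) + Q.ds p (T (Q.S p)) = 0
  rw [h1, h2]
  simpa using h3

/-! ### Local symmetry -/

/-- The fields `X̄ + (f ∘ p) E + (g ∘ p) ∂_s`. -/
def IsComb (Q : ContactQuadruple n M N) (W : VectorField (modelP n) (N × ℝ)) : Prop :=
  ∃ (X : VectorField (𝓡 (2 * n)) M) (f g : M → ℝ), IsSmoothVF (𝓡 (2 * n)) X ∧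
    ContMDiff (𝓡 (2 * n)) 𝓘(ℝ, ℝ) ∞ f ∧ ContMDiff (𝓡 (2 * n)) 𝓘(ℝ, ℝ) ∞ g ∧ W = Q.comb X f g

variable {V W Z : VectorField (modelP n) (N × ℝ)}

theorem IsComb.sub (hV : Q.IsComb V) (hW : Q.IsComb W) : Q.IsComb (V - W) := by
  obtain ⟨X, a, b, hX, ha, hb, rfl⟩ := hV
  obtain ⟨Y, f, g, hY, hf, hg, rfl⟩ := hW
  exact ⟨X - Y, a - f, b - g, hX.sub hY, ha.sub hf, hb.sub hg, funext fun p => Q.vec_sub ..⟩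

theorem IsComb.isSmoothVF (hV : Q.IsComb V) : IsSmoothVF (modelP n) V := by
  obtain ⟨X, a, b, hX, ha, hb, rfl⟩ := hV
  exact Q.isSmoothVF_comb hX ha hb

theorem IsComb.mlieBracket (hV : Q.IsComb V) (hW : Q.IsComb W) :
    Q.IsComb (mlieBracket (modelP n) V W) := by
  obtain ⟨X, a, b, hX, ha, hb, rfl⟩ := hV
  obtain ⟨Y, f, g, hY, hf, hg, rfl⟩ := hW
  exact ⟨_, _, _, hX.mlieBracket hY,
    ((contMDiff_mvfderiv_apply hf hX).sub (contMDiff_mvfderiv_apply ha hY)).sub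
      (Q.symplectic.smooth.apply hX hY),
    (contMDiff_mvfderiv_apply hg hX).sub (contMDiff_mvfderiv_apply hb hY),
    Q.mlieBracket_comb hX hY ha hb hf hg⟩

theorem IsInduced.isComb_nabla (h : Q.IsInduced D s U F DP)
    (hD : D.ContMDiffCovariantDerivative ∞) (hs : IsSmoothTwoTensor (𝓡 (2 * n)) s)
    (hU : IsSmoothVF (𝓡 (2 * n)) U) (hF : ContMDiff (𝓡 (2 * n)) 𝓘(ℝ, ℝ) ∞ F)
    (hV : Q.IsComb V) (hW : Q.IsComb W) : Q.IsComb (nabla DP V W) := by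
  obtain ⟨X, a, b, hX, ha, hb, rfl⟩ := hV
  obtain ⟨Y, f, g, hY, hf, hg, rfl⟩ := hW
  exact h.exists_nabla_comb_eq hD hs hU hF hX ha hb hY hf hg

theorem IsInduced.nabla_S_of_isComb (h : Q.IsInduced D s U F DP) (hV : Q.IsComb V) :
    nabla DP Q.S V = V := by
  obtain ⟨X, a, b, hX, ha, hb, rfl⟩ := hV
  exact h.nabla_S_comb hX ha hb

/-- For combs, `∇_{∂_s}` fixes `X`, `Y`, `Z` and also `R(X, Y)Z`, which is again a comb; hence
`(∇_{∂_s} R)(X, Y)Z = R(X, Y)Z - 3R(X, Y)Z`. -/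
theorem IsInduced.isFlat_of_isLocallySymmetric (h : Q.IsInduced D s U F DP)
    (hD : D.ContMDiffCovariantDerivative ∞) (hs : IsSmoothTwoTensor (𝓡 (2 * n)) s)
    (hU : IsSmoothVF (𝓡 (2 * n)) U) (hF : ContMDiff (𝓡 (2 * n)) 𝓘(ℝ, ℝ) ∞ F)
    (hls : IsLocallySymmetric (modelP n) DP) : IsFlat (modelP n) DP := by
  have hDP := h.contMDiff hD hs hU hF
  have hgen (p : N × ℝ) (w : TangentSpace (modelP n) p) : ∃ W, Q.IsComb W ∧ W p = w := by
    obtain ⟨X, f, g, hX, hf, hg, e⟩ := exists_isSmoothVF_comb_apply_eq (Q := Q) p w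
    exact ⟨_, ⟨X, f, g, hX, hf, hg, rfl⟩, e⟩
  intro p
  ext x y z : 3
  obtain ⟨X, hX, rfl⟩ := hgen p x
  obtain ⟨Y, hY, rfl⟩ := hgen p y
  obtain ⟨Z, hZ, rfl⟩ := hgen p z
  have hn {A B : VectorField (modelP n) (N × ℝ)} (hA : Q.IsComb A) (hB : Q.IsComb B) :=
    h.isComb_nabla hD hs hU hF hA hB
  have hc : Q.IsComb (curvOp (modelP n) DP X Y Z) :=
    ((hn hX (hn hY hZ)).sub (hn hY (hn hX hZ))).sub (hn (hX.mlieBracket hY) hZ)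
  have e (W : VectorField (modelP n) (N × ℝ)) (hW : Q.IsComb W) : DP W p (Q.S p) = W p :=
    congrFun (h.nabla_S_of_isComb hW) p
  have hR : (fun q => curvature (modelP n) DP q (X q) (Y q) (Z q)) = curvOp (modelP n) DP X Y Z :=
    funext fun q => curvature_apply hDP hX.isSmoothVF hY.isSmoothVF hZ.isSmoothVF q
  have := hls Q.S X Y Z Q.isSmoothVF_S hX.isSmoothVF hY.isSmoothVF hZ.isSmoothVF p
  rw [hR, e _ hc, e _ hX, e _ hY, e _ hZ, ← congrFun hR p] at this
  have h2 : (-2 : ℝ) • curvature (modelP n) DP p (X p) (Y p) (Z p) = 0 := by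
    rw [← this]
    module
  exact (smul_eq_zero.1 h2).resolve_left (by norm_num)

theorem tensorH_eq_zero_of_isFlat (h : Q.IsInduced D s U F DP)
    (hD : IsSymplecticConnection (𝓡 (2 * n)) Q.Ω D) (hs : IsSmoothTwoTensor (𝓡 (2 * n)) s)
    (hU : IsSmoothVF (𝓡 (2 * n)) U) (hF : ContMDiff (𝓡 (2 * n)) 𝓘(ℝ, ℝ) ∞ F)
    (hflat : IsFlat (modelP n) DP) (p : N × ℝ) (u v w : TangentSpace (𝓡 (2 * n)) (Q.proj p)) :
    tensorH Q D s (Q.proj p) u v w = 0 := by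
  have := h.curvature_hlift hD hs hU hF p u v w
  rw [hflat p] at this
  simpa [dproj_vec] using (congrArg (Q.dproj p) this).symm

end ContactQuadruple
end Quadruple

/-! ### Linear algebra of Ricci-type identities -/

section LinearAlgebra

variable {V : Type*} [AddCommGroup V] [Module ℝ V] {β : V →ₗ[ℝ] V →ₗ[ℝ] ℝ} {n : ℕ}
  {B : V →ₗ[ℝ] V →ₗ[ℝ] V}

/-- The identity is read as an endomorphism in `u` and traced. The trace conditions remove some
terms of `B`, the symmetry `hB` rewrites the others, and `2n + 1` times the wanted expression is
left. -/
theorem antisymmetrization_eq_zero [FiniteDimensional ℝ V] (h_skew : ∀ u v, β u v = -β v u)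
    (htr : LinearMap.trace ℝ V LinearMap.id = 2 * n)
    (hB : ∀ u v w, β u (B w v) = β v (B w u)) (hB1 : ∀ u, LinearMap.trace ℝ V (B u) = 0)
    (hB2 : ∀ v, LinearMap.trace ℝ V (B.flip v) = 0)
    (h : ∀ u v w z, (β v (B w z) - β w (B v z)) • u + (β w (B u z) - β u (B w z)) • v
      + (β u (B v z) - β v (B u z)) • w
      + β u z • (B v w - B w v) + β v z • (B w u - B u w) + β w z • (B u v - B v u)
      - (2 : ℝ) • (β u v • B w z + β v w • B u z + β w u • B v z) = 0) (v w z : V) :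
    β v (B w z) - β w (B v z) = 0 := by
  have hL : (β v (B w z) - β w (B v z)) • (LinearMap.id : V →ₗ[ℝ] V)
      + (β w ∘ₗ B.flip z + β (B w z)).smulRight v - (β v ∘ₗ B.flip z + β (B v z)).smulRight w
      - (β z).smulRight (B v w - B w v) + β v z • (B w - B.flip w) + β w z • (B.flip v - B v)
      - (2 : ℝ) • (-(β v).smulRight (B w z) + β v w • B.flip z + (β w).smulRight (B v z)) = 0 := by
    ext u
    have := h u v w z
    rw [h_skew u z, h_skew u v, h_skew u (B w z), h_skew u (B v z)] at this
    simp only [LinearMap.add_apply, LinearMap.sub_apply, LinearMap.smul_apply, LinearMap.neg_apply,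
      LinearMap.id_apply, LinearMap.smulRight_apply, LinearMap.comp_apply, LinearMap.flip_apply,
      LinearMap.zero_apply]
    rw [← this]
    module
  have ht := congrArg (LinearMap.trace ℝ V) hL
  simp only [map_add, map_sub, map_smul, map_neg, map_zero, LinearMap.trace_smulRight, hB1, hB2,
    htr, LinearMap.add_apply, LinearMap.comp_apply, LinearMap.flip_apply, smul_eq_mul] at ht
  have e1 := hB z w v
  have e2 := hB z v w
  have e3 := h_skew v (B w z)
  have e4 := h_skew w (B v z)
  have hn : (2 * (n : ℝ) + 1) ≠ 0 := by positivity
  have : (2 * (n : ℝ) + 1) * (β v (B w z) - β w (B v z)) = 0 := by linarith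
  exact (mul_eq_zero.1 this).resolve_left hn

/-- By `hB` and `hC` the trilinear form `β u (B v w)` is totally symmetric. Applying `β a` to the
identity and removing `v` by nondegeneracy leaves an endomorphism in `u` with trace `(2 - 2n) β w (B
z a)`; for `n = 1` this would give nothing. -/
theorem bilinear_eq_zero [FiniteDimensional ℝ V] (h_skew : ∀ u v, β u v = -β v u)
    (hnd : ∀ v, (∀ w, β w v = 0) → v = 0) (hn : 2 ≤ n)
    (htr : LinearMap.trace ℝ V LinearMap.id = 2 * n)
    (hB : ∀ u v w, β u (B w v) = β v (B w u)) (hC : ∀ v w z, β v (B w z) = β w (B v z))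
    (h : ∀ u v w z, β u v • B w z + β v w • B u z + β w u • B v z = 0) (z a : V) :
    B z a = 0 := by
  have e (w : V) : β a (B w z) = β w (B z a) := by rw [hC a w z, hB w z a, hC z a w, hB a w z]
  have h1 (u w : V) : -β w (B z a) • u + β u (B z a) • w + β w u • B z a = 0 := by
    refine hnd _ fun v => ?_
    have := congrArg (β a) (h u v w z)
    simp only [map_add, map_smul, smul_eq_mul, map_zero, e] at this ⊢
    rw [h_skew u v] at this
    linarith
  refine hnd _ fun w => ?_
  have hL : -β w (B z a) • (LinearMap.id : V →ₗ[ℝ] V) - (β (B z a)).smulRight w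
      + (β w).smulRight (B z a) = 0 := by
    ext u
    have := h1 u w
    rw [h_skew u] at this
    simpa [sub_eq_add_neg] using this
  have ht := congrArg (LinearMap.trace ℝ V) hL
  simp only [map_add, map_sub, map_smul, map_zero, LinearMap.trace_smulRight, htr,
    smul_eq_mul] at ht
  rw [h_skew (B z a) w] at ht
  have hn' : (2 : ℝ) ≤ n := by exact_mod_cast hn
  have : (2 - 2 * (n : ℝ)) * β w (B z a) = 0 := by linarith
  exact (mul_eq_zero.1 this).resolve_left (by linarith)

/-- The trace over `u` is `2n β z (A v)`: the two rank-one terms cancel, and the last term has trace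
zero. -/
theorem endomorphism_eq_zero [FiniteDimensional ℝ V] (h_skew : ∀ u v, β u v = -β v u)
    (hnd : ∀ v, (∀ w, β w v = 0) → v = 0) (hn : n ≠ 0)
    (htr : LinearMap.trace ℝ V LinearMap.id = 2 * n) {A : V →ₗ[ℝ] V}
    (hA : LinearMap.trace ℝ V A = 0)
    (h : ∀ u v z, β z (A v) • u - β u z • A v - β z (A u) • v + β v z • A u = 0) (v : V) :
    A v = 0 := by
  refine hnd _ fun z => ?_
  have hL : β z (A v) • (LinearMap.id : V →ₗ[ℝ] V) + (β z).smulRight (A v)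
      - (β z ∘ₗ A).smulRight v + β v z • A = 0 := by
    ext u
    have := h u v z
    rw [h_skew u z] at this
    simp only [LinearMap.add_apply, LinearMap.sub_apply, LinearMap.smul_apply,
      LinearMap.id_apply, LinearMap.smulRight_apply, LinearMap.comp_apply, LinearMap.zero_apply]
    rw [← this]
    module
  have ht := congrArg (LinearMap.trace ℝ V) hL
  simp only [map_add, map_sub, map_smul, map_zero, LinearMap.trace_smulRight, htr, hA,
    LinearMap.comp_apply, smul_eq_mul] at ht
  have hn' : (n : ℝ) ≠ 0 := by exact_mod_cast hn
  have : 2 * (n : ℝ) * β z (A v) = 0 := by linarith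
  exact (mul_eq_zero.1 this).resolve_left (by positivity)

theorem functional_eq_zero [FiniteDimensional ℝ V] (hn : n ≠ 0)
    (htr : LinearMap.trace ℝ V LinearMap.id = 2 * n) {φ : V →ₗ[ℝ] ℝ}
    (h : ∀ u v, φ v • u - φ u • v = 0) (v : V) : φ v = 0 := by
  have hL : φ v • (LinearMap.id : V →ₗ[ℝ] V) - φ.smulRight v = 0 := by
    ext u
    simpa using h u v
  have ht := congrArg (LinearMap.trace ℝ V) hL
  simp only [map_sub, map_smul, map_zero, LinearMap.trace_smulRight, htr, smul_eq_mul] at ht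
  have hn' : (1 : ℝ) ≤ n := by exact_mod_cast Nat.one_le_iff_ne_zero.2 hn
  have : (2 * (n : ℝ) - 1) * φ v = 0 := by linarith
  exact (mul_eq_zero.1 this).resolve_left (by linarith)

end LinearAlgebra

/-! ### Ricci type implies flat: the second Bianchi identity on `P`. -/

section Quadruple

variable {n : ℕ}
  {M : Type*} [TopologicalSpace M] [ChartedSpace (EuclideanSpace ℝ (Fin (2 * n))) M]
  [IsManifold (𝓡 (2 * n)) ∞ M]
  {N : Type*} [TopologicalSpace N] [ChartedSpace (EuclideanSpace ℝ (Fin (2 * n + 1))) N]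
  [IsManifold (𝓡 (2 * n + 1)) ∞ N] [T2Space M] [T2Space N]

namespace ContactQuadruple

variable {Q : ContactQuadruple n M N} {D : LinearConnection (𝓡 (2 * n)) M}
  {s : TwoTensor (𝓡 (2 * n)) M} {U : VectorField (𝓡 (2 * n)) M} {F : M → ℝ}
  {DP : LinearConnection (modelP n) (N × ℝ)}

/-! ### Ricci type implies flat -/

theorem second_bianchi_apply (hDP : DP.ContMDiffCovariantDerivative ∞)
    {X Y Z V : VectorField (modelP n) (N × ℝ)} (hX : IsSmoothVF (modelP n) X)
    (hY : IsSmoothVF (modelP n) Y) (hZ : IsSmoothVF (modelP n) Z) (hV : IsSmoothVF (modelP n) V)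
    (p : N × ℝ) :
    (nabla DP X (curvOp (modelP n) DP Y Z V) p
        - curvature (modelP n) DP p (Y p) (Z p) (nabla DP X V p)
        - curvature (modelP n) DP p (mlieBracket (modelP n) X Y p) (Z p) (V p))
      + (nabla DP Y (curvOp (modelP n) DP Z X V) p
        - curvature (modelP n) DP p (Z p) (X p) (nabla DP Y V p)
        - curvature (modelP n) DP p (mlieBracket (modelP n) Y Z p) (X p) (V p))
      + (nabla DP Z (curvOp (modelP n) DP X Y V) p
        - curvature (modelP n) DP p (X p) (Y p) (nabla DP Z V p)
        - curvature (modelP n) DP p (mlieBracket (modelP n) Z X p) (Y p) (V p)) = 0 := by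
  have e {A B C : VectorField (modelP n) (N × ℝ)} (hA : IsSmoothVF (modelP n) A)
      (hB : IsSmoothVF (modelP n) B) (hC : IsSmoothVF (modelP n) C) :=
    curvature_apply hDP hA hB hC p
  rw [e hY hZ (hX.nabla hDP hV), e (hX.mlieBracket hY) hZ hV, e hZ hX (hY.nabla hDP hV),
    e (hY.mlieBracket hZ) hX hV, e hX hY (hZ.nabla hDP hV), e (hZ.mlieBracket hX) hY hV]
  exact congrFun (second_bianchi hDP hX hY hZ hV) p

theorem lift_apply (X : VectorField (𝓡 (2 * n)) M) (p : N × ℝ) :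
    Q.lift X p = Q.vec p (X (Q.proj p)) 0 0 := Q.hlift_eq_vec ..

/-- Differentiating `g ∂_s` horizontally returns `g X` itself, since `∇_X̄ ∂_s = X̄`; the derivative
of `g` stays in the `∂_s`-component. This makes the horizontal Bianchi identities free of
derivatives. -/
theorem IsInduced.dproj_nabla_lift (h : Q.IsInduced D s U F DP) (X : VectorField (𝓡 (2 * n)) M)
    {g : M → ℝ} (hg : ContMDiff (𝓡 (2 * n)) 𝓘(ℝ, ℝ) ∞ g) (p : N × ℝ) :
    Q.dproj p (nabla DP (Q.lift X) (Q.comb 0 0 g) p) = g (Q.proj p) • X (Q.proj p) := by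
  rw [h.nabla_lift_comb isSmoothVF_zero contMDiff_zero_fun hg, dproj_comb]
  simp [nabla_apply, D.zero]

-- The horizontal part of the second Bianchi identity for three lifts acting on a lift. The terms
-- with `C` come from differentiating `C ∂_s`, those with `B` from the `E`-components of `∇_X̄ V̄`
-- and of the brackets. The vanishing of `H` is assumed over all of `P` because the curvature is
-- differentiated as a field.
set_option maxHeartbeats 1000000 in
theorem IsInduced.bianchi_lift (h : Q.IsInduced D s U F DP)
    (hD : IsSymplecticConnection (𝓡 (2 * n)) Q.Ω D)
    (hs : IsSmoothTwoTensor (𝓡 (2 * n)) s) (hss : ∀ x u v, s x u v = s x v u)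
    (hU : IsSmoothVF (𝓡 (2 * n)) U) (hF : ContMDiff (𝓡 (2 * n)) 𝓘(ℝ, ℝ) ∞ F)
    (hH : ∀ (q : N × ℝ) (u v w : TangentSpace (𝓡 (2 * n)) (Q.proj q)),
      tensorH Q D s (Q.proj q) u v w = 0) (p : N × ℝ) (u v w z : TangentSpace (𝓡 (2 * n)) (Q.proj p)) :
    tensorC Q D hs U (Q.proj p) v w z • u + tensorC Q D hs U (Q.proj p) w u z • v
      + tensorC Q D hs U (Q.proj p) u v z • w
      + Q.Ω (Q.proj p) u z • (tensorB Q D hs U (Q.proj p) v w - tensorB Q D hs U (Q.proj p) w v)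
      + Q.Ω (Q.proj p) v z • (tensorB Q D hs U (Q.proj p) w u - tensorB Q D hs U (Q.proj p) u w)
      + Q.Ω (Q.proj p) w z • (tensorB Q D hs U (Q.proj p) u v - tensorB Q D hs U (Q.proj p) v u)
      - (2 : ℝ) • (Q.Ω (Q.proj p) u v • tensorB Q D hs U (Q.proj p) w z
        + Q.Ω (Q.proj p) v w • tensorB Q D hs U (Q.proj p) u z
        + Q.Ω (Q.proj p) w u • tensorB Q D hs U (Q.proj p) v z) = 0 := by
  have hDP := h.contMDiff hD.smooth hs hU hF
  have hR := h.curvature_vec hD hs hss hU hF p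
  obtain ⟨X, hX, rfl⟩ := exists_isSmoothVF_apply_eq (Q.proj p) u
  obtain ⟨Y, hY, rfl⟩ := exists_isSmoothVF_apply_eq (Q.proj p) v
  obtain ⟨Z, hZ, rfl⟩ := exists_isSmoothVF_apply_eq (Q.proj p) w
  obtain ⟨V, hV, rfl⟩ := exists_isSmoothVF_apply_eq (Q.proj p) z
  have hb := second_bianchi_apply hDP (Q.isSmoothVF_lift hX) (Q.isSmoothVF_lift hY)
    (Q.isSmoothVF_lift hZ) (Q.isSmoothVF_lift hV) p
  have ec {A B : VectorField (𝓡 (2 * n)) M} (hA : IsSmoothVF (𝓡 (2 * n)) A)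
      (hB : IsSmoothVF (𝓡 (2 * n)) B) :
      curvOp (modelP n) DP (Q.lift A) (Q.lift B) (Q.lift V) =
        Q.comb 0 0 fun x => tensorC Q D hs U x (A x) (B x) (V x) := by
    rw [h.curvOp_lift_lift_lift hs hD hA hB hV]
    exact funext fun q => Q.vec_congr (hH q _ _ _) rfl rfl
  have en (A : VectorField (𝓡 (2 * n)) M) : nabla DP (Q.lift A) (Q.lift V) p = Q.vec p
      (nabla D A V (Q.proj p)) (-1 / 2 * Q.Ω (Q.proj p) (A (Q.proj p)) (V (Q.proj p)))
        (-1 * s (Q.proj p) (A (Q.proj p)) (V (Q.proj p))) := by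
    rw [h.nabla_lift_lift hV]; rfl
  have el {A B : VectorField (𝓡 (2 * n)) M} (hA : IsSmoothVF (𝓡 (2 * n)) A)
      (hB : IsSmoothVF (𝓡 (2 * n)) B) : mlieBracket (modelP n) (Q.lift A) (Q.lift B) p =
        Q.vec p (mlieBracket (𝓡 (2 * n)) A B (Q.proj p))
          (-1 * Q.Ω (Q.proj p) (A (Q.proj p)) (B (Q.proj p))) 0 := by
    rw [mlieBracket_lift hA hB]; rfl
  rw [ec hX hY, ec hY hZ, ec hZ hX, en, en, en, el hX hY, el hY hZ, el hZ hX] at hb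
  have hc {A B : VectorField (𝓡 (2 * n)) M} (hA : IsSmoothVF (𝓡 (2 * n)) A)
      (hB : IsSmoothVF (𝓡 (2 * n)) B) := contMDiff_tensorC (Q := Q) hs hD.smooth hU hA hB hV
  have hb' := congrArg (Q.dproj p) hb
  simp only [map_add, map_sub, map_zero, lift_apply, hR, dproj_vec, hH,
    h.dproj_nabla_lift _ (hc hX hY), h.dproj_nabla_lift _ (hc hY hZ),
    h.dproj_nabla_lift _ (hc hZ hX)] at hb'
  rw [← hb']
  module

end ContactQuadruple
end Quadruple

section Quadruple

variable {n : ℕ}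
  {M : Type*} [TopologicalSpace M] [ChartedSpace (EuclideanSpace ℝ (Fin (2 * n))) M]
  [IsManifold (𝓡 (2 * n)) ∞ M]
  {N : Type*} [TopologicalSpace N] [ChartedSpace (EuclideanSpace ℝ (Fin (2 * n + 1))) N]
  [IsManifold (𝓡 (2 * n + 1)) ∞ N] [T2Space M] [T2Space N]

namespace ContactQuadruple

variable {Q : ContactQuadruple n M N} {D : LinearConnection (𝓡 (2 * n)) M}
  {s : TwoTensor (𝓡 (2 * n)) M} {U : VectorField (𝓡 (2 * n)) M} {F : M → ℝ}
  {DP : LinearConnection (modelP n) (N × ℝ)}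

theorem mlieBracket_lift_E {X : VectorField (𝓡 (2 * n)) M} (hX : IsSmoothVF (𝓡 (2 * n)) X) :
    mlieBracket (modelP n) (Q.lift X) Q.E = 0 := by
  rw [mlieBracket_swap, Q.lift_eq_comb, Q.mlieBracket_E_comb hX contMDiff_zero_fun
    contMDiff_zero_fun, neg_zero]

theorem mlieBracket_E_lift {X : VectorField (𝓡 (2 * n)) M} (hX : IsSmoothVF (𝓡 (2 * n)) X) :
    mlieBracket (modelP n) Q.E (Q.lift X) = 0 := by
  rw [Q.lift_eq_comb, Q.mlieBracket_E_comb hX contMDiff_zero_fun contMDiff_zero_fun]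

theorem nabla_zero_right (W : VectorField (modelP n) (N × ℝ)) : nabla DP W 0 = 0 := by
  funext q
  rw [nabla_apply, DP.zero]
  rfl

/-- The form on `T_xM` as a bilinear map. -/
def bilinearForm (Q : ContactQuadruple n M N) (x : M) :
    TangentSpace (𝓡 (2 * n)) x →ₗ[ℝ] TangentSpace (𝓡 (2 * n)) x →ₗ[ℝ] ℝ :=
  (ContinuousLinearMap.coeLM ℝ).comp (Q.Ω x).toLinearMap

theorem bilinearForm_nondegenerate (x : M) (v : TangentSpace (𝓡 (2 * n)) x)
    (h : ∀ w, Q.bilinearForm x w v = 0) : v = 0 :=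
  Q.symplectic.eq_of_forall fun z => by rw [map_zero]; exact h z

-- The same identity with `E` as third direction, once `B = 0`. Then `R(X̄, E)V̄` is a multiple of
-- `∂_s` with coefficient `Ω(V, A X)`, and the horizontal part is algebraic in `A`.
set_option maxHeartbeats 1000000 in
theorem IsInduced.bianchi_E (h : Q.IsInduced D s U F DP)
    (hD : IsSymplecticConnection (𝓡 (2 * n)) Q.Ω D)
    (hs : IsSmoothTwoTensor (𝓡 (2 * n)) s) (hss : ∀ x u v, s x u v = s x v u)
    (hU : IsSmoothVF (𝓡 (2 * n)) U) (hF : ContMDiff (𝓡 (2 * n)) 𝓘(ℝ, ℝ) ∞ F)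
    (hH : ∀ (q : N × ℝ) (u v w : TangentSpace (𝓡 (2 * n)) (Q.proj q)),
      tensorH Q D s (Q.proj q) u v w = 0)
    (hB : ∀ (q : N × ℝ) (u v : TangentSpace (𝓡 (2 * n)) (Q.proj q)),
      tensorB Q D hs U (Q.proj q) u v = 0) (p : N × ℝ)
    (u v z : TangentSpace (𝓡 (2 * n)) (Q.proj p)) :
    Q.Ω (Q.proj p) z (tensorA Q D U F s (Q.proj p) v) • u
      - Q.Ω (Q.proj p) u z • tensorA Q D U F s (Q.proj p) v
      - Q.Ω (Q.proj p) z (tensorA Q D U F s (Q.proj p) u) • v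
      + Q.Ω (Q.proj p) v z • tensorA Q D U F s (Q.proj p) u = 0 := by
  have hDP := h.contMDiff hD.smooth hs hU hF
  have hR := h.curvature_vec hD hs hss hU hF p
  obtain ⟨X, hX, rfl⟩ := exists_isSmoothVF_apply_eq (Q.proj p) u
  obtain ⟨Y, hY, rfl⟩ := exists_isSmoothVF_apply_eq (Q.proj p) v
  obtain ⟨V, hV, rfl⟩ := exists_isSmoothVF_apply_eq (Q.proj p) z
  have hb := second_bianchi_apply hDP (Q.isSmoothVF_lift hX) (Q.isSmoothVF_lift hY)
    Q.isSmoothVF_E (Q.isSmoothVF_lift hV) p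
  have e1 : curvOp (modelP n) DP (Q.lift X) (Q.lift Y) (Q.lift V) = 0 := by
    rw [h.curvOp_lift_lift_lift hs hD hX hY hV]
    funext q
    refine Eq.trans (Q.vec_congr (hH q _ _ _) rfl ?_) (Q.vec_zero q)
    simp [tensorC, hB]
  have e2 {A : VectorField (𝓡 (2 * n)) M} (hA : IsSmoothVF (𝓡 (2 * n)) A) :
      curvOp (modelP n) DP (Q.lift A) Q.E (Q.lift V) =
        Q.comb 0 0 fun x => Q.Ω x (V x) (tensorA Q D U F s x (A x)) := by
    rw [h.curvOp_lift_E_lift hs hD hss hU hA hV]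
    exact funext fun q => Q.vec_congr ((congrArg ((2 : ℝ) • ·) (hB q _ _)).trans (smul_zero _)) rfl rfl
  have e3 : curvOp (modelP n) DP Q.E (Q.lift X) (Q.lift V) =
        Q.comb 0 0 fun x => -1 * Q.Ω x (V x) (tensorA Q D U F s x (X x)) := by
    rw [curvOp_swap, e2 hX]
    funext q
    simp only [Pi.neg_apply, comb]
    rw [← neg_one_smul ℝ, vec_smul]
    exact Q.vec_congr (smul_zero _) (mul_zero _) rfl
  have en (A : VectorField (𝓡 (2 * n)) M) : nabla DP (Q.lift A) (Q.lift V) p = Q.vec p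
      (nabla D A V (Q.proj p)) (-1 / 2 * Q.Ω (Q.proj p) (A (Q.proj p)) (V (Q.proj p)))
        (-1 * s (Q.proj p) (A (Q.proj p)) (V (Q.proj p))) := by
    rw [h.nabla_lift_lift hV]; rfl
  have eE : nabla DP Q.E (Q.lift V) p = Q.vec p ((2 : ℝ) • symplEnd (𝓡 (2 * n)) Q.Ω s (Q.proj p)
      (V (Q.proj p))) 0 (Q.Ω (Q.proj p) (V (Q.proj p)) (U (Q.proj p))) := by
    rw [h.nabla_E_lift hV]; rfl
  have el : mlieBracket (modelP n) (Q.lift X) (Q.lift Y) p =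
        Q.vec p (mlieBracket (𝓡 (2 * n)) X Y (Q.proj p))
          (-1 * Q.Ω (Q.proj p) (X (Q.proj p)) (Y (Q.proj p))) 0 := by
    rw [mlieBracket_lift hX hY]; rfl
  have hc {A : VectorField (𝓡 (2 * n)) M} (hA : IsSmoothVF (𝓡 (2 * n)) A) :=
    Q.symplectic.smooth.apply hV (isSmoothVF_tensorA (Q := Q) hs hD.smooth hU hF hA)
  have e0 : (0 : VectorField (modelP n) (N × ℝ)) p = Q.vec p 0 0 0 := (Q.vec_zero p).symm
  rw [e1, e2 hY, e3, en, en, eE, el, mlieBracket_lift_E hY, mlieBracket_E_lift hX,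
    nabla_zero_right, e0] at hb
  have hb' := congrArg (Q.dproj p) hb
  simp only [map_add, map_sub, map_zero (Q.dproj p), lift_apply, E_eq_vec, hR, dproj_vec, hH, hB,
    h.dproj_nabla_lift _ (hc hY), h.dproj_nabla_lift _ (contMDiff_cmul (-1) (hc hX))] at hb'
  rw [← hb']
  module

-- The last remaining case: directions `X̄`, `Ȳ`, `E` acting on `E`, where only the 1-form is left
-- in the curvature.
set_option maxHeartbeats 1000000 in
theorem IsInduced.bianchi_E_E (h : Q.IsInduced D s U F DP)
    (hD : IsSymplecticConnection (𝓡 (2 * n)) Q.Ω D)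
    (hs : IsSmoothTwoTensor (𝓡 (2 * n)) s) (hss : ∀ x u v, s x u v = s x v u)
    (hU : IsSmoothVF (𝓡 (2 * n)) U) (hF : ContMDiff (𝓡 (2 * n)) 𝓘(ℝ, ℝ) ∞ F)
    (hH : ∀ (q : N × ℝ) (u v w : TangentSpace (𝓡 (2 * n)) (Q.proj q)),
      tensorH Q D s (Q.proj q) u v w = 0)
    (hB : ∀ (q : N × ℝ) (u v : TangentSpace (𝓡 (2 * n)) (Q.proj q)),
      tensorB Q D hs U (Q.proj q) u v = 0)
    (hA : ∀ (q : N × ℝ) (u : TangentSpace (𝓡 (2 * n)) (Q.proj q)),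
      tensorA Q D U F s (Q.proj q) u = 0) (p : N × ℝ)
    (u v : TangentSpace (𝓡 (2 * n)) (Q.proj p)) :
    formB U F s (Q.proj p) v • u - formB U F s (Q.proj p) u • v = 0 := by
  have hDP := h.contMDiff hD.smooth hs hU hF
  have hR := h.curvature_vec hD hs hss hU hF
  obtain ⟨X, hX, rfl⟩ := exists_isSmoothVF_apply_eq (Q.proj p) u
  obtain ⟨Y, hY, rfl⟩ := exists_isSmoothVF_apply_eq (Q.proj p) v
  have hb := second_bianchi_apply hDP (Q.isSmoothVF_lift hX) (Q.isSmoothVF_lift hY)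
    Q.isSmoothVF_E Q.isSmoothVF_E p
  have e1 : curvOp (modelP n) DP (Q.lift X) (Q.lift Y) Q.E = 0 := by
    funext q
    rw [← curvature_apply hDP (Q.isSmoothVF_lift hX) (Q.isSmoothVF_lift hY) Q.isSmoothVF_E,
      lift_apply, lift_apply, E_eq_vec, hR]
    refine Eq.trans (Q.vec_congr ?_ rfl ?_) (Q.vec_zero q)
    · simp [hH, hB]
    · simp [tensorC, hB, hA]
  have e2 {A : VectorField (𝓡 (2 * n)) M} (hX : IsSmoothVF (𝓡 (2 * n)) A) :
      curvOp (modelP n) DP (Q.lift A) Q.E Q.E = Q.comb 0 0 fun x => formB U F s x (A x) := by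
    rw [h.curvOp_lift_E_E hs hss hU hF hX]
    exact funext fun q => Q.vec_congr ((congrArg ((-2 : ℝ) • ·) (hA q _)).trans (smul_zero _)) rfl rfl
  have e3 : curvOp (modelP n) DP Q.E (Q.lift X) Q.E =
        Q.comb 0 0 fun x => -1 * formB U F s x (X x) := by
    rw [curvOp_swap, e2 hX]
    funext q
    simp only [Pi.neg_apply, comb]
    rw [← neg_one_smul ℝ, vec_smul]
    exact Q.vec_congr (smul_zero _) (mul_zero _) rfl
  have en (A : VectorField (𝓡 (2 * n)) M) : nabla DP (Q.lift A) Q.E p = Q.vec p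
      ((2 : ℝ) • symplEnd (𝓡 (2 * n)) Q.Ω s (Q.proj p) (A (Q.proj p))) 0
        (Q.Ω (Q.proj p) (A (Q.proj p)) (U (Q.proj p))) := by
    rw [h.nabla_lift_E]; rfl
  have eE : nabla DP Q.E Q.E p = Q.vec p ((-2 : ℝ) • U (Q.proj p)) 0 (F (Q.proj p)) := by
    rw [h.nabla_E_E]; rfl
  have el : mlieBracket (modelP n) (Q.lift X) (Q.lift Y) p =
        Q.vec p (mlieBracket (𝓡 (2 * n)) X Y (Q.proj p))
          (-1 * Q.Ω (Q.proj p) (X (Q.proj p)) (Y (Q.proj p))) 0 := by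
    rw [mlieBracket_lift hX hY]; rfl
  have hc {A : VectorField (𝓡 (2 * n)) M} (hX : IsSmoothVF (𝓡 (2 * n)) A) :=
    contMDiff_formB hs hU hF hX
  have e0 : (0 : VectorField (modelP n) (N × ℝ)) p = Q.vec p 0 0 0 := (Q.vec_zero p).symm
  rw [e1, e2 hY, e3, en, en, eE, el, mlieBracket_lift_E hY, mlieBracket_E_lift hX,
    nabla_zero_right, e0] at hb
  have hb' := congrArg (Q.dproj p) hb
  simp only [map_add, map_sub, map_zero (Q.dproj p), lift_apply, E_eq_vec, hR, dproj_vec, hH, hB, hA,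
    h.dproj_nabla_lift _ (hc hY), h.dproj_nabla_lift _ (contMDiff_cmul (-1) (hc hX))] at hb'
  rw [← hb']
  module

/-- The unknowns are eliminated in the order `C`, `B`, `A`, 1-form, as each Bianchi identity becomes
usable only when the preceding ones vanish. -/
theorem IsInduced.isFlat_of_tensorH_eq_zero (hn : 2 ≤ n)
    (hD : IsSymplecticConnection (𝓡 (2 * n)) Q.Ω D)
    (h : Q.IsInduced D (Q.specialS D) (Q.specialU D) (Q.specialF D) DP)
    (hH : ∀ (q : N × ℝ) (u v w : TangentSpace (𝓡 (2 * n)) (Q.proj q)),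
      tensorH Q D (Q.specialS D) (Q.proj q) u v w = 0) : IsFlat (modelP n) DP := by
  have hs := Q.isSmoothTwoTensor_specialS hD.smooth
  have hss := Q.specialS_symm hD
  have hU := Q.isSmoothVF_specialU hD.smooth
  have hF := Q.contMDiff_specialF hD.smooth
  have hn0 : n ≠ 0 := by omega
  have hsk (x : M) (u v : TangentSpace (𝓡 (2 * n)) x) :
    Q.bilinearForm x u v = -Q.bilinearForm x v u := Q.symplectic.swap u v
  have hBs (x : M) (u v w : TangentSpace (𝓡 (2 * n)) x) :=
    apply_tensorB_symm (U := Q.specialU D) hD hs hss x u v w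
  have hC (q : N × ℝ) (u v w : TangentSpace (𝓡 (2 * n)) (Q.proj q)) :
      tensorC Q D hs (Q.specialU D) (Q.proj q) u v w = 0 :=
    antisymmetrization_eq_zero (hsk _) (trace_id_tangentSpace _) (hBs _)
      (trace_tensorB_right hD hs hss _) (trace_tensorB_left hD.smooth _)
      (h.bianchi_lift hD hs hss hU hF hH q) u v w
  have hC' (q : N × ℝ) (u v w : TangentSpace (𝓡 (2 * n)) (Q.proj q)) :
      Q.Ω (Q.proj q) u (tensorB Q D hs (Q.specialU D) (Q.proj q) v w) =
        Q.Ω (Q.proj q) v (tensorB Q D hs (Q.specialU D) (Q.proj q) u w) :=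
    sub_eq_zero.1 (hC q u v w)
  -- With `C = 0`, the form `Ω(u, B(v, w))` is symmetric under two generating transpositions, so `B`
  -- itself is symmetric and the differences in the Bianchi identity drop out.
  have hBc (q : N × ℝ) (u v : TangentSpace (𝓡 (2 * n)) (Q.proj q)) :
      tensorB Q D hs (Q.specialU D) (Q.proj q) u v =
        tensorB Q D hs (Q.specialU D) (Q.proj q) v u :=
    Q.symplectic.eq_of_forall fun z => by rw [hBs, hC', hBs]
  have hB (q : N × ℝ) (u v : TangentSpace (𝓡 (2 * n)) (Q.proj q)) :
      tensorB Q D hs (Q.specialU D) (Q.proj q) u v = 0 := by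
    refine bilinear_eq_zero (hsk _) (bilinearForm_nondegenerate _) hn (trace_id_tangentSpace _)
      (hBs _) (hC' q) (fun u v w z => ?_) u v
    have := h.bianchi_lift hD hs hss hU hF hH q u v w z
    rw [hC, hC, hC, hBc q v w, hBc q w u, hBc q u v] at this
    simp only [sub_self, smul_zero, zero_smul, add_zero, zero_sub, neg_eq_zero] at this
    exact (smul_eq_zero.1 this).resolve_left two_ne_zero
  have hA (q : N × ℝ) (u : TangentSpace (𝓡 (2 * n)) (Q.proj q)) :
      tensorA Q D (Q.specialU D) (Q.specialF D) (Q.specialS D) (Q.proj q) u = 0 :=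
    endomorphism_eq_zero (hsk _) (bilinearForm_nondegenerate _) hn0 (trace_id_tangentSpace _)
      (trace_tensorA hn0 _) (h.bianchi_E hD hs hss hU hF hH hB q) u
  have hb (q : N × ℝ) (u : TangentSpace (𝓡 (2 * n)) (Q.proj q)) :
      formB (Q.specialU D) (Q.specialF D) (Q.specialS D) (Q.proj q) u = 0 := by
    -- `formB` is a bare function; symmetry of `ŝ` lets it be written as an honest linear
    -- functional.
    let φ : TangentSpace (𝓡 (2 * n)) (Q.proj q) →ₗ[ℝ] ℝ :=
      (mvfderiv (𝓡 (2 * n)) (Q.specialF D) (Q.proj q)).toLinearMap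
        + (4 : ℝ) • (Q.specialS D (Q.proj q) (Q.specialU D (Q.proj q))).toLinearMap
    have e (u) : formB (Q.specialU D) (Q.specialF D) (Q.specialS D) (Q.proj q) u = φ u := by
      rw [formB, hss]; rfl
    rw [e]
    refine functional_eq_zero hn0 (trace_id_tangentSpace _) (fun u v => ?_) u
    rw [← e, ← e]
    exact h.bianchi_E_E hD hs hss hU hF hH hB hA q u v
  intro p
  ext x y z : 3
  rw [← Q.vec_components p x, ← Q.vec_components p y, ← Q.vec_components p z,
    h.curvature_vec hD hs hss hU hF]
  refine Eq.trans (Q.vec_congr ?_ rfl ?_) (Q.vec_zero p)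
  · simp [hH, hB, hA]
  · simp [hC, hA, hb]

end ContactQuadruple
end Quadruple

end SymplecticInduction

end

open SymplecticInduction in
theorem theorem4p1 (n : ℕ) (hn : 2 ≤ n)
    {M : Type*} [TopologicalSpace M] [T2Space M] [SecondCountableTopology M]
    [ChartedSpace (EuclideanSpace ℝ (Fin (2 * n))) M] [IsManifold (𝓡 (2 * n)) ∞ M]
    {N : Type*} [TopologicalSpace N] [T2Space N] [SecondCountableTopology N]
    [ChartedSpace (EuclideanSpace ℝ (Fin (2 * n + 1))) N] [IsManifold (𝓡 (2 * n + 1)) ∞ N]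
    (Q : ContactQuadruple n M N)
    (D : LinearConnection (𝓡 (2 * n)) M)
    (hD : IsSymplecticConnection (𝓡 (2 * n)) Q.Ω D) :
    IsSymplecticForm (modelP n) Q.μ ∧
    -- the formulas define a unique linear connection, and it is symplectic for all `ŝ`, `U`, `f`;
    -- the fields `E` and `∂_s` are affine
    (∀ (s : TwoTensor (𝓡 (2 * n)) M) (U : VectorField (𝓡 (2 * n)) M) (f : M → ℝ),
      IsSmoothTwoTensor (𝓡 (2 * n)) s → (∀ x u v, s x u v = s x v u) →
      IsSmoothVF (𝓡 (2 * n)) U → ContMDiff (𝓡 (2 * n)) 𝓘(ℝ, ℝ) ∞ f →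
      (∃ DP, Q.IsInduced D s U f DP) ∧
      (∀ DP DP', Q.IsInduced D s U f DP → Q.IsInduced D s U f DP' →
        ∀ W p, DiffVFAt (modelP n) W p → DP W p = DP' W p) ∧
      (∀ DP, Q.IsInduced D s U f DP →
        IsSymplecticConnection (modelP n) Q.μ DP ∧
        IsAffineVF (modelP n) DP Q.E ∧ IsAffineVF (modelP n) DP Q.S)) ∧
    -- `E` is symplectic and `∂_s` is conformal
    (∀ X Y, IsSmoothVF (modelP n) X → IsSmoothVF (modelP n) Y →
      ∀ p, lieDerivTwo (modelP n) Q.μ Q.E X Y p = 0) ∧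
    (∀ X Y, IsSmoothVF (modelP n) X → IsSmoothVF (modelP n) Y →
      ∀ p, lieDerivTwo (modelP n) Q.μ Q.S X Y p = 2 * Q.μ p (X p) (Y p)) ∧
    -- the special choice of `ŝ`, `U`, `f` is admissible
    IsSmoothTwoTensor (𝓡 (2 * n)) (Q.specialS D) ∧
    (∀ x u v, Q.specialS D x u v = Q.specialS D x v u) ∧
    IsSmoothVF (𝓡 (2 * n)) (Q.specialU D) ∧
    ContMDiff (𝓡 (2 * n)) 𝓘(ℝ, ℝ) ∞ (Q.specialF D) ∧
    -- the connection obtained from the special choice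
    (∀ DP, Q.IsInduced D (Q.specialS D) (Q.specialU D) (Q.specialF D) DP →
      IsRicciFlat (modelP n) DP ∧
      (IsRicciType (𝓡 (2 * n)) n Q.Ω D → IsFlat (modelP n) DP) ∧
      (IsLocallySymmetric (modelP n) DP →
        IsRicciTypeOn (𝓡 (2 * n)) n Q.Ω D (Set.range Q.π) ∧
        (Function.Surjective Q.π → IsRicciType (𝓡 (2 * n)) n Q.Ω D) ∧
        IsFlat (modelP n) DP)) := by

  have hs := Q.isSmoothTwoTensor_specialS hD.smooth
  have hU := Q.isSmoothVF_specialU hD.smooth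
  have hF := Q.contMDiff_specialF hD.smooth
  refine ⟨Q.isSymplecticForm_μ, fun s U f hs hss hU hf =>
    ⟨⟨_, Q.isInduced_inducedConnection D s U f⟩, fun _ _ h h' _ _ hW => h.eq h' hW, fun DP h =>
      ⟨h.isSymplecticConnection hD hs hss hU hf,
        h.isAffineVF hD.smooth hs hU hf Q.isSmoothVF_E fun _ _ _ => Q.mlieBracket_E_comb,
        h.isAffineVF hD.smooth hs hU hf Q.isSmoothVF_S fun _ _ _ => Q.mlieBracket_S_comb⟩⟩,
    fun _ _ hX hY p => Q.lieDerivTwo_E hX hY p, fun _ _ hX hY p => Q.lieDerivTwo_S hX hY p,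
    hs, Q.specialS_symm hD, hU, hF, fun DP h => ⟨h.isRicciFlat (by omega) hD, fun hr =>
      h.isFlat_of_tensorH_eq_zero hn hD fun q u v w =>
        (Q.tensorH_special _ u v w).trans (hr _ (Set.mem_univ _) u v w), fun hls => ?_⟩⟩
  have hflat := h.isFlat_of_isLocallySymmetric hD.smooth hs hU hF hls
  have hr : IsRicciTypeOn (𝓡 (2 * n)) n Q.Ω D (Set.range Q.π) := by
    rintro _ ⟨y, rfl⟩ u v w
    -- The height `0` is immaterial. Flatness of `∇^P` yields information exactly at the points of
    -- `M` below `P`, that is on the image of `π`.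
    exact (Q.tensorH_special _ u v w).symm.trans
      (ContactQuadruple.tensorH_eq_zero_of_isFlat h hD hs hU hF hflat (y, 0) u v w)
  exact ⟨hr, fun hπ x _ => hr x (hπ x), hflat⟩
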